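/- **Notation.** For an integer $n\ge 0$ let $F(n)$ be the number of non-degenerate rectangles, in arbitrary orientation, whose four vertices are points of $\mathbb Z^2$ in $[0,n)\times[0,n)$. Put $$F_0(n)=\frac{n^2(n-1)^2}{4}+\frac{n(n-1)^2(n-2)}{12},\qquad F_1(n)=\sum_{\substack{u>v>0,\ x\ge y\ge 1\\ \gcd(u,v)=1,\ xu+yv\le n}}\mathrm{mult}(x,y)\,(n-xu-yv)(n-xv-yu),$$ where $\mathrm{mult}(x,y)=2$ if $x=y$ and $4$ otherwise. For $1\le d\le n$ put $N_d=\lfloor n/d\rfloor$ and $$S_d(n)=\sum_{\substack{a>b\ge1,\ x\ge y\ge1\\ ax+by\le N_d}}\mathrm{mult}(x,y)\,\bigl(n-d(ax+by)\bigr)\bigl(n-d(bx+ay)\bigr).$$ Computations take place on a unit-cost random access machine with integer registers and an indirectly addressed integer memory. One fixed program serves all inputs. Each access to a constant, register or memory cell, each $+,-,\times$ or floor division by a positive integer, each assignment and each test costs one step. Every number that occurs has absolute value bounded by a fixed power of the input size (words of $O(\log n)$ bits), and memory is counted in words. **Theorem.** 1. There is a program that on input $n$ computes $F(n)$ exactly,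 for $n\ge 2$ in $O(n\log^2 n)$ operations and with $O(n)$ memory; all numbers occurring are bounded by a fixed power of $n+2$. 2. For every $n$, $F(n)=F_0(n)+F_1(n)$ and $F_1(n)=\sum_{d\le n}\mu(d)\,S_d(n)$, where $\mu$ is the Möbius function. 3. For every $N$, with $B=\lfloor\sqrt N\rfloor$, the set of integer quadruples $(a,b,x,y)$ with $a>b\ge1$, $x\ge y\ge1$, $ax+by\le N$ is the disjoint union of its part with $x\le B$ and its part with $a\le B$, $x>B$. 4. Let $1\le d\le n$, $N=N_d$, $B=\lfloor\sqrt N\rfloor$. For a family $M=(M_{ij})$ and an integer $T\ge0$ write $$\Phi_{p,q}[M]=n^2M_{00}-nd(p+q)(M_{10}+M_{01})+d^2pq(M_{20}+M_{02})+d^2(p^2+q^2)M_{11},$$ $$\Delta_{p,q}[T]=\sum_{t=1}^{T}\bigl(n^2-2nd(p+q)t+d^2(p+q)^2t^2\bigr).$$ Let $\Phi_{p,q}=\Phi_{p,q}[M]$ with $M_{ij}=\sum_{X\ge Y\ge1,\ pX+qY\le N}X^iY^j$, let $\Phi^{\cap}_{p,q}=\Phi_{p,q}[M^\cap]$ with $M^{\cap}_{ij}$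 the same sum restricted to $X\le B$, and let $\Delta_{p,q}=\Delta_{p,q}[\lfloor N/(p+q)\rfloor]$, $\Delta^{\cap}_{p,q}=\Delta_{p,q}[\min(B,\lfloor N/(p+q)\rfloor)]$, $C_t=2\sum_{1\le s\le N/t}\lfloor\frac{s-1}{2}\rfloor(n-dts)^2$. Then $$S_d(n)=\sum_{1\le q<p\le B}\bigl(8\Phi_{p,q}-6\Delta_{p,q}-4\Phi^{\cap}_{p,q}+2\Delta^{\cap}_{p,q}\bigr)+\sum_{t=1}^{B}C_t .$$ 5. There is a program that on input $N,a,b\ge0$, $m\ge1$ computes the six moments $\sum_{x=0}^{N-1}x^p\lfloor\frac{ax+b}{m}\rfloor^q$, $(p,q)\in\{(0,1),(1,1),(2,1),(0,2),(1,2),(0,3)\}$, in $O(\log(m+1))$ operations and with $O(\log(m+1))$ memory; all numbers occurring are bounded by a fixed power of $N+m+a+b+2$. 6. There is a program that on input $n,d$ with $1\le d\le n$ computes $S_d(n)$ in $O(N_d\log(N_d+1))$ operations and with $O(N_d)$ memory; all numbers occurring are bounded by a fixed power of $n+2$. -/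

import Mathlib

namespace LatticeRect

/-! ### Lattice rectangles -/

/-- The lattice points of the half-open square `[0,n) × [0,n)`. -/
noncomputable def grid (n : ℕ) : Finset (ℤ × ℤ) :=
  Finset.Ico (0 : ℤ) n ×ˢ Finset.Ico (0 : ℤ) n

/-- `R` is the vertex set of a non-degenerate rectangle, in any orientation, with vertices in the
integer lattice. -/
def IsRectangle (R : Finset (ℤ × ℤ)) : Prop :=
  ∃ p v w : ℤ × ℤ, v ≠ 0 ∧ w ≠ 0 ∧ v.1 * w.1 + v.2 * w.2 = 0 ∧
    R = {p, p + v, p + w, p + v + w}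

/-- `F n`: the number of lattice rectangles contained in `[0,n) × [0,n)`. -/
noncomputable def F (n : ℕ) : ℕ :=
  Set.ncard {R : Finset (ℤ × ℤ) | R ⊆ grid n ∧ IsRectangle R}

/-- The closed-form part: axis-parallel rectangles and those with sides parallel to the
diagonals. -/
def F₀ (n : ℕ) : ℚ :=
  (n : ℚ) ^ 2 * ((n : ℚ) - 1) ^ 2 / 4 + (n : ℚ) * ((n : ℚ) - 1) ^ 2 * ((n : ℚ) - 2) / 12

/-- Multiplicity of a pair of side lengths `x ≥ y`. -/
def mult (x y : ℕ) : ℤ := if x = y then 2 else 4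

/-- The part of all primitive directions `(u,v)` with `u > v > 0`; quadruples are `(u,v,x,y)`. -/
def F₁ (n : ℕ) : ℤ :=
  ∑ z ∈ (Finset.Icc 1 n ×ˢ Finset.Icc 1 n ×ˢ Finset.Icc 1 n ×ˢ Finset.Icc 1 n).filter
      (fun z : ℕ × ℕ × ℕ × ℕ =>
        z.2.1 < z.1 ∧ z.2.2.2 ≤ z.2.2.1 ∧ Nat.Coprime z.1 z.2.1 ∧
          z.2.2.1 * z.1 + z.2.2.2 * z.2.1 ≤ n),
    mult z.2.2.1 z.2.2.2 *
      (((n : ℤ) - z.2.2.1 * z.1 - z.2.2.2 * z.2.1) *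
        ((n : ℤ) - z.2.2.1 * z.2.1 - z.2.2.2 * z.1))

/-! ### Divisor layers -/

/-- The quadruples `(a,b,x,y)` with `a > b ≥ 1`, `x ≥ y ≥ 1`, `a x + b y ≤ N`
(these conditions force all four entries into `[1,N]`). -/
def region (N : ℕ) : Finset (ℕ × ℕ × ℕ × ℕ) :=
  (Finset.Icc 1 N ×ˢ Finset.Icc 1 N ×ˢ Finset.Icc 1 N ×ˢ Finset.Icc 1 N).filter
    (fun z => z.2.1 < z.1 ∧ z.2.2.2 ≤ z.2.2.1 ∧ z.1 * z.2.2.1 + z.2.1 * z.2.2.2 ≤ N)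

/-- The part `x ≤ B` of the region. -/
def smallSides (N B : ℕ) : Finset (ℕ × ℕ × ℕ × ℕ) :=
  (region N).filter (fun z => z.2.2.1 ≤ B)

/-- The part `a ≤ B`, `x > B` of the region. -/
def smallDirections (N B : ℕ) : Finset (ℕ × ℕ × ℕ × ℕ) :=
  (region N).filter (fun z => z.1 ≤ B ∧ B < z.2.2.1)

/-- The divisor layer `S_d(n)`. -/
def layer (d n : ℕ) : ℤ :=
  ∑ z ∈ region (n / d),
    mult z.2.2.1 z.2.2.2 *
      (((n : ℤ) - d * (z.1 * z.2.2.1 + z.2.1 * z.2.2.2)) *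
        ((n : ℤ) - d * (z.2.1 * z.2.2.1 + z.1 * z.2.2.2)))

/-- `M_{ij}(p,q;N) = ∑ X^i Y^j` over `X ≥ Y ≥ 1`, `p X + q Y ≤ N` (used for `p ≥ 1` only). -/
def moment (p q N i j : ℕ) : ℤ :=
  ∑ z ∈ (Finset.Icc 1 N ×ˢ Finset.Icc 1 N).filter
      (fun z : ℕ × ℕ => z.2 ≤ z.1 ∧ p * z.1 + q * z.2 ≤ N),
    (z.1 : ℤ) ^ i * (z.2 : ℤ) ^ j

/-- The capped moment: as `moment`, with the additional restriction `X ≤ B`. -/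
def cappedMoment (p q N B i j : ℕ) : ℤ :=
  ∑ z ∈ (Finset.Icc 1 B ×ˢ Finset.Icc 1 B).filter
      (fun z : ℕ × ℕ => z.2 ≤ z.1 ∧ p * z.1 + q * z.2 ≤ N),
    (z.1 : ℤ) ^ i * (z.2 : ℤ) ^ j

/-- `D_j(T) = ∑_{t=1}^T t^j`. -/
def powerSum (j T : ℕ) : ℤ := ∑ t ∈ Finset.Icc 1 T, (t : ℤ) ^ j

/-- The quadratic combination `Φ` of a family of moments `M`. -/
def PhiOf (n d p q : ℕ) (M : ℕ → ℕ → ℤ) : ℤ :=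
  (n : ℤ) ^ 2 * M 0 0 - n * d * (p + q) * (M 1 0 + M 0 1)
    + (d : ℤ) ^ 2 * (p * q) * (M 2 0 + M 0 2)
    + (d : ℤ) ^ 2 * ((p : ℤ) ^ 2 + (q : ℤ) ^ 2) * M 1 1

/-- The diagonal combination `Δ` up to `T`. -/
def DeltaOf (n d p q T : ℕ) : ℤ :=
  (n : ℤ) ^ 2 * powerSum 0 T - 2 * n * d * (p + q) * powerSum 1 T
    + (d : ℤ) ^ 2 * ((p : ℤ) + q) ^ 2 * powerSum 2 T

/-- `Φ_{p,q}^{(d)}`. -/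
def Phi (n d p q : ℕ) : ℤ := PhiOf n d p q (moment p q (n / d))

/-- `Δ_{p,q}^{(d)}`. -/
def Delta (n d p q : ℕ) : ℤ := DeltaOf n d p q (n / d / (p + q))

/-- `Φ_{p,q}^{(d),∩}` with cap `B = ⌊√N_d⌋`. -/
def PhiCap (n d p q : ℕ) : ℤ :=
  PhiOf n d p q (cappedMoment p q (n / d) (Nat.sqrt (n / d)))

/-- `Δ_{p,q}^{(d),∩}` with cap `B = ⌊√N_d⌋`. -/
def DeltaCap (n d p q : ℕ) : ℤ :=
  DeltaOf n d p q (min (Nat.sqrt (n / d)) (n / d / (p + q)))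

/-- The diagonal-side term `C_t^{(d)}`. -/
def diagSide (n d t : ℕ) : ℤ :=
  2 * ∑ s ∈ Finset.Icc 1 (n / d / t), (((s - 1) / 2 : ℕ) : ℤ) * ((n : ℤ) - d * t * s) ^ 2

/-- The floor moment `∑_{x<N} x^p ⌊(a x + b)/m⌋^q`. -/
def floorMoment (p q N m a b : ℕ) : ℕ :=
  ∑ x ∈ Finset.range N, x ^ p * ((a * x + b) / m) ^ q

/-! ### The random access machine

Programs are finite and written in structured form. A state consists of registers, addressed
directly by the program, and an integer memory with indirect addressing. The machine has two
parameters: the number `S` of memory cells and the largest absolute value `W` of a machine word.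
A computation that leaves these limits, or divides by a non-positive number, is stuck. Each
constant, register access, memory access, arithmetic operation, assignment and test costs one
step. -/

/-- A machine state. -/
structure State where
  reg : ℕ → ℤ
  mem : ℕ → ℤ

/-- Integer expressions. -/
inductive Expr where
  | const (c : ℤ)
  | reg (i : ℕ)
  | load (addr : Expr)
  | add (e₁ e₂ : Expr)
  | sub (e₁ e₂ : Expr)
  | mul (e₁ e₂ : Expr)
  | div (e₁ e₂ : Expr)

/-- Value of an expression; `div` is the floor of the quotient (for positive divisors, the only
ones that `Expr.Ok` admits). -/
def Expr.eval (s : State) : Expr → ℤ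
  | .const c => c
  | .reg i => s.reg i
  | .load a => s.mem (a.eval s).toNat
  | .add e₁ e₂ => e₁.eval s + e₂.eval s
  | .sub e₁ e₂ => e₁.eval s - e₂.eval s
  | .mul e₁ e₂ => e₁.eval s * e₂.eval s
  | .div e₁ e₂ => e₁.eval s / e₂.eval s

/-- Number of steps for the evaluation of an expression. -/
def Expr.cost : Expr → ℕ
  | .const _ => 1
  | .reg _ => 1
  | .load a => a.cost + 1
  | .add e₁ e₂ => e₁.cost + e₂.cost + 1
  | .sub e₁ e₂ => e₁.cost + e₂.cost + 1
  | .mul e₁ e₂ => e₁.cost + e₂.cost + 1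
  | .div e₁ e₂ => e₁.cost + e₂.cost + 1

/-- The evaluation stays within the limits of the machine: every intermediate value is a machine
word, every address is one of the `S` cells, and every divisor is positive. -/
def Expr.Ok (S W : ℕ) (s : State) : Expr → Prop
  | .const c => |c| ≤ W
  | .reg i => |s.reg i| ≤ W
  | .load a => a.Ok S W s ∧ 0 ≤ a.eval s ∧ a.eval s < S ∧ |s.mem (a.eval s).toNat| ≤ W
  | .add e₁ e₂ => e₁.Ok S W s ∧ e₂.Ok S W s ∧ |e₁.eval s + e₂.eval s| ≤ W
  | .sub e₁ e₂ => e₁.Ok S W s ∧ e₂.Ok S W s ∧ |e₁.eval s - e₂.eval s| ≤ W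
  | .mul e₁ e₂ => e₁.Ok S W s ∧ e₂.Ok S W s ∧ |e₁.eval s * e₂.eval s| ≤ W
  | .div e₁ e₂ => e₁.Ok S W s ∧ e₂.Ok S W s ∧ 0 < e₂.eval s

/-- Programs. Tests ask whether an expression is positive. -/
inductive Prog where
  | skip
  | assign (i : ℕ) (e : Expr)
  | store (addr e : Expr)
  | seq (P Q : Prog)
  | ifPos (e : Expr) (P Q : Prog)
  | whilePos (e : Expr) (P : Prog)

/-- `Exec S W P s t s'`: on the machine with `S` memory cells and word bound `W`, program `P`
started in state `s` halts after exactly `t` steps in state `s'`. -/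
inductive Exec (S W : ℕ) : Prog → State → ℕ → State → Prop
  | skip (s : State) : Exec S W .skip s 1 s
  | assign (i : ℕ) (e : Expr) (s : State) (he : e.Ok S W s) :
      Exec S W (.assign i e) s (e.cost + 1) ⟨Function.update s.reg i (e.eval s), s.mem⟩
  | store (a e : Expr) (s : State) (ha : a.Ok S W s) (he : e.Ok S W s)
      (h₀ : 0 ≤ a.eval s) (h₁ : a.eval s < S) :
      Exec S W (.store a e) s (a.cost + e.cost + 1)
        ⟨s.reg, Function.update s.mem (a.eval s).toNat (e.eval s)⟩
  | seq (P Q : Prog) (s s₁ s₂ : State) (t₁ t₂ : ℕ) (h₁ : Exec S W P s t₁ s₁)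
      (h₂ : Exec S W Q s₁ t₂ s₂) : Exec S W (.seq P Q) s (t₁ + t₂) s₂
  | ifTrue (e : Expr) (P Q : Prog) (s s₁ : State) (t : ℕ) (he : e.Ok S W s)
      (hpos : 0 < e.eval s) (h : Exec S W P s t s₁) :
      Exec S W (.ifPos e P Q) s (e.cost + 1 + t) s₁
  | ifFalse (e : Expr) (P Q : Prog) (s s₁ : State) (t : ℕ) (he : e.Ok S W s)
      (hpos : ¬ 0 < e.eval s) (h : Exec S W Q s t s₁) :
      Exec S W (.ifPos e P Q) s (e.cost + 1 + t) s₁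
  | whileDone (e : Expr) (P : Prog) (s : State) (he : e.Ok S W s) (hpos : ¬ 0 < e.eval s) :
      Exec S W (.whilePos e P) s (e.cost + 1) s
  | whileStep (e : Expr) (P : Prog) (s s₁ s₂ : State) (t₁ t₂ : ℕ) (he : e.Ok S W s)
      (hpos : 0 < e.eval s) (h₁ : Exec S W P s t₁ s₁)
      (h₂ : Exec S W (.whilePos e P) s₁ t₂ s₂) :
      Exec S W (.whilePos e P) s (e.cost + 1 + t₁ + t₂) s₂

/-- The initial state: the inputs in registers `0, 1, …`, zero everywhere else. -/
def initState (inp : List ℤ) : State := ⟨fun i => inp.getD i 0, fun _ => 0⟩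

/-- On input `inp` the program halts after `t` steps, within `S` memory cells and word bound `W`,
with the list `out` in registers `0, 1, …`. -/
def Outputs (P : Prog) (inp out : List ℤ) (t S W : ℕ) : Prop :=
  ∃ s : State, Exec S W P (initState inp) t s ∧ ∀ i < out.length, s.reg i = out.getD i 0

end LatticeRect

namespace LatticeRect

/-! ### Verification of programs -/

/-! Counting. A lattice rectangle is determined by its lowest vertex (the leftmost one, if two are
lowest) and its sides x(u,v) and y(-v,u) with (u,v) primitive, u > 0, v ≥ 0. Its bounding box
measures xu+yv by xv+yu, so it has (n-xu-yv)(n-xv-yu) positions if it fits and none otherwise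
(`F_eq_sum_positions`). The directions v = 0 and u = v = 1 give the polynomial `F₀`. Exchanging u
with v and x with y folds all other directions onto u > v, x ≥ y with weights 2 and 4; this is `F₁`.
Möbius inversion over gcd(u,v) replaces (u,v) by d(a,b) with a > b ≥ 1 arbitrary and produces the
layers (`F₁_eq_sum_moebius`).

One layer. Put N = ⌊n/d⌋ and B = ⌊√N⌋. Since ax ≤ N, one of a, x is at most B, and the summand is
symmetric under (a,b) ↔ (x,y). For x ≤ B fix (p,q) = (x,y): the pairs a > b contribute 4(Φ-Δ) if q <
p, and C_p if q = p. For a ≤ B < x fix (p,q) = (a,b): the pairs x ≥ y, of weight 4 and on the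
diagonal 2, contribute 4(Φ-Φ∩)-2(Δ-Δ∩). The total is `layer_formula`. It has at most B² ≤ N pairs
(p,q), so a layer costs O(N log(N+1)) as soon as each inner sum costs O(log).

The kernel. After an affine substitution each inner sum runs over the lattice points 1 ≤ y ≤
(ax+b)/m, 0 ≤ x < N', with a product of two affine forms as summand. A shear removes the integer
parts of a/m and b/m at the price of an explicit polynomial; a reflection exchanges the axes and
turns (m,a) into (a mod m, m). Both preserve products of affine forms (`lineSum_step`), so the
Euclidean algorithm evaluates the sum with a state of bounded length. The product am at least halves
in each round after the first (`fuel_step`), which gives O(log m) rounds. The numbers stay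
polynomial because |u₁|m+|u₂|a never grows (`FormBound.step`). The same kernel yields the six floor
moments, by writing powers of the column height as telescoping sums.

Everything together. The values μ(d) are sieved in memory while the loop over d runs, at cost O(n/d)
for each d. Summing N log(N+1) over the layers gives at most a constant times n log n times a
harmonic sum, which is O(n log² n).

Verification. `Runs` is a total-correctness triple with a time bound. Word sizes are controlled by a
calculus of exponents: if register i is at most D^(β i), every expression has a computable exponent,
and for a concrete program the comparison of exponents is decidable. -/

/-- Program `P`, started in `s`, halts after at most `T` steps in a state that satisfies `Q`. -/
def Runs (S W : ℕ) (P : Prog) (s : State) (T : ℕ) (Q : State → Prop) : Prop :=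
  ∃ t s', t ≤ T ∧ Exec S W P s t s' ∧ Q s'

section Rules

variable {S W : ℕ}

theorem Runs.weaken {P : Prog} {s : State} {T T' : ℕ} {Q Q' : State → Prop}
    (h : Runs S W P s T Q) (hT : T ≤ T') (hQ : ∀ s', Q s' → Q' s') : Runs S W P s T' Q' := by
  obtain ⟨t, s', ht, he, hq⟩ := h
  exact ⟨t, s', ht.trans hT, he, hQ _ hq⟩

theorem Runs.seq {P P' : Prog} {s : State} {T T' : ℕ} {R Q : State → Prop}
    (h : Runs S W P s T R) (h' : ∀ s', R s' → Runs S W P' s' T' Q) :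
    Runs S W (.seq P P') s (T + T') Q := by
  obtain ⟨t, s', ht, he, hr⟩ := h
  obtain ⟨t', s'', ht', he', hq⟩ := h' _ hr
  exact ⟨t + t', s'', by omega, .seq _ _ _ _ _ _ _ he he', hq⟩

theorem Runs.assign {i : ℕ} {e : Expr} {s : State} {Q : State → Prop} (he : e.Ok S W s)
    (hQ : Q ⟨Function.update s.reg i (e.eval s), s.mem⟩) :
    Runs S W (.assign i e) s (e.cost + 1) Q :=
  ⟨_, _, le_rfl, .assign i e s he, hQ⟩

theorem Runs.store {a e : Expr} {s : State} {Q : State → Prop} (ha : a.Ok S W s)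
    (he : e.Ok S W s) (h₀ : 0 ≤ a.eval s) (h₁ : a.eval s < S)
    (hQ : Q ⟨s.reg, Function.update s.mem (a.eval s).toNat (e.eval s)⟩) :
    Runs S W (.store a e) s (a.cost + e.cost + 1) Q :=
  ⟨_, _, le_rfl, .store a e s ha he h₀ h₁, hQ⟩

theorem Runs.ifPos {e : Expr} {P P' : Prog} {s : State} {T : ℕ} {Q : State → Prop}
    (he : e.Ok S W s) (h : 0 < e.eval s → Runs S W P s T Q)
    (h' : ¬ 0 < e.eval s → Runs S W P' s T Q) :
    Runs S W (.ifPos e P P') s (e.cost + 1 + T) Q := by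
  by_cases hp : 0 < e.eval s
  · obtain ⟨t, s', ht, hx, hq⟩ := h hp
    exact ⟨_, s', by omega, .ifTrue e P P' s s' t he hp hx, hq⟩
  · obtain ⟨t, s', ht, hx, hq⟩ := h' hp
    exact ⟨_, s', by omega, .ifFalse e P P' s s' t he hp hx, hq⟩

/-- A loop with at most `k` rounds, each of cost at most `c`. -/
theorem Runs.whileFuel {e : Expr} {P : Prog} {c : ℕ} {I : ℕ → State → Prop}
    (h : ∀ k s, I k s → e.Ok S W s ∧
      (0 < e.eval s → ∃ k', k = k' + 1 ∧ Runs S W P s c (I k'))) (k : ℕ) :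
    ∀ s, I k s → Runs S W (.whilePos e P) s (k * (e.cost + 1 + c) + (e.cost + 1))
      (fun s' => ∃ k', I k' s' ∧ ¬ 0 < e.eval s') := by
  induction k with
  | zero =>
    intro s hs
    obtain ⟨hok, hb⟩ := h 0 s hs
    have hn : ¬ 0 < e.eval s := fun hp => by
      obtain ⟨k', hk, -⟩ := hb hp
      omega
    exact ⟨_, s, by omega, .whileDone e P s hok hn, 0, hs, hn⟩
  | succ k ih =>
    intro s hs
    obtain ⟨hok, hb⟩ := h _ s hs
    by_cases hp : 0 < e.eval s
    · obtain ⟨k', hk, t, s₁, ht, hx, hI⟩ := hb hp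
      obtain rfl : k' = k := by omega
      obtain ⟨t₂, s₂, ht₂, hx₂, hq⟩ := ih s₁ hI
      refine ⟨_, s₂, ?_, .whileStep e P s s₁ s₂ t t₂ hok hp hx hx₂, hq⟩
      rw [Nat.add_mul]
      omega
    · exact ⟨_, s, by omega, .whileDone e P s hok hp, _, hs, hp⟩

/-- A loop with exactly `n` rounds, the `i`-th one of cost at most `c i`. -/
theorem Runs.whileCount {e : Expr} {P : Prog} {c : ℕ → ℕ} {I : ℕ → State → Prop} {n : ℕ}
    (hdone : ∀ s, I n s → e.Ok S W s ∧ ¬ 0 < e.eval s)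
    (hstep : ∀ i < n, ∀ s, I i s →
      e.Ok S W s ∧ 0 < e.eval s ∧ Runs S W P s (c i) (I (i + 1)))
    {s : State} (hs : I 0 s) :
    Runs S W (.whilePos e P) s
      (∑ i ∈ Finset.range n, (e.cost + 1 + c i) + (e.cost + 1)) (I n) := by
  have key : ∀ k j, j + k = n → ∀ s, I j s → Runs S W (.whilePos e P) s
      (∑ i ∈ Finset.Ico j n, (e.cost + 1 + c i) + (e.cost + 1)) (I n) := by
    intro k
    induction k with
    | zero =>
      intro j hj s hs
      obtain rfl : j = n := by omega
      obtain ⟨hok, hn⟩ := hdone s hs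
      exact ⟨_, s, by omega, .whileDone e P s hok hn, hs⟩
    | succ k ih =>
      intro j hj s hs
      obtain ⟨hok, hp, t, s₁, ht, hx, hI⟩ := hstep j (by omega) s hs
      obtain ⟨t₂, s₂, ht₂, hx₂, hq⟩ := ih (j + 1) (by omega) s₁ hI
      refine ⟨_, s₂, ?_, .whileStep e P s s₁ s₂ t t₂ hok hp hx hx₂, hq⟩
      rw [Finset.sum_eq_sum_Ico_succ_bot (by omega : j < n)]
      omega
  have := key n 0 (by omega) s hs
  rwa [← Finset.range_eq_Ico] at this

end Rules

/-! ### Polynomial bounds for expressions and blocks of assignments -/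

/-- If register `i` is bounded by `D ^ β i` then the value of `e` is bounded by
`D ^ e.degree β`. -/
def Expr.degree (β : ℕ → ℕ) : Expr → ℕ
  | .const c => c.natAbs
  | .reg i => β i
  | .load _ => 0
  | .add e₁ e₂ => max (e₁.degree β) (e₂.degree β) + 1
  | .sub e₁ e₂ => max (e₁.degree β) (e₂.degree β) + 1
  | .mul e₁ e₂ => e₁.degree β + e₂.degree β
  | .div e₁ e₂ => max (e₁.degree β) (e₂.degree β)

/-- The expression does not access the memory and its divisors are positive. -/
def Expr.Safe (s : State) : Expr → Prop
  | .const _ => True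
  | .reg _ => True
  | .load _ => False
  | .add e₁ e₂ => e₁.Safe s ∧ e₂.Safe s
  | .sub e₁ e₂ => e₁.Safe s ∧ e₂.Safe s
  | .mul e₁ e₂ => e₁.Safe s ∧ e₂.Safe s
  | .div e₁ e₂ => e₁.Safe s ∧ e₂.Safe s ∧ 0 < e₂.eval s

/-- All registers of the expression are among the first `k`. -/
def Expr.Below (k : ℕ) : Expr → Prop
  | .const _ => True
  | .reg i => i < k
  | .load _ => False
  | .add e₁ e₂ => e₁.Below k ∧ e₂.Below k
  | .sub e₁ e₂ => e₁.Below k ∧ e₂.Below k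
  | .mul e₁ e₂ => e₁.Below k ∧ e₂.Below k
  | .div e₁ e₂ => e₁.Below k ∧ e₂.Below k

theorem Expr.Below.eval_congr {k : ℕ} {s s' : State} (h : ∀ i < k, s'.reg i = s.reg i) :
    ∀ {e : Expr}, e.Below k → e.eval s' = e.eval s
  | .const _, _ => rfl
  | .reg i, hi => h i hi
  | .add _ _, hb => congrArg₂ (· + ·) (eval_congr h hb.1) (eval_congr h hb.2)
  | .sub _ _, hb => congrArg₂ (· - ·) (eval_congr h hb.1) (eval_congr h hb.2)
  | .mul _ _, hb => congrArg₂ (· * ·) (eval_congr h hb.1) (eval_congr h hb.2)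
  | .div _ _, hb => congrArg₂ (· / ·) (eval_congr h hb.1) (eval_congr h hb.2)

theorem Expr.Below.safe_congr {k : ℕ} {s s' : State} (h : ∀ i < k, s'.reg i = s.reg i) :
    ∀ {e : Expr}, e.Below k → e.Safe s → e.Safe s'
  | .const _, _, _ => trivial
  | .reg _, _, _ => trivial
  | .add _ _, hb, hs => ⟨safe_congr h hb.1 hs.1, safe_congr h hb.2 hs.2⟩
  | .sub _ _, hb, hs => ⟨safe_congr h hb.1 hs.1, safe_congr h hb.2 hs.2⟩
  | .mul _ _, hb, hs => ⟨safe_congr h hb.1 hs.1, safe_congr h hb.2 hs.2⟩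
  | .div _ _, hb, hs =>
    ⟨safe_congr h hb.1 hs.1, safe_congr h hb.2 hs.2.1, (eval_congr h hb.2).symm ▸ hs.2.2⟩

theorem Expr.Below.degree_congr {k : ℕ} {β β' : ℕ → ℕ} (h : ∀ i < k, β' i = β i) :
    ∀ {e : Expr}, e.Below k → e.degree β' = e.degree β
  | .const _, _ => rfl
  | .reg i, hi => h i hi
  | .add _ _, hb => by simp only [degree, degree_congr h hb.1, degree_congr h hb.2]
  | .sub _ _, hb => by simp only [degree, degree_congr h hb.1, degree_congr h hb.2]
  | .mul _ _, hb => by simp only [degree, degree_congr h hb.1, degree_congr h hb.2]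
  | .div _ _, hb => by simp only [degree, degree_congr h hb.1, degree_congr h hb.2]

theorem abs_le_pow_max_succ {D x y i j : ℕ} (hD : 2 ≤ D) (hx : x ≤ D ^ i) (hy : y ≤ D ^ j) :
    x + y ≤ D ^ (max i j + 1) := by
  have h1 : D ^ i ≤ D ^ max i j := Nat.pow_le_pow_right (by omega) (le_max_left _ _)
  have h2 : D ^ j ≤ D ^ max i j := Nat.pow_le_pow_right (by omega) (le_max_right _ _)
  calc x + y ≤ D ^ max i j * 2 := by omega
    _ ≤ D ^ (max i j + 1) := by rw [pow_succ]; exact Nat.mul_le_mul_left _ hD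

theorem abs_int_div_le (a b : ℤ) : |a / b| ≤ |a| := by
  have := Int.natAbs_ediv_le_natAbs a b
  rw [Int.abs_eq_natAbs, Int.abs_eq_natAbs]
  exact_mod_cast this

section Bounds

variable {S W D : ℕ} {β : ℕ → ℕ} {s : State}

theorem Expr.Safe.abs_eval_le (hD : 2 ≤ D) (hβ : ∀ i, |s.reg i| ≤ (D : ℤ) ^ β i) :
    ∀ {e : Expr}, e.Safe s → |e.eval s| ≤ (D : ℤ) ^ e.degree β := by
  have hD' : (2 : ℤ) ≤ D := by exact_mod_cast hD
  have hmax : ∀ {x y : ℤ} {i j : ℕ}, |x| ≤ (D : ℤ) ^ i → |y| ≤ (D : ℤ) ^ j →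
      |x| + |y| ≤ (D : ℤ) ^ (max i j + 1) := by
    intro x y i j hx hy
    rw [Int.abs_eq_natAbs] at hx hy ⊢
    rw [Int.abs_eq_natAbs]
    exact_mod_cast abs_le_pow_max_succ hD (by exact_mod_cast hx) (by exact_mod_cast hy)
  intro e
  induction e with
  | const c =>
    intro _
    simp only [eval, degree]
    rw [Int.abs_eq_natAbs]
    -- A literal c is assigned the exponent |c|. This is wasteful, but D ≥ 2 makes it valid, and
    -- only the boundedness of the exponents matters.
    have h1 : c.natAbs < 2 ^ c.natAbs := Nat.lt_two_pow_self
    have h2 : 2 ^ c.natAbs ≤ D ^ c.natAbs := Nat.pow_le_pow_left hD _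
    exact_mod_cast h1.le.trans h2
  | reg i => exact fun _ => hβ i
  | load a _ => exact fun h => h.elim
  | add e₁ e₂ ih₁ ih₂ =>
    intro h
    exact (abs_add_le _ _).trans (hmax (ih₁ h.1) (ih₂ h.2))
  | sub e₁ e₂ ih₁ ih₂ =>
    intro h
    exact (abs_sub _ _).trans (hmax (ih₁ h.1) (ih₂ h.2))
  | mul e₁ e₂ ih₁ ih₂ =>
    intro h
    simp only [eval, degree, abs_mul, pow_add]
    exact mul_le_mul (ih₁ h.1) (ih₂ h.2) (abs_nonneg _) (by positivity)
  | div e₁ e₂ ih₁ ih₂ =>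
    intro h
    exact (abs_int_div_le _ _).trans ((ih₁ h.1).trans
      (pow_le_pow_right₀ (by omega) (le_max_left _ _)))

/-- The exponent of a subexpression never exceeds that of the whole expression, so one inequality
controls every intermediate value. -/
theorem Expr.Safe.ok (hD : 2 ≤ D) (hβ : ∀ i, |s.reg i| ≤ (D : ℤ) ^ β i) :
    ∀ {e : Expr}, e.Safe s → D ^ e.degree β ≤ W → e.Ok S W s := by
  have hmono : ∀ {i j : ℕ}, i ≤ j → D ^ j ≤ W → D ^ i ≤ W := fun hij h =>
    (Nat.pow_le_pow_right (by omega) hij).trans h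
  have hb : ∀ {e : Expr}, e.Safe s → D ^ e.degree β ≤ W → |e.eval s| ≤ W := fun h hW =>
    (h.abs_eval_le hD hβ).trans (by exact_mod_cast hW)
  intro e
  induction e with
  | const c => exact fun h hW => hb h hW
  | reg i => exact fun h hW => hb h hW
  | load a _ => exact fun h => h.elim
  | add e₁ e₂ ih₁ ih₂ =>
    exact fun h hW => ⟨ih₁ h.1 (hmono (by simp only [degree]; omega) hW),
      ih₂ h.2 (hmono (by simp only [degree]; omega) hW), hb h hW⟩
  | sub e₁ e₂ ih₁ ih₂ =>
    exact fun h hW => ⟨ih₁ h.1 (hmono (by simp only [degree]; omega) hW),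
      ih₂ h.2 (hmono (by simp only [degree]; omega) hW), hb h hW⟩
  | mul e₁ e₂ ih₁ ih₂ =>
    exact fun h hW => ⟨ih₁ h.1 (hmono (by simp only [degree]; omega) hW),
      ih₂ h.2 (hmono (by simp only [degree]; omega) hW), hb h hW⟩
  | div e₁ e₂ ih₁ ih₂ =>
    exact fun h hW => ⟨ih₁ h.1 (hmono (by simp only [degree]; omega) hW),
      ih₂ h.2.1 (hmono (by simp only [degree]; omega) hW), h.2.2⟩

end Bounds

/-- A block of assignments. -/
def block : List (ℕ × Expr) → Prog
  | [] => .skip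
  | x :: l => .seq (.assign x.1 x.2) (block l)

/-- The effect of a block. -/
def evalBlock : List (ℕ × Expr) → State → State
  | [], s => s
  | x :: l, s => evalBlock l ⟨Function.update s.reg x.1 (x.2.eval s), s.mem⟩

/-- The number of steps of a block. -/
def blockCost : List (ℕ × Expr) → ℕ
  | [] => 1
  | x :: l => x.2.cost + 1 + blockCost l

/-- All expressions of the block are safe. -/
def BlockSafe : List (ℕ × Expr) → State → Prop
  | [], _ => True
  | x :: l, s => x.2.Safe s ∧ BlockSafe l ⟨Function.update s.reg x.1 (x.2.eval s), s.mem⟩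

/-- Degrees of the registers after a block. -/
def blockDegrees : List (ℕ × Expr) → (ℕ → ℕ) → ℕ → ℕ
  | [], β => β
  | x :: l, β => blockDegrees l (Function.update β x.1 (x.2.degree β))

/-- The largest degree that occurs in a block. -/
def blockDegree : List (ℕ × Expr) → (ℕ → ℕ) → ℕ
  | [], _ => 0
  | x :: l, β => max (x.2.degree β) (blockDegree l (Function.update β x.1 (x.2.degree β)))

/-- Straight-line code is verified by symbolic evaluation. For a concrete block there remain only
the positivity of its divisors and a numerical comparison of exponents. -/
theorem runs_block {S W D : ℕ} (hD : 2 ≤ D) : ∀ (l : List (ℕ × Expr)) {β : ℕ → ℕ} {s : State},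
    (∀ i, |s.reg i| ≤ (D : ℤ) ^ β i) → BlockSafe l s → D ^ blockDegree l β ≤ W →
    Runs S W (block l) s (blockCost l) (fun s' => s' = evalBlock l s ∧
      ∀ i, |s'.reg i| ≤ (D : ℤ) ^ blockDegrees l β i)
  | [], _, s, hβ, _, _ => ⟨1, s, le_rfl, .skip s, rfl, hβ⟩
  | x :: l, β, s, hβ, hs, hW => by
    have hmono : ∀ {i j : ℕ}, i ≤ j → D ^ j ≤ W → D ^ i ≤ W := fun hij h =>
      (Nat.pow_le_pow_right (by omega) hij).trans h
    refine Runs.seq (R := fun s' => s' = ⟨Function.update s.reg x.1 (x.2.eval s), s.mem⟩)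
      (Runs.assign (hs.1.ok hD hβ (hmono (le_max_left _ _) hW)) rfl) ?_
    rintro _ rfl
    refine runs_block hD l (β := Function.update β x.1 (x.2.degree β)) ?_ hs.2
      (hmono (le_max_right _ _) hW)
    intro i
    by_cases hi : i = x.1
    · subst hi
      simpa using hs.1.abs_eval_le hD hβ
    · simpa [Function.update_of_ne hi] using hβ i

theorem evalBlock_mem : ∀ (l : List (ℕ × Expr)) (s : State), (evalBlock l s).mem = s.mem
  | [], _ => rfl
  | _ :: l, _ => (evalBlock_mem l _)

theorem evalBlock_reg_of_notMem : ∀ {l : List (ℕ × Expr)} {s : State} {i : ℕ},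
    (∀ x ∈ l, x.1 ≠ i) → (evalBlock l s).reg i = s.reg i
  | [], _, _, _ => rfl
  | x :: l, s, i, h => by
    rw [evalBlock, evalBlock_reg_of_notMem (fun y hy => h y (List.mem_cons_of_mem _ hy))]
    exact Function.update_of_ne (h x List.mem_cons_self).symm _ _

theorem blockDegrees_le : ∀ (l : List (ℕ × Expr)) (β : ℕ → ℕ) (i : ℕ),
    blockDegrees l β i ≤ max (β i) (blockDegree l β)
  | [], _, _ => le_max_left _ _
  | x :: l, β, i => by
    refine (blockDegrees_le l _ i).trans ?_
    rw [blockDegree]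
    by_cases hi : i = x.1
    · subst hi
      rw [Function.update_self]
      exact le_max_right _ _
    · rw [Function.update_of_ne hi]
      omega

end LatticeRect

namespace LatticeRect

/-! ### Sums over the lattice points below a line -/

/-- The sum of `φ x y` over `0 ≤ x < N`, `1 ≤ y ≤ ⌊(a x + b) / m⌋`. -/
def lineSum (N m a b : ℕ) (φ : ℤ → ℤ → ℤ) : ℤ :=
  ∑ x ∈ Finset.range N, ∑ y ∈ Finset.Icc 1 ((a * x + b) / m), φ x y

/-- The product of two affine forms. -/
def affProd (u₀ u₁ u₂ v₀ v₁ v₂ : ℤ) (x y : ℤ) : ℤ :=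
  (u₀ + u₁ * x + u₂ * y) * (v₀ + v₁ * x + v₂ * y)

/-- Reducing a and b modulo m lowers the line by the integer L = ⌊a/m⌋x + ⌊b/m⌋. Each column is cut
at height L; its upper part, moved down by L, is the column under the reduced line. -/
theorem lineSum_shear (N a b : ℕ) {m : ℕ} (hm : 0 < m) (φ : ℤ → ℤ → ℤ) :
    lineSum N m a b φ = lineSum N 1 (a / m) (b / m) φ +
      lineSum N m (a % m) (b % m)
        (fun x y => φ x (y + ((a / m : ℕ) : ℤ) * x + ((b / m : ℕ) : ℤ))) := by
  unfold lineSum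
  rw [← Finset.sum_add_distrib]
  refine Finset.sum_congr rfl fun x _ => ?_
  set L := a / m * x + b / m with hL
  set g := (a % m * x + b % m) / m with hg
  have hsplit : (a * x + b) / m = L + g := by
    have h1 : a * x + b = (a % m * x + b % m) + m * L := by
      have ha := Nat.mod_add_div a m
      have hb := Nat.mod_add_div b m
      calc a * x + b = (a % m + m * (a / m)) * x + (b % m + m * (b / m)) := by rw [ha, hb]
        _ = _ := by rw [hL]; ring
    rw [h1, Nat.add_mul_div_left _ _ hm, hg, add_comm]
  rw [hsplit, Nat.div_one]
  have hIcc : ∀ k : ℕ, Finset.Icc 1 k = Finset.Ioc 0 k := fun k => by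
    ext; simp [Nat.succ_le_iff]
  rw [hIcc, hIcc, hIcc,
    ← Finset.sum_Ioc_consecutive _ (Nat.zero_le L) (Nat.le_add_right L g)]
  congr 1
  refine Finset.sum_nbij' (fun y => y - L) (fun y => y + L) ?_ ?_ ?_ ?_ ?_
  · intro y hy; simp only [Finset.mem_Ioc] at hy ⊢; omega
  · intro y hy; simp only [Finset.mem_Ioc] at hy ⊢; omega
  · intro y hy; simp only [Finset.mem_Ioc] at hy; omega
  · intro y hy; omega
  · intro y hy
    simp only [Finset.mem_Ioc] at hy
    have hL' : (L : ℤ) = ((a / m : ℕ) : ℤ) * x + ((b / m : ℕ) : ℤ) := by exact_mod_cast hL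
    congr 1
    rw [Nat.cast_sub hy.1.le, hL']
    ring

/-- Put X = N - x, Y = M - y. Since mM + r = aN + b, the inequality my ≤ ax + b becomes aX ≤ mY + r,
while x < N and y ≥ 1 become X ≥ 1 and Y < M. -/
theorem lineSum_reflect (N : ℕ) {m a b : ℕ} (ha : a < m) (hb : b < m) (φ : ℤ → ℤ → ℤ) :
    lineSum N m a b φ = lineSum ((a * N + b) / m) a m ((a * N + b) % m)
      (fun Y X => φ (N - X) (((a * N + b) / m : ℕ) - Y)) := by
  -- For a = 0 the new modulus is 0, which has to be treated apart; then b < m makes all columns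
  -- empty and M = 0.
  rcases Nat.eq_zero_or_pos a with rfl | ha0
  · simp [lineSum, Nat.div_eq_of_lt hb]
  have hm : 0 < m := by omega
  set M := (a * N + b) / m with hM
  set r := (a * N + b) % m with hr
  have hMr : m * M + r = a * N + b := Nat.div_add_mod _ _
  have hrm : r < m := Nat.mod_lt _ hm
  unfold lineSum
  rw [Finset.sum_sigma', Finset.sum_sigma']
  refine Finset.sum_nbij' (fun z => ⟨M - z.2, N - z.1⟩) (fun z => ⟨N - z.2, M - z.1⟩) ?_ ?_ ?_ ?_ ?_
  · rintro ⟨x, y⟩ h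
    simp only [Finset.mem_sigma, Finset.mem_range, Finset.mem_Icc, Nat.le_div_iff_mul_le hm,
      Nat.le_div_iff_mul_le ha0] at h ⊢
    obtain ⟨hx, hy1, hy⟩ := h
    have hyM : y ≤ M := by
      rw [hM, Nat.le_div_iff_mul_le hm]
      exact hy.trans (by gcongr)
    refine ⟨by omega, by omega, ?_⟩
    zify [hx.le, hyM] at *
    nlinarith
  · rintro ⟨Y, X⟩ h
    simp only [Finset.mem_sigma, Finset.mem_range, Finset.mem_Icc, Nat.le_div_iff_mul_le hm,
      Nat.le_div_iff_mul_le ha0] at h ⊢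
    obtain ⟨hY, hX1, hX⟩ := h
    -- From Y < M follows aX ≤ mY + r ≤ aN + b - m < aN, so the truncated difference N - X is a true
    -- one.
    have hXN : X ≤ N := by
      by_contra hc
      have h1 : a * (N + 1) ≤ X * a := by rw [mul_comm]; exact Nat.mul_le_mul_right _ (by omega)
      have h2 : m * (Y + 1) ≤ m * M := Nat.mul_le_mul_left _ hY
      nlinarith
    refine ⟨by omega, by omega, ?_⟩
    zify [hXN, hY.le] at *
    nlinarith
  · rintro ⟨x, y⟩ h
    simp only [Finset.mem_sigma, Finset.mem_range, Finset.mem_Icc, Nat.le_div_iff_mul_le hm] at h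
    obtain ⟨hx, hy1, hy⟩ := h
    have hyM : y ≤ M := by
      rw [hM, Nat.le_div_iff_mul_le hm]
      exact hy.trans (by gcongr)
    simp only [Sigma.mk.injEq, heq_eq_eq]
    omega
  · rintro ⟨Y, X⟩ h
    simp only [Finset.mem_sigma, Finset.mem_range, Finset.mem_Icc,
      Nat.le_div_iff_mul_le ha0] at h
    obtain ⟨hY, hX1, hX⟩ := h
    have hXN : X ≤ N := by
      by_contra hc
      have h1 : a * (N + 1) ≤ X * a := by rw [mul_comm]; exact Nat.mul_le_mul_right _ (by omega)
      have h2 : m * (Y + 1) ≤ m * M := Nat.mul_le_mul_left _ hY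
      nlinarith
    simp only [Sigma.mk.injEq, heq_eq_eq]
    omega
  · rintro ⟨x, y⟩ h
    simp only [Finset.mem_sigma, Finset.mem_range, Finset.mem_Icc, Nat.le_div_iff_mul_le hm] at h
    obtain ⟨hx, hy1, hy⟩ := h
    have hyM : y ≤ M := by
      rw [hM, Nat.le_div_iff_mul_le hm]
      exact hy.trans (by gcongr)
    push_cast [hx.le, hyM]
    congr 1 <;> ring

/-- A natural number divided by 0 gives 0, so all columns are empty. Modulus 0, where the Euclidean
loop stops, therefore leaves no remainder to be added. -/
theorem lineSum_zero (N a b : ℕ) (φ : ℤ → ℤ → ℤ) : lineSum N 0 a b φ = 0 := by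
  simp [lineSum]

/-- Seventy-two times the sum of a product of affine forms over `0 ≤ x < N`,
`1 ≤ y ≤ q x + r`. -/
def lineSum72 (N q r u₀ u₁ u₂ v₀ v₁ v₂ : ℤ) : ℤ :=
  12 * (6 * (u₀ * v₀) * r + 3 * (u₀ * v₂ + u₂ * v₀) * (r * (r + 1))
      + u₂ * v₂ * (r * (r + 1) * (2 * r + 1))) * N
    + 6 * (6 * (u₀ * v₀ * q + (u₀ * v₁ + u₁ * v₀) * r)
      + 3 * ((u₀ * v₂ + u₂ * v₀) * (q * (2 * r + 1)) + (u₁ * v₂ + u₂ * v₁) * (r * (r + 1)))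
      + u₂ * v₂ * (q * (6 * (r * r) + 6 * r + 1))) * (N * (N - 1))
    + 2 * (6 * ((u₀ * v₁ + u₁ * v₀) * q + u₁ * v₁ * r)
      + 3 * ((u₀ * v₂ + u₂ * v₀) * (q * q) + (u₁ * v₂ + u₂ * v₁) * (q * (2 * r + 1)))
      + u₂ * v₂ * (q * q * (6 * r + 3))) * (N * (N - 1) * (2 * N - 1))
    + 3 * (6 * (u₁ * v₁) * q + 3 * (u₁ * v₂ + u₂ * v₁) * (q * q)
      + 2 * (u₂ * v₂) * (q * q * q)) * (N * (N - 1) * (N * (N - 1)))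

/-- Faulhaber's formulas up to degree two, with denominators cleared by 6. With L affine in x the
result is cubic in x, and the sum over x clears with 12; this is the origin of 72. -/
theorem six_mul_sum_affProd (u₀ u₁ u₂ v₀ v₁ v₂ x : ℤ) (L : ℕ) :
    6 * ∑ y ∈ Finset.Icc 1 L, affProd u₀ u₁ u₂ v₀ v₁ v₂ x y =
      6 * ((u₀ + u₁ * x) * (v₀ + v₁ * x)) * L
        + 3 * ((u₀ + u₁ * x) * v₂ + (v₀ + v₁ * x) * u₂) * (L * (L + 1))
        + u₂ * v₂ * (L * (L + 1) * (2 * L + 1)) := by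
  induction L with
  | zero => simp
  | succ L ih =>
    rw [Finset.sum_Icc_succ_top (by omega), mul_add, ih, affProd]
    push_cast
    ring

theorem lineSum72_eq (N q r : ℕ) (u₀ u₁ u₂ v₀ v₁ v₂ : ℤ) :
    lineSum72 N q r u₀ u₁ u₂ v₀ v₁ v₂ =
      72 * lineSum N 1 q r (affProd u₀ u₁ u₂ v₀ v₁ v₂) := by
  induction N with
  | zero => simp [lineSum72, lineSum]
  | succ N ih =>
    have h : lineSum (N + 1) 1 q r (affProd u₀ u₁ u₂ v₀ v₁ v₂) =
        lineSum N 1 q r (affProd u₀ u₁ u₂ v₀ v₁ v₂) +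
          ∑ y ∈ Finset.Icc 1 (q * N + r), affProd u₀ u₁ u₂ v₀ v₁ v₂ N y := by
      simp [lineSum, Finset.sum_range_succ]
    rw [h, mul_add, ← ih,
      show (72 : ℤ) * ∑ y ∈ Finset.Icc 1 (q * N + r), affProd u₀ u₁ u₂ v₀ v₁ v₂ N y =
        12 * (6 * ∑ y ∈ Finset.Icc 1 (q * N + r), affProd u₀ u₁ u₂ v₀ v₁ v₂ N y) by ring,
      six_mul_sum_affProd]
    unfold lineSum72
    push_cast
    ring

/-- One round of the Euclidean algorithm for sums of a product of affine forms. -/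
theorem lineSum_step (N a b : ℕ) {m : ℕ} (hm : 0 < m) (u₀ u₁ u₂ v₀ v₁ v₂ : ℤ) :
    let M := (a % m * N + b % m) / m
    lineSum N m a b (affProd u₀ u₁ u₂ v₀ v₁ v₂) =
      lineSum72 N (a / m : ℕ) (b / m : ℕ) u₀ u₁ u₂ v₀ v₁ v₂ / 72 +
      lineSum M (a % m) m ((a % m * N + b % m) % m)
        (affProd (u₀ + u₂ * (b / m : ℕ) + (u₁ + u₂ * (a / m : ℕ)) * N + u₂ * M)
          (-u₂) (-(u₁ + u₂ * (a / m : ℕ)))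
          (v₀ + v₂ * (b / m : ℕ) + (v₁ + v₂ * (a / m : ℕ)) * N + v₂ * M)
          (-v₂) (-(v₁ + v₂ * (a / m : ℕ)))) := by
  intro M
  -- The shear adds an affine function of x to y, and the reflection substitutes N - X and M - Y.
  -- Composing an affine form with both gives the coefficients displayed.
  rw [lineSum_shear N a b hm, lineSum_reflect N (Nat.mod_lt a hm) (Nat.mod_lt b hm),
    lineSum72_eq, Int.mul_ediv_cancel_left _ (by norm_num)]
  congr 2
  funext Y X
  simp only [affProd]
  ring

end LatticeRect

namespace LatticeRect

/-! ### The floor-sum kernel -/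

instance : Add Expr := ⟨Expr.add⟩
instance : Sub Expr := ⟨Expr.sub⟩
instance : Mul Expr := ⟨Expr.mul⟩
instance : Div Expr := ⟨Expr.div⟩
instance (k : ℕ) : OfNat Expr k := ⟨Expr.const k⟩

section ExprLemmas

variable {s : State} {e₁ e₂ : Expr} {k : ℕ} {β : ℕ → ℕ}

@[simp] theorem Expr.eval_reg (i : ℕ) : (Expr.reg i).eval s = s.reg i := rfl
@[simp] theorem Expr.eval_const (c : ℤ) : (Expr.const c).eval s = c := rfl
@[simp] theorem Expr.eval_ofNat : (no_index (OfNat.ofNat k) : Expr).eval s = (k : ℤ) := rfl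
@[simp] theorem Expr.eval_add : (e₁ + e₂).eval s = e₁.eval s + e₂.eval s := rfl
@[simp] theorem Expr.eval_sub : (e₁ - e₂).eval s = e₁.eval s - e₂.eval s := rfl
@[simp] theorem Expr.eval_mul : (e₁ * e₂).eval s = e₁.eval s * e₂.eval s := rfl
@[simp] theorem Expr.eval_div : (e₁ / e₂).eval s = e₁.eval s / e₂.eval s := rfl
@[simp] theorem Expr.safe_reg (i : ℕ) : (Expr.reg i).Safe s := trivial
@[simp] theorem Expr.safe_const (c : ℤ) : (Expr.const c).Safe s := trivial
@[simp] theorem Expr.safe_ofNat : (no_index (OfNat.ofNat k) : Expr).Safe s := trivial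
@[simp] theorem Expr.safe_add : (e₁ + e₂).Safe s ↔ e₁.Safe s ∧ e₂.Safe s := Iff.rfl
@[simp] theorem Expr.safe_sub : (e₁ - e₂).Safe s ↔ e₁.Safe s ∧ e₂.Safe s := Iff.rfl
@[simp] theorem Expr.safe_mul : (e₁ * e₂).Safe s ↔ e₁.Safe s ∧ e₂.Safe s := Iff.rfl
@[simp] theorem Expr.safe_div :
    (e₁ / e₂).Safe s ↔ e₁.Safe s ∧ e₂.Safe s ∧ 0 < e₂.eval s := Iff.rfl

end ExprLemmas

/-- The expression that evaluates to `lineSum72`. -/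
def lineSum72Expr (N q r u₀ u₁ u₂ v₀ v₁ v₂ : Expr) : Expr :=
  12 * (6 * (u₀ * v₀) * r + 3 * (u₀ * v₂ + u₂ * v₀) * (r * (r + 1))
      + u₂ * v₂ * (r * (r + 1) * (2 * r + 1))) * N
    + 6 * (6 * (u₀ * v₀ * q + (u₀ * v₁ + u₁ * v₀) * r)
      + 3 * ((u₀ * v₂ + u₂ * v₀) * (q * (2 * r + 1)) + (u₁ * v₂ + u₂ * v₁) * (r * (r + 1)))
      + u₂ * v₂ * (q * (6 * (r * r) + 6 * r + 1))) * (N * (N - 1))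
    + 2 * (6 * ((u₀ * v₁ + u₁ * v₀) * q + u₁ * v₁ * r)
      + 3 * ((u₀ * v₂ + u₂ * v₀) * (q * q) + (u₁ * v₂ + u₂ * v₁) * (q * (2 * r + 1)))
      + u₂ * v₂ * (q * q * (6 * r + 3))) * (N * (N - 1) * (2 * N - 1))
    + 3 * (6 * (u₁ * v₁) * q + 3 * (u₁ * v₂ + u₂ * v₁) * (q * q)
      + 2 * (u₂ * v₂) * (q * q * q)) * (N * (N - 1) * (N * (N - 1)))

section KernelProgram

open LatticeRect.Expr (reg)

/-- One round of the kernel. Registers `10, …, 13` hold `N, m, a, b`, register `14` the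
accumulator, and registers `15, …, 20` the two affine forms. -/
def kernelBody : List (ℕ × Expr) :=
  [(21, reg 12 / reg 11), (22, reg 13 / reg 11),
    (12, reg 12 - reg 21 * reg 11), (13, reg 13 - reg 22 * reg 11),
    (23, lineSum72Expr (reg 10) (reg 21) (reg 22) (reg 15) (reg 16) (reg 17)
      (reg 18) (reg 19) (reg 20) / 72),
    (14, reg 14 + reg 23),
    (24, (reg 12 * reg 10 + reg 13) / reg 11),
    (25, reg 16 + reg 17 * reg 21),
    (15, reg 15 + reg 17 * reg 22 + reg 25 * reg 10 + reg 17 * reg 24),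
    (16, 0 - reg 17), (17, 0 - reg 25),
    (25, reg 19 + reg 20 * reg 21),
    (18, reg 18 + reg 20 * reg 22 + reg 25 * reg 10 + reg 20 * reg 24),
    (19, 0 - reg 20), (20, 0 - reg 25),
    (13, reg 12 * reg 10 + reg 13 - reg 11 * reg 24),
    (10, reg 24), (25, reg 11), (11, reg 12), (12, reg 25)]

/-- The kernel. -/
def kernel : Prog := .whilePos (reg 11) (block kernelBody)

/-- Degrees of the registers at the beginning of a round. -/
def kernelDegrees (i : ℕ) : ℕ :=
  if i < 10 then 100 else if i < 14 then 1 else if i = 14 then 73 else if i = 15 then 7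
  else if i < 18 then 3 else if i = 18 then 7 else if i < 21 then 3 else 100

end KernelProgram

theorem lineSum72Expr_safe {s : State} (i₀ i₁ i₂ i₃ i₄ i₅ i₆ i₇ i₈ : ℕ) :
    (lineSum72Expr (.reg i₀) (.reg i₁) (.reg i₂) (.reg i₃) (.reg i₄) (.reg i₅) (.reg i₆)
      (.reg i₇) (.reg i₈)).Safe s := by
  simp [lineSum72Expr]

theorem kernelBody_safe {s : State} (h : 0 < s.reg 11) : BlockSafe kernelBody s := by
  simp [kernelBody, BlockSafe, lineSum72Expr_safe, h]

/-- All exponents are numerals, so the size of every intermediate value of a round is settled by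
evaluation. -/
theorem blockDegree_kernelBody : blockDegree kernelBody kernelDegrees ≤ 100 := by decide

theorem kernelDegrees_le (i : ℕ) : kernelDegrees i ≤ 100 := by
  unfold kernelDegrees
  split_ifs <;> omega

theorem evalBlock_kernelBody_frame {s : State} {i : ℕ} (hi : i < 10 ∨ 50 ≤ i) :
    (evalBlock kernelBody s).reg i = s.reg i := by
  refine evalBlock_reg_of_notMem ?_
  have h : ∀ x ∈ kernelBody.map Prod.fst, 10 ≤ x ∧ x < 50 := by decide
  intro x hx
  have := h x.1 (List.mem_map_of_mem hx)
  omega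

/-! ### Size of the numbers and number of rounds in the Euclidean loop -/

/-- Size condition on the affine form `u₀ + u₁ x + u₂ y` in a round with parameters `m`, `a`. -/
def FormBound (X m a : ℕ) (u₀ u₁ u₂ : ℤ) : Prop :=
  |u₁| * m + |u₂| * a ≤ 2 * (X : ℤ) ^ 2 ∧ |u₂| ≤ 2 * (X : ℤ) ^ 2 ∧
    |u₀| ≤ X + (X - m) * (6 * (X : ℤ) ^ 3)

theorem FormBound.init {X m a : ℕ} {u₀ u₁ u₂ : ℤ} (hX : 2 ≤ X) (hm : m ≤ X) (ha : a ≤ X)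
    (h₀ : |u₀| ≤ X) (h₁ : |u₁| ≤ X) (h₂ : |u₂| ≤ X) : FormBound X m a u₀ u₁ u₂ := by
  have hX' : (2 : ℤ) ≤ X := by exact_mod_cast hX
  have hm' : (m : ℤ) ≤ X := by exact_mod_cast hm
  have ha' : (a : ℤ) ≤ X := by exact_mod_cast ha
  have h1 : |u₁| * m ≤ X * X := mul_le_mul h₁ hm' (by positivity) (by positivity)
  have h2 : |u₂| * a ≤ X * X := mul_le_mul h₂ ha' (by positivity) (by positivity)
  have h3 : 0 ≤ ((X : ℤ) - m) * (6 * (X : ℤ) ^ 3) := mul_nonneg (by linarith) (by positivity)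
  exact ⟨by nlinarith, by nlinarith, by linarith⟩

/-- These are the exponents 7, 3, 3 fixed in `kernelDegrees`. They use m ≥ 1, which holds while the
loop is running. -/
theorem FormBound.abs_le {X m a : ℕ} {u₀ u₁ u₂ : ℤ} (h : FormBound X m a u₀ u₁ u₂)
    (hX : 2 ≤ X) (hm : 0 < m) :
    |u₀| ≤ (X : ℤ) ^ 7 ∧ |u₁| ≤ (X : ℤ) ^ 3 ∧ |u₂| ≤ (X : ℤ) ^ 3 := by
  obtain ⟨h1, h2, h3⟩ := h
  have hX' : (2 : ℤ) ≤ X := by exact_mod_cast hX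
  have hm' : (1 : ℤ) ≤ m := by exact_mod_cast hm
  have hx2 : 2 * (X : ℤ) ^ 2 ≤ (X : ℤ) ^ 3 := by nlinarith [sq_nonneg (X : ℤ)]
  have ha : 0 ≤ |u₂| * a := by positivity
  have hu1 : |u₁| ≤ |u₁| * m := le_mul_of_one_le_right (abs_nonneg _) hm'
  refine ⟨?_, by linarith, by linarith⟩
  have h4 : ((X : ℤ) - m) * (6 * (X : ℤ) ^ 3) ≤ X * (6 * (X : ℤ) ^ 3) := by
    gcongr; linarith
  have h5 : (2 : ℤ) ^ 3 ≤ (X : ℤ) ^ 3 := by gcongr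
  have h6 : (1 : ℤ) ≤ (X : ℤ) ^ 3 := by linarith
  have h7 : (X : ℤ) ≤ (X : ℤ) ^ 4 := by nlinarith
  have h8 : 8 * (X : ℤ) ^ 4 ≤ (X : ℤ) ^ 3 * (X : ℤ) ^ 4 := by gcongr; linarith
  have h9 : (X : ℤ) ^ 3 * (X : ℤ) ^ 4 = (X : ℤ) ^ 7 := by ring
  nlinarith

/-- With q = ⌊a/m⌋ the potential does not grow: |u₁+u₂q|m + |u₂|(a mod m) ≤ |u₁|m + |u₂|(qm + a mod
m) = |u₁|m + |u₂|a. The constant term changes by three products of size at most 2X³, and the drop of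
m by at least one releases exactly 6X³ in its budget. -/
theorem FormBound.step {X N m a b : ℕ} {u₀ u₁ u₂ : ℤ} (h : FormBound X m a u₀ u₁ u₂)
    (hm : 0 < m) (hN : N ≤ X) (hb : b ≤ X) {M : ℕ} (hM : M ≤ X) :
    FormBound X (a % m) m
      (u₀ + u₂ * (b / m : ℕ) + (u₁ + u₂ * (a / m : ℕ)) * N + u₂ * M)
      (-u₂) (-(u₁ + u₂ * (a / m : ℕ))) := by
  obtain ⟨h1, h2, h3⟩ := h
  set q := a / m with hq
  set r := b / m with hr
  have hm' : (1 : ℤ) ≤ m := by exact_mod_cast hm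
  have hdm : (a : ℤ) = (a % m : ℕ) + m * q := by exact_mod_cast (Nat.mod_add_div a m).symm
  have hlt : ((a % m : ℕ) : ℤ) + 1 ≤ m := by exact_mod_cast Nat.mod_lt a hm
  have hr' : (r : ℤ) ≤ X := by exact_mod_cast (Nat.div_le_self b m).trans hb
  have hN' : (N : ℤ) ≤ X := by exact_mod_cast hN
  have hM' : (M : ℤ) ≤ X := by exact_mod_cast hM
  have hw : |u₁ + u₂ * q| ≤ |u₁| + |u₂| * q := by
    refine (abs_add_le _ _).trans ?_
    rw [abs_mul, Nat.abs_cast]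
  have hpot : |u₁ + u₂ * q| * m + |u₂| * (a % m : ℕ) ≤ 2 * (X : ℤ) ^ 2 := by
    have := mul_le_mul_of_nonneg_right hw (by positivity : (0 : ℤ) ≤ m)
    rw [hdm] at h1
    nlinarith
  have hp2 : 0 ≤ |u₂| * ((a % m : ℕ) : ℤ) := by positivity
  have hu1 : |u₁ + u₂ * q| ≤ 2 * (X : ℤ) ^ 2 := by
    have : |u₁ + u₂ * q| ≤ |u₁ + u₂ * q| * m := le_mul_of_one_le_right (abs_nonneg _) hm'
    linarith
  refine ⟨?_, ?_, ?_⟩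
  · rw [abs_neg, abs_neg]; linarith
  · rwa [abs_neg]
  · have e1 : |u₂ * r| ≤ 2 * (X : ℤ) ^ 2 * X := by
      rw [abs_mul, Nat.abs_cast]; gcongr
    have e2 : |(u₁ + u₂ * q) * N| ≤ 2 * (X : ℤ) ^ 2 * X := by
      rw [abs_mul, Nat.abs_cast]; gcongr
    have e3 : |u₂ * M| ≤ 2 * (X : ℤ) ^ 2 * X := by
      rw [abs_mul, Nat.abs_cast]; gcongr
    have e4 := abs_add_le (u₀ + u₂ * r + (u₁ + u₂ * q) * N) (u₂ * M)
    have e5 := abs_add_le (u₀ + u₂ * r) ((u₁ + u₂ * q) * N)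
    have e6 := abs_add_le u₀ (u₂ * r)
    have e7 : ((X : ℤ) - m + 1) * (6 * (X : ℤ) ^ 3) ≤
        ((X : ℤ) - (a % m : ℕ)) * (6 * (X : ℤ) ^ 3) := by
      gcongr; linarith
    nlinarith

/-- The loop invariant of the kernel. `A` is the value to be computed, `s₀` the initial state, and
`k` bounds the number of remaining rounds. -/
structure KernelInv (X : ℕ) (A : ℤ) (s₀ : State) (k : ℕ) (s : State) : Prop where
  params : ∃ N m a b : ℕ, s.reg 10 = N ∧ s.reg 11 = m ∧ s.reg 12 = a ∧ s.reg 13 = b ∧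
    N ≤ X ∧ m ≤ X ∧ a ≤ X ∧ b ≤ X ∧
    A = s.reg 14 + lineSum N m a b
      (affProd (s.reg 15) (s.reg 16) (s.reg 17) (s.reg 18) (s.reg 19) (s.reg 20)) ∧
    FormBound X m a (s.reg 15) (s.reg 16) (s.reg 17) ∧
    FormBound X m a (s.reg 18) (s.reg 19) (s.reg 20) ∧
    |s.reg 14| ≤ (X - m) * (X : ℤ) ^ 72 ∧
    (m ≤ a ∧ a * m < 2 ^ k ∨ ∃ k', k = k' + 1 ∧ m * m < 2 ^ k')
  mem_eq : s.mem = s₀.mem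
  frame : ∀ i, i < 10 ∨ 50 ≤ i → s.reg i = s₀.reg i
  bound : ∀ i, |s.reg i| ≤ (X : ℤ) ^ 100

/-- If m ≤ a then (a mod m) + m ≤ a, hence 2m(a mod m) ≤ am: the product of the two parameters at
least halves. The second alternative is for the first round, where a is arbitrary: that round brings
the product below m², so the number of rounds depends on m alone. -/
theorem fuel_step {m a k : ℕ} (hm : 0 < m)
    (h : m ≤ a ∧ a * m < 2 ^ k ∨ ∃ k', k = k' + 1 ∧ m * m < 2 ^ k') :
    ∃ k', k = k' + 1 ∧ a % m ≤ m ∧ m * (a % m) < 2 ^ k' := by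
  have hlt := Nat.mod_lt a hm
  rcases h with ⟨hma, hk⟩ | ⟨k', rfl, hk⟩
  · cases k with
    | zero => nlinarith
    | succ k' =>
      refine ⟨k', rfl, hlt.le, ?_⟩
      have h1 : a % m + m ≤ a := by
        have h2 := Nat.mod_add_div a m
        have h3 : 1 ≤ a / m := (Nat.one_le_div_iff hm).2 hma
        nlinarith
      rw [pow_succ] at hk
      nlinarith
  · exact ⟨k', rfl, hlt.le, lt_of_le_of_lt (Nat.mul_le_mul_left _ hlt.le) hk⟩

theorem KernelInv.step {S W X : ℕ} {A : ℤ} {s₀ : State} {k : ℕ} {s : State} (hX : 2 ≤ X)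
    (hW : X ^ 100 ≤ W) (h : KernelInv X A s₀ k s) (hpos : 0 < s.reg 11) :
    ∃ k', k = k' + 1 ∧
      Runs S W (block kernelBody) s (blockCost kernelBody) (KernelInv X A s₀ k') := by
  obtain ⟨⟨N, m, a, b, hN, hm, ha, hb, hNX, hmX, haX, hbX, hA, hu, hv, hacc, hfuel⟩, hmem, hfr,
    hbd⟩ := h
  have hm0 : 0 < m := by rw [hm] at hpos; exact_mod_cast hpos
  obtain ⟨k', rfl, hk1, hk2⟩ := fuel_step hm0 hfuel
  refine ⟨k', rfl, ?_⟩
  have hX' : (2 : ℤ) ≤ X := by exact_mod_cast hX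
  have hβ : ∀ i, |s.reg i| ≤ (X : ℤ) ^ kernelDegrees i := by
    obtain ⟨hu0, hu1, hu2⟩ := hu.abs_le hX hm0
    obtain ⟨hv0, hv1, hv2⟩ := hv.abs_le hX hm0
    have hacc' : |s.reg 14| ≤ (X : ℤ) ^ 73 := by
      refine hacc.trans ?_
      rw [pow_succ' (X : ℤ) 72]
      exact mul_le_mul_of_nonneg_right (by linarith) (by positivity)
    intro i
    by_cases hi : i < 10 ∨ 21 ≤ i
    · have : kernelDegrees i = 100 := by
        unfold kernelDegrees
        split_ifs <;> omega
      rw [this]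
      exact hbd i
    · have h1 : 10 ≤ i := by omega
      have h2 : i < 21 := by omega
      interval_cases i
      · rw [hN, Nat.abs_cast]; exact_mod_cast (pow_one X).symm ▸ hNX
      · rw [hm, Nat.abs_cast]; exact_mod_cast (pow_one X).symm ▸ hmX
      · rw [ha, Nat.abs_cast]; exact_mod_cast (pow_one X).symm ▸ haX
      · rw [hb, Nat.abs_cast]; exact_mod_cast (pow_one X).symm ▸ hbX
      all_goals assumption
  refine (runs_block hX kernelBody hβ (kernelBody_safe hpos)
    ((Nat.pow_le_pow_right (by omega) blockDegree_kernelBody).trans hW)).weaken le_rfl ?_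
  rintro s' ⟨rfl, hbd'⟩
  -- The exponent of register 23 evaluates to 72. A quotient receives the larger of two exponents,
  -- and here the literal divisor 72 dominates.
  have hinc : |lineSum72 (s.reg 10) (s.reg 12 / s.reg 11) (s.reg 13 / s.reg 11) (s.reg 15)
      (s.reg 16) (s.reg 17) (s.reg 18) (s.reg 19) (s.reg 20) / 72| ≤ (X : ℤ) ^ 72 := hbd' 23
  have hq : s.reg 12 / s.reg 11 = (a / m : ℕ) := by rw [ha, hm]; rfl
  have hr : s.reg 13 / s.reg 11 = (b / m : ℕ) := by rw [hb, hm]; rfl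
  have ham : s.reg 12 - s.reg 12 / s.reg 11 * s.reg 11 = (a % m : ℕ) := by
    rw [ha, hm, Int.natCast_mod, Int.emod_def, mul_comm (m : ℤ)]
  have hbm : s.reg 13 - s.reg 13 / s.reg 11 * s.reg 11 = (b % m : ℕ) := by
    rw [hb, hm, Int.natCast_mod, Int.emod_def, mul_comm (m : ℤ)]
  set M := (a % m * N + b % m) / m with hM
  have hMv : ((s.reg 12 - s.reg 12 / s.reg 11 * s.reg 11) * s.reg 10 +
      (s.reg 13 - s.reg 13 / s.reg 11 * s.reg 11)) / s.reg 11 = (M : ℕ) := by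
    rw [ham, hbm, hN, hm, hM]
    push_cast
    rfl
  -- Reduced slope and offset are less than m, so the number of columns never grows.
  have hMN : M ≤ N := by
    rw [hM, ← Nat.lt_succ_iff, Nat.div_lt_iff_lt_mul hm0]
    have h1 := Nat.mod_lt a hm0
    have h2 := Nat.mod_lt b hm0
    nlinarith
  -- The final registers unfold definitionally to expressions in the initial ones; these are matched
  -- with the coefficients of `lineSum_step`.
  have e10 : (evalBlock kernelBody s).reg 10 = M := hMv
  have e11 : (evalBlock kernelBody s).reg 11 = (a % m : ℕ) := ham
  have e12 : (evalBlock kernelBody s).reg 12 = m := hm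
  have e13 : (evalBlock kernelBody s).reg 13 = ((a % m * N + b % m) % m : ℕ) := by
    have h1 : (evalBlock kernelBody s).reg 13 =
        (s.reg 12 - s.reg 12 / s.reg 11 * s.reg 11) * s.reg 10 +
          (s.reg 13 - s.reg 13 / s.reg 11 * s.reg 11) - s.reg 11 *
          (((s.reg 12 - s.reg 12 / s.reg 11 * s.reg 11) * s.reg 10 +
            (s.reg 13 - s.reg 13 / s.reg 11 * s.reg 11)) / s.reg 11) := rfl
    have h2 : ((m * M + (a % m * N + b % m) % m : ℕ) : ℤ) = (a % m * N + b % m : ℕ) := by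
      rw [hM, Nat.div_add_mod]
    rw [h1, hMv, ham, hbm, hN, hm]
    push_cast at h2 ⊢
    linarith
  have e14 : (evalBlock kernelBody s).reg 14 = s.reg 14 +
      lineSum72 (s.reg 10) (s.reg 12 / s.reg 11) (s.reg 13 / s.reg 11) (s.reg 15)
        (s.reg 16) (s.reg 17) (s.reg 18) (s.reg 19) (s.reg 20) / 72 := rfl
  have e15 : (evalBlock kernelBody s).reg 15 = s.reg 15 + s.reg 17 * (b / m : ℕ) +
      (s.reg 16 + s.reg 17 * (a / m : ℕ)) * N + s.reg 17 * M := by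
    rw [← hMv, ← hq, ← hr, ← hN]; rfl
  have e16 : (evalBlock kernelBody s).reg 16 = -s.reg 17 := zero_sub _
  have e17 : (evalBlock kernelBody s).reg 17 = -(s.reg 16 + s.reg 17 * (a / m : ℕ)) := by
    rw [← hq]; exact zero_sub _
  have e18 : (evalBlock kernelBody s).reg 18 = s.reg 18 + s.reg 20 * (b / m : ℕ) +
      (s.reg 19 + s.reg 20 * (a / m : ℕ)) * N + s.reg 20 * M := by
    rw [← hMv, ← hq, ← hr, ← hN]; rfl
  have e19 : (evalBlock kernelBody s).reg 19 = -s.reg 20 := zero_sub _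
  have e20 : (evalBlock kernelBody s).reg 20 = -(s.reg 19 + s.reg 20 * (a / m : ℕ)) := by
    rw [← hq]; exact zero_sub _
  refine ⟨⟨M, a % m, m, (a % m * N + b % m) % m, e10, e11, e12, e13, hMN.trans hNX,
    (Nat.mod_lt a hm0).le.trans hmX, hmX, (Nat.mod_lt _ hm0).le.trans hmX, ?_, ?_, ?_, ?_,
    Or.inl ⟨hk1, hk2⟩⟩, ?_, ?_, ?_⟩
  · rw [hA, e14, e15, e16, e17, e18, e19, e20, hq, hr, hN, lineSum_step N a b hm0]
    ring
  · rw [e15, e16, e17]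
    exact hu.step hm0 hNX hbX (hMN.trans hNX)
  · rw [e18, e19, e20]
    exact hv.step hm0 hNX hbX (hMN.trans hNX)
  -- The exponent calculus alone would let the accumulator gain a power in each round. The budget (X
  -- - m)X^72 avoids this: m drops by at least one, and a round adds at most X^72.
  · rw [e14]
    have hlt : ((a % m : ℕ) : ℤ) + 1 ≤ m := by exact_mod_cast Nat.mod_lt a hm0
    have h1 : ((X : ℤ) - m + 1) * (X : ℤ) ^ 72 ≤ ((X : ℤ) - (a % m : ℕ)) * (X : ℤ) ^ 72 := by
      gcongr; linarith
    refine (abs_add_le _ _).trans ?_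
    linarith
  · rw [evalBlock_mem, hmem]
  · intro i hi
    rw [evalBlock_kernelBody_frame hi, hfr i hi]
  · intro i
    refine (hbd' i).trans (pow_le_pow_right₀ (by linarith) ?_)
    exact (blockDegrees_le _ _ _).trans (max_le (kernelDegrees_le i) blockDegree_kernelBody)

/-- The number of steps of one round of the kernel. -/
def kernelRound : ℕ := 2 + blockCost kernelBody

theorem runs_kernel {S W X : ℕ} (hX : 2 ≤ X) (hW : X ^ 100 ≤ W) {N m a b : ℕ} {s : State}
    (hN : s.reg 10 = N) (hm : s.reg 11 = m) (ha : s.reg 12 = a) (hb : s.reg 13 = b)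
    (hacc : s.reg 14 = 0) (hin : ∀ i, 10 ≤ i → i ≤ 20 → |s.reg i| ≤ X)
    (hbd : ∀ i, |s.reg i| ≤ (X : ℤ) ^ 100) :
    Runs S W kernel s ((2 * Nat.size m + 2) * kernelRound)
      (fun s' => s'.reg 14 = lineSum N m a b
          (affProd (s.reg 15) (s.reg 16) (s.reg 17) (s.reg 18) (s.reg 19) (s.reg 20)) ∧
        |s'.reg 14| ≤ (X : ℤ) ^ 73 ∧ s'.mem = s.mem ∧
        (∀ i, i < 10 ∨ 50 ≤ i → s'.reg i = s.reg i) ∧ ∀ i, |s'.reg i| ≤ (X : ℤ) ^ 100) := by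
  have hX' : (2 : ℤ) ≤ X := by exact_mod_cast hX
  have hnat : ∀ {i k : ℕ}, 10 ≤ i → i ≤ 20 → s.reg i = k → k ≤ X := fun h1 h2 h => by
    have := hin _ h1 h2
    rw [h, Nat.abs_cast] at this
    exact_mod_cast this
  have hmX := hnat (by norm_num) (by norm_num) hm
  have haX := hnat (by norm_num) (by norm_num) ha
  set A := lineSum N m a b
    (affProd (s.reg 15) (s.reg 16) (s.reg 17) (s.reg 18) (s.reg 19) (s.reg 20)) with hA
  -- From m < 2^(size m) follows m² < 2^(2 size m); the extra unit pays for the first round, in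
  -- which a is unrestricted.
  have hI : KernelInv X A s (2 * Nat.size m + 1) s := by
    refine ⟨⟨N, m, a, b, hN, hm, ha, hb, hnat (by norm_num) (by norm_num) hN, hmX, haX,
      hnat (by norm_num) (by norm_num) hb, by rw [hacc, zero_add],
      .init hX hmX haX (hin _ (by norm_num) (by norm_num)) (hin _ (by norm_num) (by norm_num))
        (hin _ (by norm_num) (by norm_num)),
      .init hX hmX haX (hin _ (by norm_num) (by norm_num)) (hin _ (by norm_num) (by norm_num))
        (hin _ (by norm_num) (by norm_num)), ?_, Or.inr ⟨_, rfl, ?_⟩⟩, rfl, fun _ _ => rfl, hbd⟩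
    · rw [hacc, abs_zero]
      have : (m : ℤ) ≤ X := by exact_mod_cast hmX
      exact mul_nonneg (by linarith) (by positivity)
    · have := Nat.lt_size_self m
      rw [two_mul, pow_add]
      exact Nat.mul_lt_mul'' this this
  have hrun := Runs.whileFuel (S := S) (W := W) (e := .reg 11) (P := block kernelBody)
    (c := blockCost kernelBody) (I := KernelInv X A s) (fun k s' h => ⟨?_, fun hpos =>
      h.step hX hW hpos⟩) _ s hI
  · refine hrun.weaken ?_ ?_
    · simp only [Expr.cost, kernelRound]
      nlinarith
    · rintro s' ⟨k', ⟨⟨N', m', a', b', -, hm', -, -, -, hmX', -, -, hval, -, -, hacc', -⟩, hmem, hfr,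
        hbd'⟩, hneg⟩
      have hm0 : m' = 0 := by
        rw [Expr.eval_reg, hm'] at hneg
        omega
      subst hm0
      rw [lineSum_zero, add_zero] at hval
      refine ⟨hval.symm, hacc'.trans (le_of_eq ?_), hmem, hfr, hbd'⟩
      push_cast
      ring
  · exact (h.bound 11).trans (by exact_mod_cast hW)

end LatticeRect

namespace LatticeRect

/-! ### Calls of the kernel -/

section Parallel

variable {k : ℕ}

/-- Targets are at least k and right-hand sides read only registers below k, so no assignment
disturbs a later one and the block acts as a simultaneous assignment. -/
theorem evalBlock_parallel : ∀ {l : List (ℕ × Expr)} {s : State},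
    (∀ x ∈ l, k ≤ x.1 ∧ x.2.Below k) → (l.map Prod.fst).Nodup →
    ∀ x ∈ l, (evalBlock l s).reg x.1 = x.2.eval s
  | [], _, _, _, x, hx => absurd hx List.not_mem_nil
  | y :: l, s, h, hnd, x, hx => by
    rw [List.map_cons, List.nodup_cons] at hnd
    rw [evalBlock]
    rcases List.mem_cons.1 hx with rfl | hx'
    · rw [evalBlock_reg_of_notMem]
      · exact Function.update_self _ _ _
      · intro z hz hzx
        exact hnd.1 (hzx ▸ List.mem_map_of_mem hz)
    · rw [evalBlock_parallel (fun z hz => h z (List.mem_cons_of_mem _ hz)) hnd.2 x hx']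
      refine Expr.Below.eval_congr (fun i hi => ?_) (h x hx).2
      exact Function.update_of_ne (by have := (h y List.mem_cons_self).1; omega) _ _

theorem blockSafe_parallel : ∀ {l : List (ℕ × Expr)} {s : State},
    (∀ x ∈ l, k ≤ x.1 ∧ x.2.Below k) → (∀ x ∈ l, x.2.Safe s) → BlockSafe l s
  | [], _, _, _ => trivial
  | y :: l, s, h, hs => by
    refine ⟨hs y List.mem_cons_self,
      blockSafe_parallel (fun z hz => h z (List.mem_cons_of_mem _ hz)) fun z hz => ?_⟩
    refine Expr.Below.safe_congr (fun i hi => ?_) (h z (List.mem_cons_of_mem _ hz)).2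
      (hs z (List.mem_cons_of_mem _ hz))
    exact Function.update_of_ne (by have := (h y List.mem_cons_self).1; omega) _ _

theorem blockDegree_parallel {E : ℕ} : ∀ {l : List (ℕ × Expr)} {β : ℕ → ℕ},
    (∀ x ∈ l, k ≤ x.1 ∧ x.2.Below k) → (∀ x ∈ l, x.2.degree β ≤ E) → blockDegree l β ≤ E
  | [], _, _, _ => Nat.zero_le _
  | y :: l, β, h, hd => by
    refine max_le (hd y List.mem_cons_self)
      (blockDegree_parallel (fun z hz => h z (List.mem_cons_of_mem _ hz)) fun z hz => ?_)
    rw [Expr.Below.degree_congr (fun i hi => ?_) (h z (List.mem_cons_of_mem _ hz)).2]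
    · exact hd z (List.mem_cons_of_mem _ hz)
    · exact Function.update_of_ne (by have := (h y List.mem_cons_self).1; omega) _ _

end Parallel

/-- Arguments of a call of the kernel. -/
structure CallArgs where
  N : Expr
  m : Expr
  a : Expr
  b : Expr
  u₀ : Expr
  u₁ : Expr
  u₂ : Expr
  v₀ : Expr
  v₁ : Expr
  v₂ : Expr

/-- The assignments that pass the arguments to the kernel. -/
def CallArgs.setup (c : CallArgs) : List (ℕ × Expr) :=
  [(10, c.N), (11, c.m), (12, c.a), (13, c.b), (14, 0), (15, c.u₀), (16, c.u₁), (17, c.u₂),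
    (18, c.v₀), (19, c.v₁), (20, c.v₂)]

/-- A call of the kernel. -/
def CallArgs.call (c : CallArgs) : Prog := .seq (block c.setup) kernel

/-- All arguments can be evaluated from the first ten registers, with values of degree at most
`E` if these registers have degree `A`. -/
def CallArgs.Admissible (c : CallArgs) (A E : ℕ) (s : State) : Prop :=
  ∀ x ∈ c.setup, x.2.Below 10 ∧ x.2.Safe s ∧ x.2.degree (fun _ => A) ≤ E

/-- The number of steps of a call with modulus `m`. -/
def CallArgs.time (c : CallArgs) (m : ℕ) : ℕ :=
  blockCost c.setup + (2 * Nat.size m + 2) * kernelRound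

/-- Arguments of degree E in D are inputs of degree one in X = D^E, so the exponents 73 and 100 of
the kernel are multiplied by E. Callers keep their data in registers below 10 or from 50 on. -/
theorem runs_call {S W D A E : ℕ} (hD : 2 ≤ D) (hE : 1 ≤ E) (hW : D ^ (100 * E) ≤ W)
    {s : State} (hlow : ∀ i < 10, |s.reg i| ≤ (D : ℤ) ^ A)
    (hall : ∀ i, |s.reg i| ≤ (D : ℤ) ^ (100 * E)) {c : CallArgs} (hc : c.Admissible A E s)
    {N m a b : ℕ} (hN : c.N.eval s = N) (hm : c.m.eval s = m) (ha : c.a.eval s = a)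
    (hb : c.b.eval s = b) :
    Runs S W c.call s (c.time m)
      (fun s' => s'.reg 14 = lineSum N m a b (affProd (c.u₀.eval s) (c.u₁.eval s) (c.u₂.eval s)
          (c.v₀.eval s) (c.v₁.eval s) (c.v₂.eval s)) ∧
        |s'.reg 14| ≤ (D : ℤ) ^ (73 * E) ∧ s'.mem = s.mem ∧
        (∀ i, i < 10 ∨ 50 ≤ i → s'.reg i = s.reg i) ∧
        ∀ i, |s'.reg i| ≤ (D : ℤ) ^ (100 * E)) := by
  have hD1 : (1 : ℤ) ≤ D := by exact_mod_cast (by omega : 1 ≤ D)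
  have hidx : ∀ x ∈ c.setup.map Prod.fst, 10 ≤ x ∧ x ≤ 20 := by
    simp [CallArgs.setup]
  have hpar : ∀ x ∈ c.setup, 10 ≤ x.1 ∧ x.2.Below 10 := fun x hx =>
    ⟨(hidx x.1 (List.mem_map_of_mem hx)).1, (hc x hx).1⟩
  have hnd : (c.setup.map Prod.fst).Nodup := by simp [CallArgs.setup]
  set β : ℕ → ℕ := fun i => if i < 10 then A else 100 * E with hβdef
  have hβ : ∀ i, |s.reg i| ≤ (D : ℤ) ^ β i := by
    intro i
    by_cases hi : i < 10
    · simpa [hβdef, hi] using hlow i hi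
    · simpa [hβdef, hi] using hall i
  have hdeg : blockDegree c.setup β ≤ E := by
    refine blockDegree_parallel hpar fun x hx => ?_
    rw [Expr.Below.degree_congr (β := fun _ => A) (fun i hi => by simp [hβdef, hi]) (hc x hx).1]
    exact (hc x hx).2.2
  refine Runs.seq (runs_block hD c.setup hβ (blockSafe_parallel hpar fun x hx => (hc x hx).2.1)
    ((Nat.pow_le_pow_right (by omega) (hdeg.trans (by omega))).trans hW)) ?_
  rintro s₁ ⟨rfl, hbd⟩
  have hval := evalBlock_parallel (s := s) hpar hnd
  have hget : ∀ i e, (i, e) ∈ c.setup → (evalBlock c.setup s).reg i = e.eval s :=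
    fun i e h => hval (i, e) h
  have hfr : ∀ i, i < 10 ∨ 50 ≤ i → (evalBlock c.setup s).reg i = s.reg i := fun i hi =>
    evalBlock_reg_of_notMem fun x hx => by
      have := hidx x.1 (List.mem_map_of_mem hx)
      omega
  have hin : ∀ i, 10 ≤ i → i ≤ 20 → |(evalBlock c.setup s).reg i| ≤ ((D ^ E : ℕ) : ℤ) := by
    intro i h1 h2
    have hmem : ∃ e, (i, e) ∈ c.setup := by
      interval_cases i <;> simp [CallArgs.setup]
    obtain ⟨e, he⟩ := hmem
    rw [hget i e he]
    refine ((hc _ he).2.1.abs_eval_le hD hβ).trans ?_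
    rw [Expr.Below.degree_congr (β := fun _ => A) (fun i hi => by simp [hβdef, hi]) (hc _ he).1]
    push_cast
    exact pow_le_pow_right₀ hD1 (hc _ he).2.2
  have hX : 2 ≤ D ^ E := hD.trans (Nat.le_self_pow (by omega) D)
  have hpow : ((D ^ E : ℕ) : ℤ) ^ 100 = (D : ℤ) ^ (100 * E) := by
    push_cast
    rw [← pow_mul, mul_comm]
  have hall' : ∀ i, |(evalBlock c.setup s).reg i| ≤ ((D ^ E : ℕ) : ℤ) ^ 100 := by
    intro i
    by_cases hi : 10 ≤ i ∧ i ≤ 20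
    · refine (hin i hi.1 hi.2).trans (le_self_pow₀ ?_ (by norm_num))
      exact_mod_cast hX.trans' (by norm_num)
    · rw [evalBlock_reg_of_notMem fun x hx => by
        have := hidx x.1 (List.mem_map_of_mem hx)
        omega, hpow]
      exact hall i
  have hrun := runs_kernel (S := S) (W := W) hX (by rwa [← pow_mul, mul_comm])
    (s := evalBlock c.setup s) (N := N) (m := m) (a := a) (b := b)
    (by rw [← hN]; exact hget _ _ (by simp [CallArgs.setup]))
    (by rw [← hm]; exact hget _ _ (by simp [CallArgs.setup]))
    (by rw [← ha]; exact hget _ _ (by simp [CallArgs.setup]))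
    (by rw [← hb]; exact hget _ _ (by simp [CallArgs.setup]))
    (by exact hget 14 0 (by simp [CallArgs.setup])) hin hall'
  refine hrun.weaken le_rfl ?_
  rintro s' ⟨h1, h2, h3, h4, h5⟩
  refine ⟨?_, ?_, ?_, ?_, ?_⟩
  · rw [h1, hget 15 c.u₀ (by simp [CallArgs.setup]), hget 16 c.u₁ (by simp [CallArgs.setup]),
      hget 17 c.u₂ (by simp [CallArgs.setup]), hget 18 c.v₀ (by simp [CallArgs.setup]),
      hget 19 c.v₁ (by simp [CallArgs.setup]), hget 20 c.v₂ (by simp [CallArgs.setup])]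
  · refine h2.trans (le_of_eq ?_)
    push_cast
    rw [← pow_mul, mul_comm]
  · rw [h3, evalBlock_mem]
  · intro i hi
    rw [h4 i hi, hfr i hi]
  · intro i
    rw [← hpow]
    exact h5 i

/-! ### The floor moments -/

section MomentMath

variable (N m a b : ℕ)

/-- G is the discrete antiderivative of g, so the sum of g over a column telescopes to the value of
G at its height. -/
theorem lineSum_eq_sum_mul (f : ℤ → ℤ) (g : ℤ → ℤ) (G : ℕ → ℤ)
    (h0 : G 0 = 0) (hG : ∀ k : ℕ, G (k + 1) = G k + g ((k : ℤ) + 1)) :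
    lineSum N m a b (fun x y => f x * g y) =
      ∑ x ∈ Finset.range N, f x * G ((a * x + b) / m) := by
  have hsum : ∀ k : ℕ, ∑ y ∈ Finset.Icc 1 k, g y = G k := by
    intro k
    induction k with
    | zero => simp [h0]
    | succ k ih => rw [Finset.sum_Icc_succ_top (by omega), ih, hG]; push_cast; rfl
  unfold lineSum
  refine Finset.sum_congr rfl fun x _ => ?_
  rw [← Finset.mul_sum, hsum]

theorem floorMoment_one (p : ℕ) : (floorMoment p 1 N m a b : ℤ) =
    lineSum N m a b (fun x _ => x ^ p * 1) := by
  rw [lineSum_eq_sum_mul N m a b (fun x => x ^ p) (fun _ => 1) (fun k => k) (by simp) (by simp),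
    floorMoment]
  simp

theorem floorMoment_two (p : ℕ) : (floorMoment p 2 N m a b : ℤ) =
    lineSum N m a b (fun x y => x ^ p * (2 * y - 1)) := by
  rw [lineSum_eq_sum_mul N m a b (fun x => x ^ p) (fun y => 2 * y - 1) (fun k => (k : ℤ) ^ 2)
    (by simp) (fun k => by push_cast; ring), floorMoment]
  simp

/-- The differences 3k²+3k+1 of k³ do not split into affine factors, but those of k³ - k do: with y
= k+1 they are 3y(y-1). The first moment makes up for the k subtracted. -/
theorem floorMoment_three : (floorMoment 0 3 N m a b : ℤ) =
    3 * lineSum N m a b (fun _ y => 1 * (y * (y - 1))) + floorMoment 0 1 N m a b := by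
  have h := lineSum_eq_sum_mul N m a b (fun _ => 1) (fun y => 3 * (y * (y - 1)))
    (fun k => (k : ℤ) ^ 3 - k) (by simp) (fun k => by push_cast; ring)
  have h' : lineSum N m a b (fun _ y => 1 * (3 * (y * (y - 1)))) =
      3 * lineSum N m a b (fun _ y => 1 * (y * (y - 1))) := by
    simp only [lineSum, Finset.mul_sum]
    exact Finset.sum_congr rfl fun _ _ => Finset.sum_congr rfl fun _ _ => by ring
  rw [← h', h]
  simp only [floorMoment, Nat.cast_sum, ← Finset.sum_add_distrib]
  exact Finset.sum_congr rfl fun _ _ => by push_cast; ring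

end MomentMath

/-- The pairs of affine forms that belong to the six moments. -/
def momentForms : ℕ → (ℤ × ℤ × ℤ) × (ℤ × ℤ × ℤ)
  | 0 => ((1, 0, 0), (1, 0, 0))
  | 1 => ((0, 1, 0), (1, 0, 0))
  | 2 => ((0, 1, 0), (0, 1, 0))
  | 3 => ((-1, 0, 2), (1, 0, 0))
  | 4 => ((0, 1, 0), (-1, 0, 2))
  | _ => ((0, 0, 1), (-1, 0, 1))

/-- The arguments of the kernel for the six moments. -/
def momentArgs (j : ℕ) : CallArgs :=
  ⟨.reg 0, .reg 1, .reg 2, .reg 3, .const (momentForms j).1.1, .const (momentForms j).1.2.1,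
    .const (momentForms j).1.2.2, .const (momentForms j).2.1, .const (momentForms j).2.2.1,
    .const (momentForms j).2.2.2⟩

/-- The value computed by the `j`-th call. -/
def momentValue (N m a b j : ℕ) : ℤ :=
  lineSum N m a b (affProd (momentForms j).1.1 (momentForms j).1.2.1 (momentForms j).1.2.2
    (momentForms j).2.1 (momentForms j).2.2.1 (momentForms j).2.2.2)

/-- The first `k` calls; the results are collected in registers `50, 51, …`. -/
def momentCalls : ℕ → Prog
  | 0 => .skip
  | k + 1 => .seq (momentCalls k) (.seq (momentArgs k).call (.assign (50 + k) (.reg 14)))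

/-- The output of the moments. -/
def momentOutput : List (ℕ × Expr) :=
  [(0, .reg 50), (1, .reg 51), (2, .reg 52), (3, .reg 53), (4, .reg 54),
    (5, 3 * .reg 55 + .reg 50)]

/-- The program for the six moments. -/
def momentProg : Prog := .seq (momentCalls 6) (block momentOutput)

theorem momentArgs_admissible (j : ℕ) (s : State) : (momentArgs j).Admissible 1 2 s := by
  intro x hx
  have hc : ∀ c : ℤ, c.natAbs ≤ 2 → (Expr.const c).Below 10 ∧ (Expr.const c).Safe s ∧
      (Expr.const c).degree (fun _ => 1) ≤ 2 := fun c h => ⟨trivial, trivial, h⟩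
  have hr : ∀ i, i < 10 → (Expr.reg i).Below 10 ∧ (Expr.reg i).Safe s ∧
      (Expr.reg i).degree (fun _ => 1) ≤ 2 := fun i h => ⟨h, trivial, by simp [Expr.degree]⟩
  simp only [CallArgs.setup, momentArgs, List.mem_cons, List.not_mem_nil, or_false] at hx
  rcases hx with rfl | rfl | rfl | rfl | rfl | rfl | rfl | rfl | rfl | rfl | rfl
  · exact hr 0 (by norm_num)
  · exact hr 1 (by norm_num)
  · exact hr 2 (by norm_num)
  · exact hr 3 (by norm_num)
  · exact hc 0 (by norm_num)
  all_goals
    refine hc _ ?_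
    rcases j with _ | _ | _ | _ | _ | j <;> simp [momentForms]

/-- A bound for the number of steps of `momentCalls k`. -/
def momentCallsTime (m : ℕ) : ℕ → ℕ
  | 0 => 1
  | k + 1 => momentCallsTime m k + ((momentArgs k).time m + 2)

theorem runs_momentCalls {S W D N m a b : ℕ} (hD : 2 ≤ D) (hW : D ^ 200 ≤ W) {s : State}
    (hlow : ∀ i < 10, |s.reg i| ≤ (D : ℤ) ^ 1) (hall : ∀ i, |s.reg i| ≤ (D : ℤ) ^ 200)
    (hN : s.reg 0 = N) (hm : s.reg 1 = m) (ha : s.reg 2 = a) (hb : s.reg 3 = b) (k : ℕ) :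
    Runs S W (momentCalls k) s (momentCallsTime m k) (fun s' =>
      (∀ i < 10, s'.reg i = s.reg i) ∧ (∀ i, |s'.reg i| ≤ (D : ℤ) ^ 200) ∧
      ∀ j < k, s'.reg (50 + j) = momentValue N m a b j) := by
  induction k with
  | zero => exact ⟨1, s, le_rfl, .skip s, fun _ _ => rfl, hall, fun j hj => by omega⟩
  | succ k ih =>
    refine ih.seq fun s₁ ⟨h1, h2, h3⟩ => ?_
    refine (runs_call (E := 2) (A := 1) hD (by norm_num) hW
      (fun i hi => by rw [h1 i hi]; exact hlow i hi) h2 (momentArgs_admissible k s₁)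
      (N := N) (m := m) (a := a) (b := b) ?_ ?_ ?_ ?_).seq fun s₂ ⟨g1, _, _, g3, g4⟩ => ?_
    · exact (h1 0 (by norm_num)).trans hN
    · exact (h1 1 (by norm_num)).trans hm
    · exact (h1 2 (by norm_num)).trans ha
    · exact (h1 3 (by norm_num)).trans hb
    · refine Runs.assign ((g4 14).trans (by exact_mod_cast hW)) ⟨?_, ?_, ?_⟩
      · intro i hi
        have hik : i ≠ 50 + k := by omega
        simp only
        rw [Function.update_of_ne hik, g3 i (Or.inl hi), h1 i hi]
      · intro i
        by_cases hi : i = 50 + k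
        · subst hi
          simpa using g4 14
        · simpa [Function.update_of_ne hi] using g4 i
      · intro j hj
        by_cases hjk : j = k
        · subst hjk
          exact (Function.update_self _ _ _).trans g1
        · simp only
          rw [Function.update_of_ne (by omega), g3 _ (Or.inr (by omega)), h3 j (by omega)]

/-- For m ≥ 1 the logarithm is at least log 2 > 1/2, so additive constants can be absorbed. -/
theorem natSize_le_log {m : ℕ} (hm : 1 ≤ m) :
    (Nat.size m : ℝ) ≤ 4 * Real.log (m + 1) ∧ 1 ≤ 2 * Real.log (m + 1) := by
  have hl2 : (0.6931471803 : ℝ) < Real.log 2 := Real.log_two_gt_d9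
  have hm1 : (1 : ℝ) ≤ m := by exact_mod_cast hm
  have h1 : Real.log 2 ≤ Real.log (m + 1) := Real.log_le_log (by norm_num) (by linarith)
  have h2 : m.size ≤ Nat.log 2 m + 1 := by
    rw [Nat.size_le]
    exact Nat.lt_pow_succ_log_self (by norm_num) m
  have h3 : (Nat.log 2 m : ℝ) * Real.log 2 ≤ Real.log (m + 1) := by
    rw [← Real.log_pow]
    refine Real.log_le_log (by positivity) ?_
    have : 2 ^ Nat.log 2 m ≤ m := Nat.pow_log_le_self 2 (by omega)
    have : (2 : ℝ) ^ Nat.log 2 m ≤ m := by exact_mod_cast this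
    linarith
  have h4 : (m.size : ℝ) ≤ Nat.log 2 m + 1 := by exact_mod_cast h2
  have h5 : (0 : ℝ) ≤ Nat.log 2 m := by positivity
  constructor <;> nlinarith

theorem CallArgs.time_le (c : CallArgs) {K m : ℕ} (hK : blockCost c.setup ≤ K) :
    c.time m ≤ (K + 4 * kernelRound) * (Nat.size m + 1) := by
  unfold CallArgs.time
  have : 0 ≤ kernelRound * Nat.size m := by positivity
  nlinarith [Nat.zero_le (K * m.size)]

theorem exists_momentProg_time : ∃ C : ℕ, ∀ m,
    momentCallsTime m 6 + blockCost momentOutput ≤ C * (Nat.size m + 1) := by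
  generalize blockCost momentOutput = c
  obtain ⟨K, hK⟩ : ∃ K : ℕ,
      K = ∑ j ∈ Finset.range 6, blockCost (momentArgs j).setup + 4 * kernelRound := ⟨_, rfl⟩
  have htime : ∀ m, momentCallsTime m 6 ≤ (6 * (K + 2) + 1) * (Nat.size m + 1) := by
    intro m
    have h : ∀ k ≤ 6, momentCallsTime m k ≤ (k * (K + 2) + 1) * (Nat.size m + 1) := by
      intro k hk
      induction k with
      | zero => simp [momentCallsTime]
      | succ k ih =>
        have h1 := ih (by omega)
        have h2 : (momentArgs k).time m ≤ K * (Nat.size m + 1) :=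
          hK ▸ (momentArgs k).time_le (Finset.single_le_sum
            (f := fun j => blockCost (momentArgs j).setup) (fun _ _ => Nat.zero_le _)
            (Finset.mem_range.2 (by omega)))
        rw [momentCallsTime]
        nlinarith [Nat.zero_le (Nat.size m)]
    exact h 6 le_rfl
  refine ⟨6 * (K + 2) + 1 + c, fun m => ?_⟩
  have := htime m
  nlinarith [Nat.zero_le (c * Nat.size m)]

theorem floorMoment_program :
    ∃ (P : Prog) (C : ℝ) (k : ℕ), ∀ N m a b : ℕ, 1 ≤ m → ∃ t S : ℕ,
      Outputs P [(N : ℤ), (m : ℤ), (a : ℤ), (b : ℤ)]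
        [(floorMoment 0 1 N m a b : ℤ), (floorMoment 1 1 N m a b : ℤ),
          (floorMoment 2 1 N m a b : ℤ), (floorMoment 0 2 N m a b : ℤ),
          (floorMoment 1 2 N m a b : ℤ), (floorMoment 0 3 N m a b : ℤ)]
        t S ((N + m + a + b + 2) ^ k) ∧
      (t : ℝ) ≤ C * Real.log (m + 1) ∧ (S : ℝ) ≤ C * Real.log (m + 1) := by
  obtain ⟨C, hC⟩ := exists_momentProg_time
  -- The factor 6 = 4 + 2 comes from `natSize_le_log`. The arguments have degree at most 2, so
  -- registers stay below D^(100·2), and 210 leaves room for the output block.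
  refine ⟨momentProg, 6 * C, 210, fun N m a b hm => ?_⟩
  set D := N + m + a + b + 2 with hDdef
  have hD : 2 ≤ D := by omega
  have hD1 : (1 : ℤ) ≤ D := by exact_mod_cast (by omega : 1 ≤ D)
  set s := initState [(N : ℤ), (m : ℤ), (a : ℤ), (b : ℤ)] with hs
  have hlow : ∀ i, |s.reg i| ≤ (D : ℤ) ^ 1 := by
    intro i
    rw [pow_one]
    rcases i with _ | _ | _ | _ | i
    · simp [hs, initState, hDdef]; omega
    · simp [hs, initState, hDdef]; omega
    · simp [hs, initState, hDdef]; omega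
    · simp [hs, initState, hDdef]; omega
    · simp [hs, initState, hDdef]; omega
  have hrun : Runs 0 (D ^ 210) momentProg s (momentCallsTime m 6 + blockCost momentOutput)
      (fun s' => s'.reg 0 = momentValue N m a b 0 ∧ s'.reg 1 = momentValue N m a b 1 ∧
        s'.reg 2 = momentValue N m a b 2 ∧ s'.reg 3 = momentValue N m a b 3 ∧
        s'.reg 4 = momentValue N m a b 4 ∧
        s'.reg 5 = 3 * momentValue N m a b 5 + momentValue N m a b 0) := by
    refine (runs_momentCalls (N := N) (m := m) (a := a) (b := b) hD
      (Nat.pow_le_pow_right (by omega) (by norm_num)) (fun i _ => hlow i)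
      (fun i => (hlow i).trans (pow_le_pow_right₀ hD1 (by norm_num))) rfl rfl rfl rfl 6).seq
      fun s₁ ⟨_, h2, h3⟩ => ?_
    refine (runs_block hD momentOutput (β := fun _ => 200) h2
      (by simp [momentOutput, BlockSafe]) (Nat.pow_le_pow_right (by omega) (by decide))).weaken
      le_rfl ?_
    rintro _ ⟨rfl, -⟩
    refine ⟨h3 0 (by norm_num), h3 1 (by norm_num), h3 2 (by norm_num), h3 3 (by norm_num),
      h3 4 (by norm_num), ?_⟩
    rw [← h3 5 (by norm_num), ← h3 0 (by norm_num)]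
    rfl
  obtain ⟨t, s', ht, hx, h0, h1, h2, h3, h4, h5⟩ := hrun
  obtain ⟨hl1, hl2⟩ := natSize_le_log hm
  -- Only registers are used, so zero memory cells suffice.
  refine ⟨t, 0, ⟨s', hx, ?_⟩, ?_, ?_⟩
  · have hval : ∀ (φ : ℤ → ℤ → ℤ) j, (∀ x y, affProd (momentForms j).1.1 (momentForms j).1.2.1
        (momentForms j).1.2.2 (momentForms j).2.1 (momentForms j).2.2.1 (momentForms j).2.2.2 x y
          = φ x y) → momentValue N m a b j = lineSum N m a b φ := fun φ j h => by
      rw [momentValue, funext fun x => funext fun y => h x y]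
    have m0 := hval (fun x _ => x ^ 0 * 1) 0 (fun x y => by simp [momentForms, affProd])
    intro i hi
    simp only [List.length_cons, List.length_nil] at hi
    interval_cases i
    · rw [h0, m0, ← floorMoment_one]; rfl
    · rw [h1, hval (fun x _ => x ^ 1 * 1) 1 (fun x y => by simp [momentForms, affProd]),
        ← floorMoment_one]; rfl
    · rw [h2, hval (fun x _ => x ^ 2 * 1) 2 (fun x y => by simp only [momentForms, affProd]; ring),
        ← floorMoment_one]; rfl
    · rw [h3, hval (fun x y => x ^ 0 * (2 * y - 1)) 3
        (fun x y => by simp only [momentForms, affProd]; ring), ← floorMoment_two]; rfl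
    · rw [h4, hval (fun x y => x ^ 1 * (2 * y - 1)) 4
        (fun x y => by simp only [momentForms, affProd]; ring), ← floorMoment_two]; rfl
    · rw [h5, m0, ← floorMoment_one, hval (fun x y => 1 * (y * (y - 1))) 5
        (fun x y => by simp only [momentForms, affProd]; ring), ← floorMoment_three]; rfl
  · have hT : t ≤ C * (Nat.size m + 1) := ht.trans (hC m)
    have hT' : (t : ℝ) ≤ C * (Nat.size m + 1) := by exact_mod_cast hT
    have hC0 : (0 : ℝ) ≤ C := by positivity
    nlinarith
  · have : 0 ≤ Real.log (m + 1) := by linarith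
    rw [Nat.cast_zero]
    positivity

end LatticeRect

namespace LatticeRect

/-! ### The divisor layers -/

/-- If a and x both exceeded ⌊√N⌋, then ax > N, against ax + by ≤ N. -/
theorem region_eq_union (N : ℕ) :
    region N = smallSides N (Nat.sqrt N) ∪ smallDirections N (Nat.sqrt N) := by
  ext ⟨a, b, x, y⟩
  simp only [smallSides, smallDirections, Finset.mem_union, Finset.mem_filter]
  constructor
  · intro h
    by_cases hx : x ≤ Nat.sqrt N
    · exact Or.inl ⟨h, hx⟩
    · refine Or.inr ⟨h, ?_, by omega⟩
      simp only [region, Finset.mem_filter] at h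
      by_contra ha
      have h1 : (Nat.sqrt N + 1) * (Nat.sqrt N + 1) ≤ a * x :=
        Nat.mul_le_mul (by omega) (by omega)
      have h2 := Nat.lt_succ_sqrt N
      have h3 := h.2.2.2
      simp only [Nat.succ_eq_add_one] at h2
      omega
  · rintro (h | h) <;> exact h.1

theorem disjoint_smallSides_smallDirections (N B : ℕ) :
    Disjoint (smallSides N B) (smallDirections N B) := by
  rw [Finset.disjoint_left]
  rintro z h1 h2
  simp only [smallSides, smallDirections, Finset.mem_filter] at h1 h2
  omega

/-- The summand of a layer. -/
def layerTerm (n d p q : ℕ) (X Y : ℤ) : ℤ :=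
  ((n : ℤ) - d * (p * X + q * Y)) * ((n : ℤ) - d * (q * X + p * Y))

/-- The index set of the moments. -/
def pairs (p q N : ℕ) : Finset (ℕ × ℕ) :=
  (Finset.Icc 1 N ×ˢ Finset.Icc 1 N).filter
    (fun z : ℕ × ℕ => z.2 ≤ z.1 ∧ p * z.1 + q * z.2 ≤ N)

theorem PhiOf_sum (n d p q : ℕ) (T : Finset (ℕ × ℕ)) :
    PhiOf n d p q (fun i j => ∑ z ∈ T, (z.1 : ℤ) ^ i * (z.2 : ℤ) ^ j) =
      ∑ z ∈ T, layerTerm n d p q z.1 z.2 := by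
  simp only [PhiOf, Finset.mul_sum, ← Finset.sum_add_distrib, ← Finset.sum_sub_distrib]
  refine Finset.sum_congr rfl fun z _ => ?_
  simp only [layerTerm]
  ring

theorem DeltaOf_sum (n d p q T : ℕ) :
    DeltaOf n d p q T = ∑ t ∈ Finset.Icc 1 T, layerTerm n d p q t t := by
  simp only [DeltaOf, powerSum, Finset.mul_sum, ← Finset.sum_add_distrib,
    ← Finset.sum_sub_distrib]
  refine Finset.sum_congr rfl fun z _ => ?_
  simp only [layerTerm]
  ring

theorem Phi_eq_sum (n d p q : ℕ) :
    Phi n d p q = ∑ z ∈ pairs p q (n / d), layerTerm n d p q z.1 z.2 :=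
  PhiOf_sum n d p q _

theorem PhiCap_eq_sum (n d p q : ℕ) :
    PhiCap n d p q = ∑ z ∈ (pairs p q (n / d)).filter (fun z => z.1 ≤ Nat.sqrt (n / d)),
      layerTerm n d p q z.1 z.2 := by
  refine (PhiOf_sum n d p q _).trans (Finset.sum_congr ?_ fun _ _ => rfl)
  ext ⟨X, Y⟩
  have := Nat.sqrt_le_self (n / d)
  simp only [pairs, Finset.mem_filter, Finset.mem_product, Finset.mem_Icc]
  omega

theorem sum_pairs_diag (p q N B : ℕ) (hpq : 0 < p + q) (g : ℕ → ℕ → ℤ) :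
    ∑ z ∈ (pairs p q N).filter (fun z => z.1 = z.2 ∧ z.1 ≤ B), g z.1 z.2 =
      ∑ t ∈ Finset.Icc 1 (min B (N / (p + q))), g t t := by
  refine Finset.sum_nbij' (fun z => z.1) (fun t => (t, t)) ?_ ?_ ?_ ?_ ?_
  · rintro ⟨X, Y⟩ h
    simp only [pairs, Finset.mem_filter, Finset.mem_product, Finset.mem_Icc, le_min_iff,
      Nat.le_div_iff_mul_le hpq] at h ⊢
    obtain ⟨⟨⟨h1, _⟩, _, h2⟩, rfl, h3⟩ := h
    exact ⟨h1.1, h3, by linarith⟩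
  · intro t h
    simp only [pairs, Finset.mem_filter, Finset.mem_product, Finset.mem_Icc, le_min_iff,
      Nat.le_div_iff_mul_le hpq] at h ⊢
    have h1 : t ≤ t * (p + q) := Nat.le_mul_of_pos_right _ hpq
    refine ⟨⟨⟨⟨h.1, by omega⟩, h.1, by omega⟩, le_rfl, by linarith [h.2.2]⟩, trivial, h.2.1⟩
  · rintro ⟨X, Y⟩ h
    simp only [Finset.mem_filter] at h
    ext <;> simp [h.2.1]
  · intro t _; rfl
  · rintro ⟨X, Y⟩ h
    simp only [Finset.mem_filter] at h
    simp [h.2.1]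

theorem Delta_eq_sum (n d p q : ℕ) (hpq : 0 < p + q) :
    Delta n d p q = ∑ z ∈ (pairs p q (n / d)).filter (fun z => z.1 = z.2),
      layerTerm n d p q z.1 z.2 := by
  have h := sum_pairs_diag p q (n / d) (n / d) hpq (fun X Y => layerTerm n d p q X Y)
  rw [min_eq_right (Nat.div_le_self _ _)] at h
  rw [Delta, DeltaOf_sum, ← h]
  refine Finset.sum_congr ?_ fun _ _ => rfl
  ext ⟨X, Y⟩
  simp only [pairs, Finset.mem_filter, Finset.mem_product, Finset.mem_Icc]
  omega

theorem DeltaCap_eq_sum (n d p q : ℕ) (hpq : 0 < p + q) :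
    DeltaCap n d p q = ∑ z ∈ (pairs p q (n / d)).filter
        (fun z => z.1 = z.2 ∧ z.1 ≤ Nat.sqrt (n / d)), layerTerm n d p q z.1 z.2 := by
  rw [sum_pairs_diag p q (n / d) _ hpq (fun X Y => layerTerm n d p q X Y), DeltaCap, DeltaOf_sum]

/-- The weights agree pointwise. For X > Y they are 4 + 4[X > B] = 8 - 4[X ≤ B]; for X = Y they are
2[X > B] = 8 - 6 - 4[X ≤ B] + 2[X ≤ B]. -/
theorem sum_pairs_combination (n d p q : ℕ) (hpq : 0 < p + q) :
    4 * ∑ z ∈ (pairs p q (n / d)).filter (fun z => z.2 < z.1), layerTerm n d p q z.1 z.2 +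
      ∑ z ∈ (pairs p q (n / d)).filter (fun z => Nat.sqrt (n / d) < z.1),
        mult z.1 z.2 * layerTerm n d p q z.1 z.2 =
    8 * Phi n d p q - 6 * Delta n d p q - 4 * PhiCap n d p q + 2 * DeltaCap n d p q := by
  rw [Phi_eq_sum, PhiCap_eq_sum, Delta_eq_sum n d p q hpq, DeltaCap_eq_sum n d p q hpq]
  simp only [Finset.sum_filter, Finset.mul_sum, ← Finset.sum_add_distrib,
    ← Finset.sum_sub_distrib]
  refine Finset.sum_congr rfl fun z hz => ?_
  simp only [pairs, Finset.mem_filter] at hz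
  have hle := hz.2.1
  simp only [mult]
  by_cases h1 : z.1 = z.2
  · by_cases h2 : z.1 ≤ Nat.sqrt (n / d)
    · rw [if_neg (by omega), if_neg (by omega), if_pos h1, if_pos h2, if_pos ⟨h1, h2⟩]
      ring
    · rw [if_neg (by omega), if_pos (by omega), if_pos h1, if_pos h1, if_neg h2,
        if_neg (by omega)]
      ring
  · by_cases h2 : z.1 ≤ Nat.sqrt (n / d)
    · rw [if_pos (by omega), if_neg (by omega), if_neg h1, if_pos h2, if_neg (by omega)]
      ring
    · rw [if_pos (by omega), if_pos (by omega), if_neg h1, if_neg h1, if_neg h2,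
        if_neg (by omega)]
      ring

/-- For p = q = t the summand depends only on s = X + Y, and ⌊(s-1)/2⌋ counts the pairs X > Y ≥ 1
with sum s. -/
theorem diagSide_eq_sum (n d t : ℕ) (ht : 0 < t) :
    diagSide n d t = 2 * ∑ z ∈ (pairs t t (n / d)).filter (fun z => z.2 < z.1),
      layerTerm n d t t z.1 z.2 := by
  have h : ∀ s ∈ Finset.Icc 1 (n / d / t),
      (((s - 1) / 2 : ℕ) : ℤ) * ((n : ℤ) - d * t * s) ^ 2 =
        ∑ y ∈ Finset.Icc 1 ((s - 1) / 2), ((n : ℤ) - d * t * s) ^ 2 := by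
    intro s _
    rw [Finset.sum_const, Nat.card_Icc, Nat.add_sub_cancel, nsmul_eq_mul]
  rw [diagSide, Finset.sum_congr rfl h, Finset.sum_sigma']
  congr 1
  refine Finset.sum_nbij' (fun z => (z.1 - z.2, z.2)) (fun z => ⟨z.1 + z.2, z.2⟩) ?_ ?_ ?_ ?_ ?_
  · rintro ⟨s, y⟩ h
    simp only [pairs, Finset.mem_sigma, Finset.mem_filter, Finset.mem_product, Finset.mem_Icc,
      Nat.le_div_iff_mul_le ht] at h ⊢
    have h1 : s ≤ s * t := Nat.le_mul_of_pos_right _ ht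
    have h2 : t * (s - y) + t * y = s * t := by rw [← mul_add, mul_comm]; congr 1; omega
    omega
  · rintro ⟨X, Y⟩ h
    simp only [pairs, Finset.mem_sigma, Finset.mem_filter, Finset.mem_product, Finset.mem_Icc,
      Nat.le_div_iff_mul_le ht] at h ⊢
    have h2 : (X + Y) * t = t * X + t * Y := by ring
    omega
  · rintro ⟨s, y⟩ h
    simp only [Finset.mem_sigma, Finset.mem_Icc] at h
    simp only [Sigma.mk.injEq, heq_eq_eq, and_true]
    omega
  · rintro ⟨X, Y⟩ _
    simp
  · rintro ⟨s, y⟩ h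
    simp only [Finset.mem_sigma, Finset.mem_Icc] at h
    have hy : y ≤ s := by omega
    simp only [layerTerm]
    push_cast [hy]
    ring

theorem sum_smallDirections (n d : ℕ) :
    ∑ z ∈ smallDirections (n / d) (Nat.sqrt (n / d)),
      mult z.2.2.1 z.2.2.2 *
        (((n : ℤ) - d * (z.1 * z.2.2.1 + z.2.1 * z.2.2.2)) *
          ((n : ℤ) - d * (z.2.1 * z.2.2.1 + z.1 * z.2.2.2))) =
    ∑ p ∈ Finset.Icc 1 (Nat.sqrt (n / d)), ∑ q ∈ Finset.Ico 1 p,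
      ∑ z ∈ (pairs p q (n / d)).filter (fun z => Nat.sqrt (n / d) < z.1),
        mult z.1 z.2 * layerTerm n d p q z.1 z.2 := by
  have hB := Nat.sqrt_le_self (n / d)
  simp only [Finset.sum_sigma']
  refine Finset.sum_nbij' (fun z => ⟨z.1, z.2.1, (z.2.2.1, z.2.2.2)⟩)
    (fun z => (z.1, z.2.1, z.2.2.1, z.2.2.2)) ?_ ?_ ?_ ?_ ?_
  · rintro ⟨a, b, x, y⟩ h
    simp only [smallDirections, region, pairs, Finset.mem_sigma, Finset.mem_filter,
      Finset.mem_product, Finset.mem_Icc, Finset.mem_Ico] at h ⊢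
    omega
  · rintro ⟨p, q, X, Y⟩ h
    simp only [smallDirections, region, pairs, Finset.mem_sigma, Finset.mem_filter,
      Finset.mem_product, Finset.mem_Icc, Finset.mem_Ico] at h ⊢
    omega
  · rintro ⟨a, b, x, y⟩ _; rfl
  · rintro ⟨p, q, X, Y⟩ _; rfl
  · rintro ⟨a, b, x, y⟩ _; rfl

/-- The summand is symmetric under (a,b) ↔ (x,y), so the short sides can play the role of (p,q). The
multiplicity is then constant on each inner sum, and a > b makes the running pair strict. -/
theorem sum_smallSides (n d : ℕ) :
    ∑ z ∈ smallSides (n / d) (Nat.sqrt (n / d)),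
      mult z.2.2.1 z.2.2.2 *
        (((n : ℤ) - d * (z.1 * z.2.2.1 + z.2.1 * z.2.2.2)) *
          ((n : ℤ) - d * (z.2.1 * z.2.2.1 + z.1 * z.2.2.2))) =
    ∑ p ∈ Finset.Icc 1 (Nat.sqrt (n / d)), ∑ q ∈ Finset.Icc 1 p,
      ∑ z ∈ (pairs p q (n / d)).filter (fun z => z.2 < z.1),
        mult p q * layerTerm n d p q z.1 z.2 := by
  have hB := Nat.sqrt_le_self (n / d)
  simp only [Finset.sum_sigma']
  refine Finset.sum_nbij' (fun z => ⟨z.2.2.1, z.2.2.2, (z.1, z.2.1)⟩)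
    (fun z => (z.2.2.1, z.2.2.2, z.1, z.2.1)) ?_ ?_ ?_ ?_ ?_
  · rintro ⟨a, b, x, y⟩ h
    simp only [smallSides, region, pairs, Finset.mem_sigma, Finset.mem_filter,
      Finset.mem_product, Finset.mem_Icc] at h ⊢
    rw [mul_comm x, mul_comm y]
    omega
  · rintro ⟨p, q, X, Y⟩ h
    simp only [smallSides, region, pairs, Finset.mem_sigma, Finset.mem_filter,
      Finset.mem_product, Finset.mem_Icc] at h ⊢
    rw [mul_comm X, mul_comm Y]
    omega
  · rintro ⟨a, b, x, y⟩ _; rfl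
  · rintro ⟨p, q, X, Y⟩ _; rfl
  · rintro ⟨a, b, x, y⟩ _
    simp only [layerTerm]
    ring

theorem layer_formula (n d : ℕ) :
    layer d n =
      ∑ p ∈ Finset.Icc 1 (Nat.sqrt (n / d)), ∑ q ∈ Finset.Ico 1 p,
        (8 * Phi n d p q - 6 * Delta n d p q - 4 * PhiCap n d p q + 2 * DeltaCap n d p q)
      + ∑ t ∈ Finset.Icc 1 (Nat.sqrt (n / d)), diagSide n d t := by
  rw [layer, region_eq_union, Finset.sum_union (disjoint_smallSides_smallDirections _ _),
    sum_smallSides, sum_smallDirections, ← Finset.sum_add_distrib, ← Finset.sum_add_distrib]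
  refine Finset.sum_congr rfl fun p hp => ?_
  have hp1 := (Finset.mem_Icc.1 hp).1
  -- The small sides include q = p, the small directions do not; this extra term is the
  -- diagonal-side term.
  rw [← Finset.Ico_insert_right hp1, Finset.sum_insert Finset.right_notMem_Ico,
    diagSide_eq_sum n d p hp1]
  simp only [← Finset.mul_sum]
  rw [add_assoc, ← Finset.sum_add_distrib, add_comm]
  congr 1
  · refine Finset.sum_congr rfl fun q hq => ?_
    have hq1 := Finset.mem_Ico.1 hq
    rw [← sum_pairs_combination n d p q (by omega)]
    congr 2
    exact if_neg (by omega)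
  · congr 1
    exact if_pos rfl

/-! ### The ingredients of a layer as sums below a line -/

/-- Let E = ⌊N/p⌋, r = N mod p, and substitute x = E - (X - Y), y = Y. Then pX + qY ≤ N reads (p+q)y
≤ px + r, and Y ≤ X reads x ≤ E. -/
theorem Phi_eq_lineSum (n d p q : ℕ) (hp : 0 < p) :
    Phi n d p q = lineSum (n / d / p + 1) (p + q) p (n / d % p)
      (fun x y => layerTerm n d p q ((n / d / p : ℕ) - x + y) y) := by
  set N := n / d
  have hdm := Nat.div_add_mod N p
  set E := N / p
  set r := N % p
  rw [Phi_eq_sum, lineSum, Finset.sum_sigma']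
  refine Finset.sum_nbij' (fun z => ⟨E - (z.1 - z.2), z.2⟩) (fun z => (E - z.1 + z.2, z.2))
    ?_ ?_ ?_ ?_ ?_
  · rintro ⟨X, Y⟩ h
    simp only [pairs, Finset.mem_sigma, Finset.mem_filter, Finset.mem_product, Finset.mem_Icc,
      Finset.mem_range, Nat.le_div_iff_mul_le (by omega : 0 < p + q)] at h ⊢
    obtain ⟨e, rfl⟩ := Nat.exists_eq_add_of_le h.2.1
    have hm : p * (Y + e) + q * Y ≤ N := h.2.2
    have heE : e ≤ E := (Nat.le_div_iff_mul_le hp).2 (by nlinarith)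
    refine ⟨by omega, h.1.2.1, ?_⟩
    rw [Nat.add_sub_cancel_left, Nat.mul_sub]
    have : p * e ≤ p * E := Nat.mul_le_mul_left _ heE
    zify [this] at *
    nlinarith
  · rintro ⟨x, y⟩ h
    simp only [pairs, Finset.mem_sigma, Finset.mem_filter, Finset.mem_product, Finset.mem_Icc,
      Finset.mem_range, Nat.le_div_iff_mul_le (by omega : 0 < p + q)] at h ⊢
    obtain ⟨hx, hy1, hy⟩ := h
    have hle : p * (E - x + y) + q * y ≤ N := by
      have : x ≤ E := by omega
      zify [this] at *
      nlinarith
    have h1 : E - x + y ≤ p * (E - x + y) := Nat.le_mul_of_pos_left _ hp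
    exact ⟨by omega, by omega, hle⟩
  · rintro ⟨X, Y⟩ h
    simp only [pairs, Finset.mem_filter, Finset.mem_product, Finset.mem_Icc] at h
    have h1 : p * X ≤ N := by omega
    have h2 : X ≤ E := (Nat.le_div_iff_mul_le hp).2 (by linarith)
    simp only [Prod.mk.injEq, and_true]
    omega
  · rintro ⟨x, y⟩ h
    simp only [Finset.mem_sigma, Finset.mem_range] at h
    simp only [Sigma.mk.injEq, heq_eq_eq, and_true]
    omega
  · rintro ⟨X, Y⟩ h
    simp only [pairs, Finset.mem_filter, Finset.mem_product, Finset.mem_Icc] at h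
    have h1 : p * X ≤ N := by omega
    have h2 : X ≤ E := (Nat.le_div_iff_mul_le hp).2 (by linarith)
    have h3 : X - Y ≤ E := by omega
    simp only
    rw [Nat.cast_sub h3, Nat.cast_sub h.2.1]
    congr 1
    ring

/-- A one-dimensional sum in the format of the kernel: each column consists of y = 1 only, so x + y
runs over 1, …, T. -/
theorem DeltaOf_eq_lineSum (n d p q T : ℕ) :
    DeltaOf n d p q T = lineSum T 1 0 1 (fun x y => layerTerm n d p q (x + y) (x + y)) := by
  have h := Finset.sum_Ico_add' (fun t : ℕ => layerTerm n d p q t t) 0 T 1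
  rw [DeltaOf_sum, lineSum, Finset.range_eq_Ico]
  refine h.symm.trans (Finset.sum_congr rfl fun x _ => ?_)
  simp

/-- Here X > B implies (p+q)X > N, so pX + qY ≤ N already forces Y < X. Without the order condition
the part X > B lies below the single line qy ≤ px + r, where x = E - X, y = Y. -/
theorem PhiCap_eq_lineSum_of_lt (n d p q : ℕ) (hp : 0 < p) (hq : 0 < q)
    (h : n / d / (p + q) < Nat.sqrt (n / d)) :
    PhiCap n d p q = Phi n d p q -
      lineSum (n / d / p - Nat.sqrt (n / d)) q p (n / d % p)
        (fun x y => layerTerm n d p q ((n / d / p : ℕ) - x) y) := by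
  have hsplit : Phi n d p q = PhiCap n d p q +
      ∑ z ∈ (pairs p q (n / d)).filter (fun z => ¬ z.1 ≤ Nat.sqrt (n / d)),
        layerTerm n d p q z.1 z.2 := by
    rw [Phi_eq_sum, PhiCap_eq_sum, Finset.sum_filter_add_sum_filter_not]
  rw [hsplit, eq_sub_iff_add_eq]
  congr 1
  set N := n / d
  have hdm := Nat.div_add_mod N p
  set E := N / p
  set r := N % p
  set B := Nat.sqrt N
  rw [lineSum, Finset.sum_sigma']
  refine Finset.sum_nbij' (fun z => (E - z.1, z.2)) (fun z => ⟨E - z.1, z.2⟩) ?_ ?_ ?_ ?_ ?_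
  · rintro ⟨x, y⟩ hz
    simp only [pairs, Finset.mem_sigma, Finset.mem_filter, Finset.mem_product, Finset.mem_Icc,
      Finset.mem_range, Nat.le_div_iff_mul_le hq] at hz ⊢
    obtain ⟨hx, hy1, hy⟩ := hz
    obtain ⟨X, hX⟩ : ∃ X, E = x + X := Nat.exists_eq_add_of_le (by omega)
    rw [hX, Nat.add_sub_cancel_left]
    have hle : p * X + q * y ≤ N := by rw [hX] at hdm; nlinarith
    have hBX : N < (p + q) * X := by
      have h1 : N < (p + q) * (N / (p + q) + 1) := Nat.lt_mul_div_succ N (by omega)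
      exact h1.trans_le (Nat.mul_le_mul_left _ (by omega))
    have hyX : y ≤ X := by
      by_contra hc
      have : q * X ≤ q * y := Nat.mul_le_mul_left _ (by omega)
      nlinarith
    have hXN : X ≤ p * X := Nat.le_mul_of_pos_left _ hp
    exact ⟨⟨⟨⟨by omega, by omega⟩, by omega, by omega⟩, hyX, hle⟩, by omega⟩
  · rintro ⟨X, Y⟩ hz
    simp only [pairs, Finset.mem_sigma, Finset.mem_filter, Finset.mem_product, Finset.mem_Icc,
      Finset.mem_range, Nat.le_div_iff_mul_le hq] at hz ⊢
    have hle : p * X + q * Y ≤ N := hz.1.2.2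
    have hXE : X ≤ E := (Nat.le_div_iff_mul_le hp).2 (by nlinarith)
    refine ⟨by omega, by omega, ?_⟩
    zify [hXE] at *
    nlinarith
  · rintro ⟨x, y⟩ hz
    simp only [Finset.mem_sigma, Finset.mem_range] at hz
    simp only [Sigma.mk.injEq, heq_eq_eq, and_true]
    omega
  · rintro ⟨X, Y⟩ hz
    simp only [pairs, Finset.mem_filter, Finset.mem_product, Finset.mem_Icc] at hz
    have hXE : X ≤ E := (Nat.le_div_iff_mul_le hp).2 (by nlinarith)
    simp only [Prod.mk.injEq, and_true]
    omega
  · rintro ⟨x, y⟩ hz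
    simp only [Finset.mem_sigma, Finset.mem_range] at hz
    have : x ≤ E := by omega
    simp only
    rw [Nat.cast_sub this]

/-- Here (p+q)B ≤ N, so the linear constraint holds on the whole triangle Y ≤ X ≤ B. The column x =
0 is empty and only serves the indexing. -/
theorem PhiCap_eq_lineSum_of_le (n d p q : ℕ) (hp : 0 < p)
    (h : Nat.sqrt (n / d) ≤ n / d / (p + q)) :
    PhiCap n d p q = lineSum (Nat.sqrt (n / d) + 1) 1 1 0
        (fun x y => layerTerm n d p q x y) := by
  have hB := Nat.sqrt_le_self (n / d)
  rw [PhiCap_eq_sum, lineSum, Finset.sum_sigma']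
  set N := n / d
  set B := Nat.sqrt N
  rw [Nat.le_div_iff_mul_le (by omega)] at h
  refine Finset.sum_nbij' (fun z => ⟨z.1, z.2⟩) (fun z => (z.1, z.2)) ?_ ?_ ?_ ?_ ?_
  · rintro ⟨X, Y⟩ hz
    simp only [pairs, Finset.mem_sigma, Finset.mem_filter, Finset.mem_product, Finset.mem_Icc,
      Finset.mem_range, Nat.div_one] at hz ⊢
    omega
  · rintro ⟨x, y⟩ hz
    simp only [pairs, Finset.mem_sigma, Finset.mem_filter, Finset.mem_product, Finset.mem_Icc,
      Finset.mem_range, Nat.div_one] at hz ⊢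
    have hx : p * x ≤ p * B := Nat.mul_le_mul_left _ (by omega)
    have hy : q * y ≤ q * B := Nat.mul_le_mul_left _ (by omega)
    have : p * x + q * y ≤ N := by nlinarith
    omega
  · rintro ⟨X, Y⟩ _; rfl
  · rintro ⟨x, y⟩ _; rfl
  · rintro ⟨X, Y⟩ _; rfl

/-- With q = 0 and both arguments equal to x + 1 the layer summand becomes the square (n -
dt(x+1))², and the number ⌊x/2⌋ is the height of a column under a line of slope 1/2. -/
theorem diagSide_eq_lineSum (n d t : ℕ) :
    diagSide n d t = 2 * lineSum (n / d / t) 2 1 0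
      (fun x _ => layerTerm n d t 0 (x + 1) (x + 1)) := by
  rw [diagSide, lineSum, Finset.range_eq_Ico]
  congr 1
  have h := Finset.sum_Ico_add' (fun s : ℕ => (((s - 1) / 2 : ℕ) : ℤ) *
    ((n : ℤ) - d * t * s) ^ 2) 0 (n / d / t) 1
  rw [zero_add] at h
  refine (h.symm.trans (Finset.sum_congr rfl fun x _ => ?_))
  rw [Finset.sum_const, Nat.card_Icc, nsmul_eq_mul]
  simp only [layerTerm, Nat.add_sub_cancel, one_mul, add_zero]
  push_cast
  ring

end LatticeRect

namespace LatticeRect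

/-! ### The program for one layer -/

/-- No memory access and no division. -/
def Expr.divFree : Expr → Bool
  | .const _ => true
  | .reg _ => true
  | .load _ => false
  | .add e₁ e₂ => e₁.divFree && e₂.divFree
  | .sub e₁ e₂ => e₁.divFree && e₂.divFree
  | .mul e₁ e₂ => e₁.divFree && e₂.divFree
  | .div _ _ => false

theorem Expr.safe_of_divFree (s : State) : ∀ {e : Expr}, e.divFree = true → e.Safe s
  | .const _, _ => trivial
  | .reg _, _ => trivial
  | .add _ _, h => by
    rw [divFree, Bool.and_eq_true] at h
    exact ⟨safe_of_divFree s h.1, safe_of_divFree s h.2⟩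
  | .sub _ _, h => by
    rw [divFree, Bool.and_eq_true] at h
    exact ⟨safe_of_divFree s h.1, safe_of_divFree s h.2⟩
  | .mul _ _, h => by
    rw [divFree, Bool.and_eq_true] at h
    exact ⟨safe_of_divFree s h.1, safe_of_divFree s h.2⟩

instance Expr.decidableBelow (k : ℕ) : (e : Expr) → Decidable (e.Below k)
  | .const _ => .isTrue trivial
  | .reg i => Nat.decLt i k
  | .load _ => .isFalse not_false
  | .add e₁ e₂ => @instDecidableAnd _ _ (decidableBelow k e₁) (decidableBelow k e₂)
  | .sub e₁ e₂ => @instDecidableAnd _ _ (decidableBelow k e₁) (decidableBelow k e₂)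
  | .mul e₁ e₂ => @instDecidableAnd _ _ (decidableBelow k e₁) (decidableBelow k e₂)
  | .div e₁ e₂ => @instDecidableAnd _ _ (decidableBelow k e₁) (decidableBelow k e₂)

/-- State condition inside the computation of a layer: `s₀` is the state in which the computation
started, register `50` holds the partial sum `T`, and `c` bounds the weighted number of calls so
far. -/
structure LayerState (D : ℕ) (s₀ : State) (T : ℤ) (c : ℕ) (s : State) : Prop where
  low : ∀ i < 10, |s.reg i| ≤ (D : ℤ)
  total : s.reg 50 = T
  total_le : |T| ≤ c * (D : ℤ) ^ 438
  mem_eq : s.mem = s₀.mem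
  frame : ∀ i, 51 ≤ i → s.reg i = s₀.reg i
  all : ∀ i, |s.reg i| ≤ (D : ℤ) ^ 600

theorem LayerState.mono {D : ℕ} {s₀ s : State} {T : ℤ} {c c' : ℕ}
    (h : LayerState D s₀ T c s) (hc : c ≤ c') : LayerState D s₀ T c' s :=
  { h with
    total_le := h.total_le.trans (by gcongr) }

/-- Degrees of the registers inside the computation of a layer. -/
def layerDegrees (i : ℕ) : ℕ := if i < 10 then 1 else 600

theorem LayerState.degrees {D : ℕ} {s₀ s : State} {T : ℤ} {c : ℕ}
    (h : LayerState D s₀ T c s) (i : ℕ) : |s.reg i| ≤ (D : ℤ) ^ layerDegrees i := by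
  unfold layerDegrees
  split_ifs with hi
  · simpa using h.low i hi
  · exact h.all i

/-- An assignment to one of the first ten registers. -/
theorem LayerState.runs_set {S W D : ℕ} (hD : 2 ≤ D) (hW : D ^ 610 ≤ W) {s₀ s : State} {T : ℤ}
    {c : ℕ} (h : LayerState D s₀ T c s) {k : ℕ} (hk : k < 10) {e : Expr}
    (hdeg : e.degree layerDegrees ≤ 600) (hsafe : e.Safe s) (he : |e.eval s| ≤ D) :
    Runs S W (block [(k, e)]) s (blockCost [(k, e)])
      (fun s' => s'.reg k = e.eval s ∧ (∀ i, i ≠ k → s'.reg i = s.reg i) ∧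
        LayerState D s₀ T c s') := by
  refine (runs_block hD [(k, e)] h.degrees ⟨hsafe, trivial⟩ ((Nat.pow_le_pow_right (by omega)
    ((max_le hdeg (Nat.zero_le _)).trans (by norm_num : 600 ≤ 610))).trans hW)).weaken le_rfl ?_
  rintro _ ⟨rfl, -⟩
  have hself : (evalBlock [(k, e)] s).reg k = e.eval s := Function.update_self _ _ _
  have hne : ∀ i, i ≠ k → (evalBlock [(k, e)] s).reg i = s.reg i := fun i hi =>
    Function.update_of_ne hi _ _
  refine ⟨hself, hne, fun i hi => ?_, by rw [hne 50 (by omega), h.total], h.total_le, h.mem_eq,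
    fun i hi => by rw [hne i (by omega), h.frame i hi], fun i => ?_⟩
  · by_cases hik : i = k
    · rw [hik, hself]; exact he
    · rw [hne i hik]; exact h.low i hi
  · by_cases hik : i = k
    · rw [hik, hself]
      exact he.trans (le_self_pow₀ (by exact_mod_cast (by omega : 1 ≤ D)) (by norm_num))
    · rw [hne i hik]; exact h.all i

section TermCall

open LatticeRect.Expr (reg)

/-- A call of the kernel with the summand `layerTerm`, evaluated at
`X = X₀ + X₁ x + X₂ y`, `Y = Y₀ + Y₁ x + Y₂ y`. -/
def termArgs (N m a b X₀ X₁ X₂ Y₀ Y₁ Y₂ : Expr) : CallArgs :=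
  ⟨N, m, a, b,
    reg 0 - reg 1 * (reg 4 * X₀ + reg 5 * Y₀), 0 - reg 1 * (reg 4 * X₁ + reg 5 * Y₁),
    0 - reg 1 * (reg 4 * X₂ + reg 5 * Y₂),
    reg 0 - reg 1 * (reg 5 * X₀ + reg 4 * Y₀), 0 - reg 1 * (reg 5 * X₁ + reg 4 * Y₁),
    0 - reg 1 * (reg 5 * X₂ + reg 4 * Y₂)⟩

/-- Add `κ` times the result of a call to the partial sum. -/
def CallArgs.addTo (c : CallArgs) (κ : ℤ) : Prog :=
  .seq c.call (.assign 50 (reg 50 + .const κ * reg 14))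

end TermCall

/-- The arguments are free of divisions, depend on the first ten registers only, and have small
degree. -/
def CallArgs.Static (c : CallArgs) : Prop :=
  ∀ x ∈ c.setup, x.2.Below 10 ∧ x.2.divFree = true ∧ x.2.degree (fun _ => 1) ≤ 6

instance (c : CallArgs) : Decidable c.Static := by
  unfold CallArgs.Static
  infer_instance

theorem count_mul_pow_le {D c : ℕ} (hD : 2 ≤ D) (hc : c ≤ 60 * D ^ 2) :
    (c : ℤ) * (D : ℤ) ^ 438 ≤ (D : ℤ) ^ 600 := by
  have h1 : c ≤ D ^ 8 := by
    calc c ≤ 60 * D ^ 2 := hc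
      _ ≤ 2 ^ 6 * D ^ 2 := by gcongr; norm_num
      _ ≤ D ^ 6 * D ^ 2 := by gcongr
      _ = D ^ 8 := by ring
  have h2 : c * D ^ 438 ≤ D ^ 600 := by
    calc c * D ^ 438 ≤ D ^ 8 * D ^ 438 := by gcongr
      _ = D ^ 446 := (pow_add D 8 438).symm
      _ ≤ D ^ 600 := Nat.pow_le_pow_right (by omega) (by norm_num)
  exact_mod_cast h2

/-- Arguments of degree at most 6 give the exponents 100·6 = 600 and 73·6 = 438. Thus a call changes
the partial sum by at most |κ| units of D^438, which is what the counter of `LayerState` records. -/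
theorem exists_runs_addTo (c : CallArgs) (hstat : c.Static) (κ : ℤ) (hκ : κ.natAbs ≤ 8) :
    ∃ K : ℕ, ∀ {S W D : ℕ} {s₀ s : State} {T : ℤ} {cnt N m a b : ℕ} (_ : 2 ≤ D)
      (_ : D ^ 610 ≤ W) (_ : LayerState D s₀ T cnt s) (_ : cnt + κ.natAbs ≤ 60 * D ^ 2)
      (_ : c.N.eval s = N) (_ : c.m.eval s = m) (_ : c.a.eval s = a) (_ : c.b.eval s = b),
      Runs S W (c.addTo κ) s (K * (Nat.size m + 1)) (fun s' => (∀ i < 10, s'.reg i = s.reg i) ∧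
        LayerState D s₀ (T + κ * lineSum N m a b (affProd (c.u₀.eval s) (c.u₁.eval s)
          (c.u₂.eval s) (c.v₀.eval s) (c.v₁.eval s) (c.v₂.eval s))) (cnt + κ.natAbs) s') := by
  refine ⟨blockCost c.setup + 4 * kernelRound + 6, ?_⟩
  intro S W D s₀ s T cnt N m a b hD hW h hcnt hN hm ha hb
  have hD1 : (1 : ℤ) ≤ D := by exact_mod_cast (by omega : 1 ≤ D)
  have hadm : c.Admissible 1 6 s := fun x hx =>
    ⟨(hstat x hx).1, Expr.safe_of_divFree s (hstat x hx).2.1, (hstat x hx).2.2⟩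
  have hW' : D ^ (100 * 6) ≤ W :=
    (Nat.pow_le_pow_right (by omega) (by norm_num : 100 * 6 ≤ 610)).trans hW
  have hrun := runs_call (S := S) (W := W) (E := 6) (A := 1) hD (by norm_num) hW'
    (fun i hi => by simpa using h.low i hi) h.all hadm hN hm ha hb
  refine Runs.weaken (hrun.seq (T' := 6) (Q := fun s' => (∀ i < 10, s'.reg i = s.reg i) ∧
        LayerState D s₀ (T + κ * lineSum N m a b (affProd (c.u₀.eval s) (c.u₁.eval s)
          (c.u₂.eval s) (c.v₀.eval s) (c.v₁.eval s) (c.v₂.eval s))) (cnt + κ.natAbs) s')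
      fun s₁ ⟨h1, h2, h3, h4, h5⟩ => ?_) ?_ fun _ hs => hs
  · have hsafe : (Expr.reg 50 + .const κ * Expr.reg 14).Safe s₁ := by simp
    have hok := hsafe.ok (S := S) (W := W) hD (β := fun _ => 600) h5
      ((Nat.pow_le_pow_right (by omega) ?_).trans hW)
    · refine Runs.assign hok ?_
      have hev : (Expr.reg 50 + .const κ * Expr.reg 14).eval s₁ =
          T + κ * lineSum N m a b (affProd (c.u₀.eval s) (c.u₁.eval s)
            (c.u₂.eval s) (c.v₀.eval s) (c.v₁.eval s) (c.v₂.eval s)) := by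
        rw [← h1, ← h.total, ← h4 50 (Or.inr le_rfl)]
        rfl
      rw [hev]
      have hbound : |T + κ * lineSum N m a b (affProd (c.u₀.eval s) (c.u₁.eval s)
            (c.u₂.eval s) (c.v₀.eval s) (c.v₁.eval s) (c.v₂.eval s))| ≤
          ((cnt + κ.natAbs : ℕ) : ℤ) * (D : ℤ) ^ 438 := by
        rw [← h1]
        refine (abs_add_le _ _).trans ?_
        rw [abs_mul, Int.abs_eq_natAbs κ]
        push_cast
        rw [add_mul]
        exact add_le_add h.total_le (mul_le_mul_of_nonneg_left h2 (by positivity))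
      refine ⟨fun i hi => ?_, fun i hi => ?_, by simp, hbound,
        h3.trans h.mem_eq, fun i hi => ?_, fun i => ?_⟩
      · exact (Function.update_of_ne (by omega) _ _).trans (h4 i (Or.inl hi))
      · simp only
        rw [Function.update_of_ne (by omega), h4 i (Or.inl hi)]
        exact h.low i hi
      · simp only
        rw [Function.update_of_ne (by omega), h4 i (Or.inr (by omega)), h.frame i hi]
      · by_cases hi : i = 50
        · subst hi
          simp only [Function.update_self]
          exact hbound.trans (count_mul_pow_le hD hcnt)
        · simp only [Function.update_of_ne hi]
          exact h5 i
    · change max 600 (κ.natAbs + 600) + 1 ≤ 610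
      omega
  · have := c.time_le (m := m) (K := blockCost c.setup) le_rfl
    nlinarith [Nat.zero_le m.size]

theorem affProd_termArgs {n d p q : ℕ} {s : State} (h0 : s.reg 0 = n) (h1 : s.reg 1 = d)
    (h4 : s.reg 4 = p) (h5 : s.reg 5 = q) (N m a b X₀ X₁ X₂ Y₀ Y₁ Y₂ : Expr)
    {φ : ℤ → ℤ → ℤ} (hφ : ∀ x y, φ x y = layerTerm n d p q
      (X₀.eval s + X₁.eval s * x + X₂.eval s * y) (Y₀.eval s + Y₁.eval s * x + Y₂.eval s * y)) :
    let c := termArgs N m a b X₀ X₁ X₂ Y₀ Y₁ Y₂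
    affProd (c.u₀.eval s) (c.u₁.eval s) (c.u₂.eval s) (c.v₀.eval s) (c.v₁.eval s)
      (c.v₂.eval s) = φ := by
  intro c
  funext x y
  rw [hφ]
  simp only [c, termArgs, affProd, layerTerm, Expr.eval_add, Expr.eval_sub, Expr.eval_mul,
    Expr.eval_reg, Expr.eval_ofNat, h0, h1, h4, h5]
  push_cast
  ring

section LayerProgram

open LatticeRect.Expr (reg)

/-- The terms `Φ`; register `6` holds `⌊N / p⌋` and register `8` holds `N mod p`. -/
def phiArgs : CallArgs :=
  termArgs (reg 6 + 1) (reg 4 + reg 5) (reg 4) (reg 8) (reg 6) (.const (-1)) 1 0 0 1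

/-- The terms `Δ`; register `7` holds `⌊N / (p + q)⌋`. -/
def deltaArgs : CallArgs := termArgs (reg 7) 1 0 1 0 1 1 0 1 1

/-- The terms of `Φ` with `X > B`, if `⌊N / (p + q)⌋ < B`. -/
def tailArgs : CallArgs :=
  termArgs (reg 6 - reg 3) (reg 5) (reg 4) (reg 8) (reg 6) (.const (-1)) 0 0 0 1

/-- The capped terms `Φ`, if `B ≤ ⌊N / (p + q)⌋`. -/
def triangleArgs : CallArgs := termArgs (reg 3 + 1) 1 1 0 0 1 0 0 0 1

/-- The capped terms `Δ`, if `B ≤ ⌊N / (p + q)⌋`. -/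
def deltaCapArgs : CallArgs := termArgs (reg 3) 1 0 1 0 1 1 0 1 1

/-- The diagonal-side terms. -/
def diagArgs : CallArgs := termArgs (reg 6) 2 1 0 1 1 0 1 1 0

/-- The contribution of one pair `(p, q)`. -/
def cellProg : Prog :=
  .seq (block [(7, reg 2 / (reg 4 + reg 5))])
    (.seq (.ifPos (reg 3 - reg 7)
      (.seq (phiArgs.addTo 4) (.seq (deltaArgs.addTo (-4)) (tailArgs.addTo 4)))
      (.seq (phiArgs.addTo 8) (.seq (deltaArgs.addTo (-6))
        (.seq (triangleArgs.addTo (-4)) (deltaCapArgs.addTo 2)))))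
    (block [(5, reg 5 + 1)]))

/-- The contribution of one value of `p`. -/
def rowProg : Prog :=
  .seq (block [(5, 0)])
    (.seq (block [(6, reg 2 / reg 4)])
    (.seq (block [(8, reg 2 - reg 4 * reg 6)])
    (.seq (diagArgs.addTo 2)
    (.seq (block [(5, 1)])
    (.seq (.whilePos (reg 4 - reg 5) cellProg)
    (block [(4, reg 4 + 1)]))))))

/-- The initial assignments of `layerProg`. -/
def layerInit : List (ℕ × Expr) :=
  [(2, reg 0 / reg 1), (3, 0), (4, 1), (5, 0), (6, 0), (7, 0), (8, 0), (9, 0), (50, 0)]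

/-- The computation of one layer, from `n` and `d` in registers `0` and `1`; the result is in
register `50`. -/
def layerProg : Prog :=
  .seq (block layerInit)
    (.seq (.whilePos (reg 2 + 1 - (reg 3 + 1) * (reg 3 + 1)) (block [(3, reg 3 + 1)]))
    (.whilePos (reg 3 + 1 - reg 4) rowProg))

end LayerProgram

/-- The values of the registers while the pair `(p, q)` is treated. -/
structure CellVars (n d p q : ℕ) (s : State) : Prop where
  r0 : s.reg 0 = n
  r1 : s.reg 1 = d
  r2 : s.reg 2 = (n / d : ℕ)
  r3 : s.reg 3 = Nat.sqrt (n / d)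
  r4 : s.reg 4 = p
  r5 : s.reg 5 = q
  r6 : s.reg 6 = (n / d / p : ℕ)
  r8 : s.reg 8 = (n / d % p : ℕ)

theorem CellVars.congr {n d p q : ℕ} {s s' : State} (h : CellVars n d p q s)
    (hs : ∀ i < 10, i ≠ 7 → s'.reg i = s.reg i) : CellVars n d p q s' where
  r0 := (hs 0 (by norm_num) (by norm_num)).trans h.r0
  r1 := (hs 1 (by norm_num) (by norm_num)).trans h.r1
  r2 := (hs 2 (by norm_num) (by norm_num)).trans h.r2
  r3 := (hs 3 (by norm_num) (by norm_num)).trans h.r3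
  r4 := (hs 4 (by norm_num) (by norm_num)).trans h.r4
  r5 := (hs 5 (by norm_num) (by norm_num)).trans h.r5
  r6 := (hs 6 (by norm_num) (by norm_num)).trans h.r6
  r8 := (hs 8 (by norm_num) (by norm_num)).trans h.r8

/-- The contribution of one pair. -/
def cellValue (n d p q : ℕ) : ℤ :=
  8 * Phi n d p q - 6 * Delta n d p q - 4 * PhiCap n d p q + 2 * DeltaCap n d p q

section Calls

variable {n d p q : ℕ} {s : State}

theorem exists_runs_phi (κ : ℤ) (hκ : κ.natAbs ≤ 8) : ∃ K : ℕ, ∀ {S W D n d p q : ℕ}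
    {s₀ s : State} {T : ℤ} {cnt : ℕ} (_ : 2 ≤ D) (_ : D ^ 610 ≤ W)
    (_ : LayerState D s₀ T cnt s) (_ : cnt + κ.natAbs ≤ 60 * D ^ 2) (_ : CellVars n d p q s)
    (_ : 0 < p), Runs S W (phiArgs.addTo κ) s (K * (Nat.size (p + q) + 1)) (fun s' =>
      (∀ i < 10, s'.reg i = s.reg i) ∧
        LayerState D s₀ (T + κ * Phi n d p q) (cnt + κ.natAbs) s') := by
  obtain ⟨K, hK⟩ := exists_runs_addTo phiArgs (by decide) κ hκ
  refine ⟨K, fun {S W D n d p q s₀ s T cnt} hD hW h hcnt hv hp => ?_⟩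
  have := hK (S := S) (N := n / d / p + 1) (m := p + q) (a := p) (b := n / d % p) hD hW h hcnt
    (by simp [phiArgs, termArgs, hv.r6]) (by simp [phiArgs, termArgs, hv.r4, hv.r5])
    hv.r4 hv.r8
  rwa [phiArgs, affProd_termArgs hv.r0 hv.r1 hv.r4 hv.r5
    (φ := fun x y => layerTerm n d p q ((n / d / p : ℕ) - x + y) y), ← Phi_eq_lineSum n d p q hp]
    at this
  intro x y
  simp only [Expr.eval_reg, Expr.eval_const, Expr.eval_ofNat, hv.r6]
  congr 1 <;> (push_cast; ring)

theorem exists_runs_delta (κ : ℤ) (hκ : κ.natAbs ≤ 8) : ∃ K : ℕ, ∀ {S W D n d p q : ℕ}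
    {s₀ s : State} {T : ℤ} {cnt t : ℕ} (_ : 2 ≤ D) (_ : D ^ 610 ≤ W)
    (_ : LayerState D s₀ T cnt s) (_ : cnt + κ.natAbs ≤ 60 * D ^ 2) (_ : CellVars n d p q s)
    (_ : s.reg 7 = t), Runs S W (deltaArgs.addTo κ) s (K * (Nat.size 1 + 1)) (fun s' =>
      (∀ i < 10, s'.reg i = s.reg i) ∧
        LayerState D s₀ (T + κ * DeltaOf n d p q t) (cnt + κ.natAbs) s') := by
  obtain ⟨K, hK⟩ := exists_runs_addTo deltaArgs (by decide) κ hκ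
  refine ⟨K, fun {S W D n d p q s₀ s T cnt t} hD hW h hcnt hv ht => ?_⟩
  have := hK (S := S) (N := t) (m := 1) (a := 0) (b := 1) hD hW h hcnt ht rfl rfl rfl
  rwa [deltaArgs, affProd_termArgs hv.r0 hv.r1 hv.r4 hv.r5
    (φ := fun x y => layerTerm n d p q (x + y) (x + y)), ← DeltaOf_eq_lineSum] at this
  intro x y
  simp only [Expr.eval_ofNat]
  congr 1 <;> (push_cast; ring)

theorem exists_runs_deltaCap (κ : ℤ) (hκ : κ.natAbs ≤ 8) : ∃ K : ℕ, ∀ {S W D n d p q : ℕ}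
    {s₀ s : State} {T : ℤ} {cnt : ℕ} (_ : 2 ≤ D) (_ : D ^ 610 ≤ W)
    (_ : LayerState D s₀ T cnt s) (_ : cnt + κ.natAbs ≤ 60 * D ^ 2) (_ : CellVars n d p q s),
    Runs S W (deltaCapArgs.addTo κ) s (K * (Nat.size 1 + 1)) (fun s' =>
      (∀ i < 10, s'.reg i = s.reg i) ∧
        LayerState D s₀ (T + κ * DeltaOf n d p q (Nat.sqrt (n / d))) (cnt + κ.natAbs) s') := by
  obtain ⟨K, hK⟩ := exists_runs_addTo deltaCapArgs (by decide) κ hκ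
  refine ⟨K, fun {S W D n d p q s₀ s T cnt} hD hW h hcnt hv => ?_⟩
  have := hK (S := S) (N := Nat.sqrt (n / d)) (m := 1) (a := 0) (b := 1) hD hW h hcnt hv.r3
    rfl rfl rfl
  rwa [deltaCapArgs, affProd_termArgs hv.r0 hv.r1 hv.r4 hv.r5
    (φ := fun x y => layerTerm n d p q (x + y) (x + y)), ← DeltaOf_eq_lineSum] at this
  intro x y
  simp only [Expr.eval_ofNat]
  congr 1 <;> (push_cast; ring)

theorem exists_runs_tail (κ : ℤ) (hκ : κ.natAbs ≤ 8) : ∃ K : ℕ, ∀ {S W D n d p q : ℕ}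
    {s₀ s : State} {T : ℤ} {cnt : ℕ} (_ : 2 ≤ D) (_ : D ^ 610 ≤ W)
    (_ : LayerState D s₀ T cnt s) (_ : cnt + κ.natAbs ≤ 60 * D ^ 2) (_ : CellVars n d p q s)
    (_ : 0 < p) (_ : 0 < q) (_ : p ≤ Nat.sqrt (n / d))
    (_ : n / d / (p + q) < Nat.sqrt (n / d)),
    Runs S W (tailArgs.addTo κ) s (K * (Nat.size q + 1)) (fun s' =>
      (∀ i < 10, s'.reg i = s.reg i) ∧
        LayerState D s₀ (T + κ * (Phi n d p q - PhiCap n d p q)) (cnt + κ.natAbs) s') := by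
  obtain ⟨K, hK⟩ := exists_runs_addTo tailArgs (by decide) κ hκ
  refine ⟨K, fun {S W D n d p q s₀ s T cnt} hD hW h hcnt hv hp hq hpB hlt => ?_⟩
  -- From p ≤ B follows Bp ≤ B² ≤ N. Thus the integer difference formed by the program equals the
  -- truncated one in the formula.
  have hBE : Nat.sqrt (n / d) ≤ n / d / p := by
    rw [Nat.le_div_iff_mul_le hp]
    exact (Nat.mul_le_mul_left _ hpB).trans (Nat.sqrt_le _)
  have := hK (S := S) (N := n / d / p - Nat.sqrt (n / d)) (m := q) (a := p) (b := n / d % p)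
    hD hW h hcnt
    (by rw [Nat.cast_sub hBE, ← hv.r6, ← hv.r3]; rfl) hv.r5 hv.r4 hv.r8
  rwa [tailArgs, affProd_termArgs hv.r0 hv.r1 hv.r4 hv.r5
    (φ := fun x y => layerTerm n d p q ((n / d / p : ℕ) - x) y),
    show lineSum (n / d / p - Nat.sqrt (n / d)) q p (n / d % p)
        (fun x y => layerTerm n d p q ((n / d / p : ℕ) - x) y) =
      Phi n d p q - PhiCap n d p q by
        rw [PhiCap_eq_lineSum_of_lt n d p q hp hq hlt]; ring] at this
  intro x y
  simp only [Expr.eval_reg, Expr.eval_const, Expr.eval_ofNat, hv.r6]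
  congr 1 <;> (push_cast; ring)

theorem exists_runs_triangle (κ : ℤ) (hκ : κ.natAbs ≤ 8) : ∃ K : ℕ, ∀ {S W D n d p q : ℕ}
    {s₀ s : State} {T : ℤ} {cnt : ℕ} (_ : 2 ≤ D) (_ : D ^ 610 ≤ W)
    (_ : LayerState D s₀ T cnt s) (_ : cnt + κ.natAbs ≤ 60 * D ^ 2) (_ : CellVars n d p q s)
    (_ : 0 < p) (_ : Nat.sqrt (n / d) ≤ n / d / (p + q)),
    Runs S W (triangleArgs.addTo κ) s (K * (Nat.size 1 + 1)) (fun s' =>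
      (∀ i < 10, s'.reg i = s.reg i) ∧
        LayerState D s₀ (T + κ * PhiCap n d p q) (cnt + κ.natAbs) s') := by
  obtain ⟨K, hK⟩ := exists_runs_addTo triangleArgs (by decide) κ hκ
  refine ⟨K, fun {S W D n d p q s₀ s T cnt} hD hW h hcnt hv hp hle => ?_⟩
  have := hK (S := S) (N := Nat.sqrt (n / d) + 1) (m := 1) (a := 1) (b := 0) hD hW h hcnt
    (by simp [triangleArgs, termArgs, hv.r3]) rfl rfl rfl
  rwa [triangleArgs, affProd_termArgs hv.r0 hv.r1 hv.r4 hv.r5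
    (φ := fun x y => layerTerm n d p q x y), ← PhiCap_eq_lineSum_of_le n d p q hp hle] at this
  intro x y
  simp only [Expr.eval_ofNat]
  congr 1 <;> (push_cast; ring)

theorem exists_runs_diag : ∃ K : ℕ, ∀ {S W D n d p : ℕ}
    {s₀ s : State} {T : ℤ} {cnt : ℕ} (_ : 2 ≤ D) (_ : D ^ 610 ≤ W)
    (_ : LayerState D s₀ T cnt s) (_ : cnt + 2 ≤ 60 * D ^ 2) (_ : CellVars n d p 0 s),
    Runs S W (diagArgs.addTo 2) s (K * (Nat.size 2 + 1)) (fun s' =>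
      (∀ i < 10, s'.reg i = s.reg i) ∧ LayerState D s₀ (T + diagSide n d p) (cnt + 2) s') := by
  obtain ⟨K, hK⟩ := exists_runs_addTo diagArgs (by decide) 2 (by norm_num)
  refine ⟨K, fun {S W D n d p s₀ s T cnt} hD hW h hcnt hv => ?_⟩
  have := hK (S := S) (N := n / d / p) (m := 2) (a := 1) (b := 0) hD hW h hcnt hv.r6 rfl rfl rfl
  rwa [diagArgs, affProd_termArgs hv.r0 hv.r1 hv.r4 hv.r5
    (φ := fun x _ => layerTerm n d p 0 (x + 1) (x + 1)), ← diagSide_eq_lineSum] at this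
  intro x y
  simp only [Expr.eval_ofNat]
  congr 1 <;> (push_cast; ring)

end Calls

end LatticeRect

/-! ### The loops over q and p inside a layer -/

namespace LatticeRect

/-- If ⌊N/(p+q)⌋ < B, then Δ∩ = Δ and Φ - Φ∩ lies below one line; otherwise Φ∩ is a full triangle
and Δ∩ extends to B. The weights |κ| add up to 12 and 20 in the two branches, hence the increment
20. No modulus exceeds p + q. -/
theorem exists_runs_cell : ∃ K : ℕ, ∀ {S W D n d p q σ : ℕ} {s₀ s : State} {T : ℤ} {cnt : ℕ}
    (_ : n + 2 ≤ D) (_ : D ^ 610 ≤ W) (_ : LayerState D s₀ T cnt s)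
    (_ : cnt + 20 ≤ 60 * D ^ 2) (_ : CellVars n d p q s) (_ : 0 < q) (_ : q < p)
    (_ : p ≤ Nat.sqrt (n / d)) (_ : Nat.size (p + q) ≤ σ),
    Runs S W cellProg s (K * (σ + 1)) (fun s' => CellVars n d p (q + 1) s' ∧
      LayerState D s₀ (T + cellValue n d p q) (cnt + 20) s') := by
  obtain ⟨K₁, h₁⟩ := exists_runs_phi 4 (by norm_num)
  obtain ⟨K₂, h₂⟩ := exists_runs_delta (-4) (by norm_num)
  obtain ⟨K₃, h₃⟩ := exists_runs_tail 4 (by norm_num)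
  obtain ⟨K₄, h₄⟩ := exists_runs_phi 8 (by norm_num)
  obtain ⟨K₅, h₅⟩ := exists_runs_delta (-6) (by norm_num)
  obtain ⟨K₆, h₆⟩ := exists_runs_triangle (-4) (by norm_num)
  obtain ⟨K₇, h₇⟩ := exists_runs_deltaCap 2 (by norm_num)
  obtain ⟨c₁, hc₁⟩ : ∃ c, c = blockCost [(7, Expr.reg 2 / (Expr.reg 4 + Expr.reg 5))] := ⟨_, rfl⟩
  obtain ⟨c₂, hc₂⟩ : ∃ c, c = blockCost [(5, Expr.reg 5 + 1)] := ⟨_, rfl⟩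
  refine ⟨K₁ + K₂ + K₃ + K₄ + K₅ + K₆ + K₇ + c₁ + c₂ + 4,
    fun {S W D n d p q σ s₀ s T cnt} hDn hW h hcnt hv hq hqp hpB hσ => ?_⟩
  have hD : 2 ≤ D := by omega
  have hN : n / d ≤ n := Nat.div_le_self _ _
  have hBN : Nat.sqrt (n / d) ≤ n / d := Nat.sqrt_le_self _
  have hp : 0 < p := by omega
  set t := n / d / (p + q) with ht
  have htn : t ≤ n := (Nat.div_le_self _ _).trans hN
  have h1σ : Nat.size 1 ≤ σ := (Nat.size_le_size (by omega : 1 ≤ p + q)).trans hσ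
  have hqσ : Nat.size q ≤ σ := (Nat.size_le_size (by omega : q ≤ p + q)).trans hσ
  have htime : ∀ {K m : ℕ}, Nat.size m ≤ σ → K * (Nat.size m + 1) ≤ K * (σ + 1) := fun hm =>
    Nat.mul_le_mul_left _ (by omega)
  have hev : (Expr.reg 2 / (Expr.reg 4 + Expr.reg 5)).eval s = t := by
    simp only [Expr.eval_div, Expr.eval_add, Expr.eval_reg, hv.r2, hv.r4, hv.r5, ht]
    push_cast
    rfl
  have hrun : Runs S W cellProg s
      (c₁ + ((4 + (K₁ + K₂ + K₃ + K₄ + K₅ + K₆ + K₇) * (σ + 1)) + c₂))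
      (fun s' => CellVars n d p (q + 1) s' ∧
        LayerState D s₀ (T + cellValue n d p q) (cnt + 20) s') := by
    rw [hc₁]
    refine (h.runs_set hD hW (k := 7) (by norm_num) (by decide) ?_ ?_).seq
      fun s₁ ⟨e7, efr, hs₁⟩ => ?_
    · simp only [Expr.safe_div, Expr.safe_reg, Expr.safe_add, Expr.eval_add, Expr.eval_reg, hv.r4,
        hv.r5, true_and, and_true]
      omega
    · rw [hev, Nat.abs_cast]
      exact_mod_cast (by omega : t ≤ D)
    rw [hev] at e7
    have hv₁ : CellVars n d p q s₁ := hv.congr fun i _ hi => efr i hi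
    refine Runs.seq (R := fun s' => CellVars n d p q s' ∧
      LayerState D s₀ (T + cellValue n d p q) (cnt + 20) s') (Runs.ifPos ?_ ?_ ?_) ?_
    · refine Expr.Safe.ok hD hs₁.degrees (by simp) ((Nat.pow_le_pow_right (by omega) ?_).trans hW)
      decide
    · intro hpos
      have hlt : t < Nat.sqrt (n / d) := by
        simp only [Expr.eval_sub, Expr.eval_reg, hv₁.r3, e7] at hpos
        omega
      refine Runs.weaken (T := K₁ * (Nat.size (p + q) + 1) +
        (K₂ * (Nat.size 1 + 1) + K₃ * (Nat.size q + 1))) (Q := fun s' => CellVars n d p q s' ∧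
        LayerState D s₀ (T + cellValue n d p q) (cnt + 20) s') ?_ ?_ fun _ hs => hs
      · refine (h₁ hD hW hs₁ (by simp; omega) hv₁ hp).seq fun s₂ ⟨f₂, hs₂⟩ => ?_
        have hv₂ := hv₁.congr fun i hi _ => f₂ i hi
        refine (h₂ hD hW hs₂ (by simp; omega) hv₂ ((f₂ 7 (by norm_num)).trans e7)).seq
          fun s₃ ⟨f₃, hs₃⟩ => ?_
        have hv₃ := hv₂.congr fun i hi _ => f₃ i hi
        refine (h₃ hD hW hs₃ (by simp; omega) hv₃ hp hq hpB hlt).weaken le_rfl ?_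
        rintro s' ⟨f₄, hs₄⟩
        refine ⟨hv₃.congr fun i hi _ => f₄ i hi, ?_⟩
        -- Regrouping: 8Φ - 4Φ∩ = 4Φ + 4(Φ - Φ∩), and -6Δ + 2Δ∩ = -4Δ.
        have hval : T + 4 * Phi n d p q + -4 * DeltaOf n d p q t +
            4 * (Phi n d p q - PhiCap n d p q) = T + cellValue n d p q := by
          rw [cellValue, Delta, DeltaCap, min_eq_right hlt.le]
          ring
        rw [hval] at hs₄
        exact hs₄.mono (by simp)
      · have a1 := htime (K := K₁) hσ
        have a2 := htime (K := K₂) h1σ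
        have a3 := htime (K := K₃) hqσ
        simp only [add_mul _ _ (σ + 1)]
        omega
    · intro hneg
      have hle : Nat.sqrt (n / d) ≤ t := by
        simp only [Expr.eval_sub, Expr.eval_reg, hv₁.r3, e7] at hneg
        omega
      refine Runs.weaken (T := K₄ * (Nat.size (p + q) + 1) + (K₅ * (Nat.size 1 + 1) +
        (K₆ * (Nat.size 1 + 1) + K₇ * (Nat.size 1 + 1)))) (Q := fun s' => CellVars n d p q s' ∧
        LayerState D s₀ (T + cellValue n d p q) (cnt + 20) s') ?_ ?_ fun _ hs => hs
      · refine (h₄ hD hW hs₁ (by simp; omega) hv₁ hp).seq fun s₂ ⟨f₂, hs₂⟩ => ?_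
        have hv₂ := hv₁.congr fun i hi _ => f₂ i hi
        refine (h₅ hD hW hs₂ (by simp; omega) hv₂ ((f₂ 7 (by norm_num)).trans e7)).seq
          fun s₃ ⟨f₃, hs₃⟩ => ?_
        have hv₃ := hv₂.congr fun i hi _ => f₃ i hi
        refine (h₆ hD hW hs₃ (by simp; omega) hv₃ hp hle).seq fun s₄ ⟨f₄, hs₄⟩ => ?_
        have hv₄ := hv₃.congr fun i hi _ => f₄ i hi
        refine (h₇ hD hW hs₄ (by simp; omega) hv₄).weaken le_rfl ?_
        rintro s' ⟨f₅, hs₅⟩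
        refine ⟨hv₄.congr fun i hi _ => f₅ i hi, ?_⟩
        have hval : T + 8 * Phi n d p q + -6 * DeltaOf n d p q t + -4 * PhiCap n d p q +
            2 * DeltaOf n d p q (Nat.sqrt (n / d)) = T + cellValue n d p q := by
          rw [cellValue, Delta, DeltaCap, min_eq_left hle]
          ring
        rw [hval] at hs₅
        exact hs₅.mono (by simp)
      · have a1 := htime (K := K₄) hσ
        have a2 := htime (K := K₅) h1σ
        have a3 := htime (K := K₆) h1σ
        have a4 := htime (K := K₇) h1σ
        simp only [add_mul _ _ (σ + 1)]
        omega
    · rintro s₂ ⟨hv₂, hs₂⟩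
      rw [hc₂]
      have hev2 : (Expr.reg 5 + 1).eval s₂ = ((q + 1 : ℕ) : ℤ) := by
        simp [hv₂.r5]
      refine (hs₂.runs_set hD hW (k := 5) (by norm_num) (by decide) (by simp) ?_).weaken le_rfl ?_
      · rw [hev2, Nat.abs_cast]
        exact_mod_cast (by omega : q + 1 ≤ D)
      · rintro s₃ ⟨e5, efr', hs₃⟩
        rw [hev2] at e5
        exact ⟨⟨(efr' 0 (by norm_num)).trans hv₂.r0, (efr' 1 (by norm_num)).trans hv₂.r1,
          (efr' 2 (by norm_num)).trans hv₂.r2, (efr' 3 (by norm_num)).trans hv₂.r3,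
          (efr' 4 (by norm_num)).trans hv₂.r4, e5, (efr' 6 (by norm_num)).trans hv₂.r6,
          (efr' 8 (by norm_num)).trans hv₂.r8⟩, hs₃⟩
  refine hrun.weaken ?_ fun _ hs => hs
  have a1 : c₁ + c₂ + 4 ≤ (c₁ + c₂ + 4) * (σ + 1) := Nat.le_mul_of_pos_right _ (by omega)
  simp only [add_mul _ _ (σ + 1)] at a1 ⊢
  omega

/-- The values of the registers between two rows. -/
structure RowVars (n d B p : ℕ) (s : State) : Prop where
  r0 : s.reg 0 = n
  r1 : s.reg 1 = d
  r2 : s.reg 2 = (n / d : ℕ)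
  r3 : s.reg 3 = B
  r4 : s.reg 4 = p

/-- The contribution of one value of `p`. -/
def rowValue (n d p : ℕ) : ℤ := diagSide n d p + ∑ q ∈ Finset.Ico 1 p, cellValue n d p q

theorem exists_runs_row : ∃ K : ℕ, ∀ {S W D n d p σ : ℕ} {s₀ s : State} {T : ℤ} {cnt : ℕ}
    (_ : n + 2 ≤ D) (_ : D ^ 610 ≤ W) (_ : LayerState D s₀ T cnt s)
    (_ : cnt + 20 * p ≤ 60 * D ^ 2) (_ : RowVars n d (Nat.sqrt (n / d)) p s) (_ : 0 < p)
    (_ : p ≤ Nat.sqrt (n / d)) (_ : Nat.size (2 * p) ≤ σ),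
    Runs S W rowProg s (K * (p * (σ + 1))) (fun s' =>
      RowVars n d (Nat.sqrt (n / d)) (p + 1) s' ∧
      LayerState D s₀ (T + rowValue n d p) (cnt + 20 * p) s') := by
  obtain ⟨K₁, h₁⟩ := exists_runs_diag
  obtain ⟨K₂, h₂⟩ := exists_runs_cell
  obtain ⟨c₁, hc₁⟩ : ∃ c, c = blockCost [(5, (0 : Expr))] := ⟨_, rfl⟩
  obtain ⟨c₂, hc₂⟩ : ∃ c, c = blockCost [(6, Expr.reg 2 / Expr.reg 4)] := ⟨_, rfl⟩
  obtain ⟨c₃, hc₃⟩ : ∃ c, c = blockCost [(8, Expr.reg 2 - Expr.reg 4 * Expr.reg 6)] := ⟨_, rfl⟩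
  obtain ⟨c₄, hc₄⟩ : ∃ c, c = blockCost [(5, (1 : Expr))] := ⟨_, rfl⟩
  obtain ⟨c₅, hc₅⟩ : ∃ c, c = blockCost [(4, Expr.reg 4 + 1)] := ⟨_, rfl⟩
  refine ⟨3 * K₁ + K₂ + c₁ + c₂ + c₃ + c₄ + c₅ + 8,
    fun {S W D n d p σ s₀ s T cnt} hDn hW h hcnt hv hp hpB hσ => ?_⟩
  have hD : 2 ≤ D := by omega
  have hN : n / d ≤ n := Nat.div_le_self _ _
  have hBN : Nat.sqrt (n / d) ≤ n / d := Nat.sqrt_le_self _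
  set E := n / d / p with hE
  set r := n / d % p with hr
  have hEn : E ≤ n := (Nat.div_le_self _ _).trans hN
  have hrn : r ≤ n := (Nat.mod_le _ _).trans hN
  have habs : ∀ {k : ℕ}, k ≤ n + 2 → |(k : ℤ)| ≤ D := fun hk => by
    rw [Nat.abs_cast]
    exact_mod_cast hk.trans hDn
  have hrun : Runs S W rowProg s
      (c₁ + (c₂ + (c₃ + (K₁ * 3 + (c₄ + (((p - 1) * (4 + K₂ * (σ + 1)) + 4) + c₅))))))
      (fun s' => RowVars n d (Nat.sqrt (n / d)) (p + 1) s' ∧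
        LayerState D s₀ (T + rowValue n d p) (cnt + 20 * p) s') := by
    rw [hc₁]
    -- Register 5 is 0 during the diagonal call, whose summand is the one with q = 0. It is then
    -- reset to 1, the first value of q.
    refine (h.runs_set hD hW (k := 5) (by norm_num) (by decide) (by simp) (by simp)).seq
      fun s₁ ⟨e1, f1, hs₁⟩ => ?_
    rw [hc₂]
    have ev1 : (Expr.reg 2 / Expr.reg 4).eval s₁ = (E : ℤ) := by
      rw [Expr.eval_div, Expr.eval_reg, Expr.eval_reg, f1 2 (by norm_num), f1 4 (by norm_num),
        hv.r2, hv.r4, hE]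
      rfl
    refine (hs₁.runs_set hD hW (k := 6) (by norm_num) (by decide) ?_ ?_).seq
      fun s₂ ⟨e2, f2, hs₂⟩ => ?_
    · simp only [Expr.safe_div, Expr.safe_reg, Expr.eval_reg, f1 4 (by norm_num), hv.r4, true_and]
      exact_mod_cast hp
    · rw [ev1]; exact habs (by omega)
    rw [ev1] at e2
    rw [hc₃]
    have ev2 : (Expr.reg 2 - Expr.reg 4 * Expr.reg 6).eval s₂ = (r : ℤ) := by
      have : ((p * E + r : ℕ) : ℤ) = (n / d : ℕ) := by rw [hE, hr, Nat.div_add_mod]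
      rw [Expr.eval_sub, Expr.eval_mul, Expr.eval_reg, Expr.eval_reg, Expr.eval_reg, e2,
        f2 2 (by norm_num), f2 4 (by norm_num), f1 2 (by norm_num), f1 4 (by norm_num), hv.r2,
        hv.r4, ← this]
      push_cast
      ring
    refine (hs₂.runs_set hD hW (k := 8) (by norm_num) (by decide) (by simp) ?_).seq
      fun s₃ ⟨e3, f3, hs₃⟩ => ?_
    · rw [ev2]; exact habs (by omega)
    rw [ev2] at e3
    have g3 : ∀ i, i ≠ 5 → i ≠ 6 → i ≠ 8 → s₃.reg i = s.reg i := fun i h5 h6 h8 => by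
      rw [f3 i h8, f2 i h6, f1 i h5]
    have hv₃ : CellVars n d p 0 s₃ :=
      ⟨(g3 0 (by norm_num) (by norm_num) (by norm_num)).trans hv.r0,
        (g3 1 (by norm_num) (by norm_num) (by norm_num)).trans hv.r1,
        (g3 2 (by norm_num) (by norm_num) (by norm_num)).trans hv.r2,
        (g3 3 (by norm_num) (by norm_num) (by norm_num)).trans hv.r3,
        (g3 4 (by norm_num) (by norm_num) (by norm_num)).trans hv.r4,
        by rw [f3 5 (by norm_num), f2 5 (by norm_num), e1]; rfl,
        by rw [f3 6 (by norm_num), e2], e3⟩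
    refine ((h₁ hD hW hs₃ (by omega) hv₃).weaken (T' := K₁ * 3) ?_ fun _ hs => hs).seq
      fun s₄ ⟨f4, hs₄⟩ => ?_
    · exact Nat.mul_le_mul_left _ (by decide)
    have hv₄ : CellVars n d p 0 s₄ := hv₃.congr fun i hi _ => f4 i hi
    rw [hc₄]
    refine (hs₄.runs_set hD hW (k := 5) (by norm_num) (by decide) (by simp) ?_).seq
      fun s₅ ⟨e5, f5, hs₅⟩ => ?_
    · exact habs (k := 1) (by omega)
    have hv₅ : CellVars n d p 1 s₅ :=
      ⟨(f5 0 (by norm_num)).trans hv₄.r0, (f5 1 (by norm_num)).trans hv₄.r1,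
        (f5 2 (by norm_num)).trans hv₄.r2, (f5 3 (by norm_num)).trans hv₄.r3,
        (f5 4 (by norm_num)).trans hv₄.r4, e5, (f5 6 (by norm_num)).trans hv₄.r6,
        (f5 8 (by norm_num)).trans hv₄.r8⟩
    set I : ℕ → State → Prop := fun j s' => CellVars n d p (j + 1) s' ∧
      LayerState D s₀ (T + diagSide n d p + ∑ q ∈ Finset.Ico 1 (j + 1), cellValue n d p q)
        (cnt + 20 + 20 * j) s' with hI
    have hok : ∀ {T' : ℤ} {c : ℕ} {s' : State}, LayerState D s₀ T' c s' →
        (Expr.reg 4 - Expr.reg 5).Ok S W s' := fun hs => by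
      refine Expr.Safe.ok hD hs.degrees (by simp) ((Nat.pow_le_pow_right (by omega) ?_).trans hW)
      decide
    have hloop := Runs.whileCount (S := S) (W := W) (e := Expr.reg 4 - Expr.reg 5) (P := cellProg)
      (c := fun _ => K₂ * (σ + 1)) (I := I) (n := p - 1) (s := s₅) ?_ ?_ ?_
    · refine (hloop.weaken (T' := (p - 1) * (4 + K₂ * (σ + 1)) + 4) ?_ fun _ hs => hs).seq
        fun s₆ ⟨hv₆, hs₆⟩ => ?_
      · rw [Finset.sum_const, Finset.card_range, smul_eq_mul]
        exact le_rfl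
      · rw [hc₅]
        have ev6 : (Expr.reg 4 + 1).eval s₆ = ((p + 1 : ℕ) : ℤ) := by simp [hv₆.r4]
        refine (hs₆.runs_set hD hW (k := 4) (by norm_num) (by decide) (by simp) ?_).weaken
          le_rfl ?_
        · rw [ev6]; exact habs (by omega)
        · rintro s₇ ⟨e7, f7, hs₇⟩
          rw [ev6] at e7
          refine ⟨⟨(f7 0 (by norm_num)).trans hv₆.r0, (f7 1 (by norm_num)).trans hv₆.r1,
            (f7 2 (by norm_num)).trans hv₆.r2, (f7 3 (by norm_num)).trans hv₆.r3, e7⟩, ?_⟩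
          rw [Nat.sub_add_cancel hp, add_assoc] at hs₇
          exact hs₇.mono (by omega)
    · rintro s' ⟨hv', hs'⟩
      refine ⟨hok hs', ?_⟩
      rw [Expr.eval_sub, Expr.eval_reg, Expr.eval_reg, hv'.r4, hv'.r5]
      omega
    · rintro j hj s' ⟨hv', hs'⟩
      refine ⟨hok hs', ?_, ?_⟩
      · rw [Expr.eval_sub, Expr.eval_reg, Expr.eval_reg, hv'.r4, hv'.r5]
        omega
      · refine (h₂ hDn hW hs' (by omega) hv' (by omega) (by omega) hpB
          ((Nat.size_le_size (by omega)).trans hσ)).weaken le_rfl ?_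
        rintro s'' ⟨hv'', hs''⟩
        refine ⟨hv'', ?_⟩
        rw [Finset.sum_Ico_succ_top (by omega), ← add_assoc]
        exact hs''.mono (by omega)
    · refine ⟨hv₅, ?_⟩
      simp only [zero_add, Finset.Ico_self, Finset.sum_empty, add_zero]
      exact hs₅.mono (by omega)
  refine hrun.weaken ?_ fun _ hs => hs
  obtain ⟨p', rfl⟩ : ∃ p', p = p' + 1 := ⟨p - 1, by omega⟩
  rw [Nat.add_sub_cancel]
  obtain ⟨c, hc⟩ : ∃ c, c = c₁ + c₂ + c₃ + c₄ + c₅ + 3 * K₁ := ⟨_, rfl⟩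
  have e1 : c ≤ c * ((p' + 1) * (σ + 1)) := Nat.le_mul_of_pos_right _ (by positivity)
  have e2 : p' * (4 + K₂ * (σ + 1)) + 4 ≤ (K₂ + 8) * ((p' + 1) * (σ + 1)) := by
    nlinarith [Nat.zero_le (p' * σ), Nat.zero_le (K₂ * (σ + 1))]
  calc _ = c + (p' * (4 + K₂ * (σ + 1)) + 4) := by rw [hc]; ring
    _ ≤ c * ((p' + 1) * (σ + 1)) + (K₂ + 8) * ((p' + 1) * (σ + 1)) := by omega
    _ = _ := by rw [hc]; ring

theorem layer_eq_sum_rowValue (n d : ℕ) :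
    layer d n = ∑ p ∈ Finset.Icc 1 (Nat.sqrt (n / d)), rowValue n d p := by
  rw [layer_formula]
  simp only [rowValue, cellValue, Finset.sum_add_distrib]
  ring

end LatticeRect

/-! ### Correctness and running time for a whole layer -/

namespace LatticeRect

theorem runs_layerInit {S W D n d : ℕ} (hDn : n + 2 ≤ D) (hW : D ^ 610 ≤ W) (hd : 1 ≤ d)
    (hdn : d ≤ n) {s : State} (h0 : s.reg 0 = n) (h1 : s.reg 1 = d)
    (hall : ∀ i, |s.reg i| ≤ (D : ℤ) ^ 600) :
    Runs S W (block layerInit) s (blockCost layerInit)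
      (fun s' => RowVars n d 0 1 s' ∧ LayerState D s 0 0 s') := by
  have hD : 2 ≤ D := by omega
  have hN : n / d ≤ n := Nat.div_le_self _ _
  have hsafe : BlockSafe layerInit s := by
    simp only [layerInit, BlockSafe, Expr.safe_div, Expr.safe_reg, Expr.safe_ofNat, Expr.eval_reg,
      h1, true_and, and_true]
    exact_mod_cast hd
  have hdeg : blockDegree layerInit (fun _ => 600) ≤ 600 := by decide
  refine (runs_block hD layerInit (β := fun _ => 600) hall hsafe
    ((Nat.pow_le_pow_right (by omega) (hdeg.trans (by norm_num))).trans hW)).weaken le_rfl ?_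
  rintro _ ⟨rfl, hb⟩
  have e2 : (evalBlock layerInit s).reg 2 = (n / d : ℕ) := by
    have : (evalBlock layerInit s).reg 2 = s.reg 0 / s.reg 1 := rfl
    rw [this, h0, h1]
    rfl
  have hidx : ∀ x ∈ layerInit.map Prod.fst, x ≤ 50 := by decide
  refine ⟨⟨h0, h1, e2, rfl, rfl⟩, fun i hi => ?_, rfl, by simp, evalBlock_mem _ _, fun i hi => ?_,
    fun i => (hb i).trans (pow_le_pow_right₀ (by exact_mod_cast (by omega : 1 ≤ D)) ?_)⟩
  · have hz : |(0 : ℤ)| ≤ D := by simp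
    interval_cases i
    · rw [show (evalBlock layerInit s).reg 0 = s.reg 0 from rfl, h0, Nat.abs_cast]
      exact_mod_cast (by omega : n ≤ D)
    · rw [show (evalBlock layerInit s).reg 1 = s.reg 1 from rfl, h1, Nat.abs_cast]
      exact_mod_cast (by omega : d ≤ D)
    · rw [e2, Nat.abs_cast]
      exact_mod_cast (by omega : n / d ≤ D)
    · exact hz
    · change |(1 : ℤ)| ≤ D
      rw [abs_one]
      exact_mod_cast (by omega : 1 ≤ D)
    all_goals exact hz
  · exact evalBlock_reg_of_notMem fun x hx => by
      have := hidx x.1 (List.mem_map_of_mem hx)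
      omega
  · exact (blockDegrees_le _ _ _).trans (max_le le_rfl hdeg)

/-- The root is found by counting up while (i+1)² ≤ N. These B rounds are negligible against the B²
available. -/
theorem runs_sqrtLoop {S W D n d : ℕ} (hDn : n + 2 ≤ D) (hW : D ^ 610 ≤ W) {s₀ s : State}
    (hv : RowVars n d 0 1 s) (hs : LayerState D s₀ 0 0 s) :
    Runs S W (.whilePos (.reg 2 + 1 - (.reg 3 + 1) * (.reg 3 + 1)) (block [(3, .reg 3 + 1)])) s
      (Nat.sqrt (n / d) * 20 + 12)
      (fun s' => RowVars n d (Nat.sqrt (n / d)) 1 s' ∧ LayerState D s₀ 0 0 s') := by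
  have hD : 2 ≤ D := by omega
  have hN : n / d ≤ n := Nat.div_le_self _ _
  have hBN : Nat.sqrt (n / d) ≤ n / d := Nat.sqrt_le_self _
  have hok : ∀ {s' : State}, LayerState D s₀ 0 0 s' →
      (Expr.reg 2 + 1 - (.reg 3 + 1) * (.reg 3 + 1)).Ok S W s' := fun hs => by
    refine Expr.Safe.ok hD hs.degrees (by simp) ((Nat.pow_le_pow_right (by omega) ?_).trans hW)
    decide
  have heval : ∀ {i : ℕ} {s' : State}, RowVars n d i 1 s' →
      (Expr.reg 2 + 1 - (.reg 3 + 1) * (.reg 3 + 1)).eval s' =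
        ((n / d : ℕ) : ℤ) + 1 - ((i + 1) * (i + 1) : ℕ) := fun hv => by
    simp only [Expr.eval_sub, Expr.eval_add, Expr.eval_mul, Expr.eval_reg, Expr.eval_ofNat, hv.r2,
      hv.r3]
    push_cast
    rfl
  have hloop := Runs.whileCount (S := S) (W := W)
    (e := .reg 2 + 1 - (.reg 3 + 1) * (.reg 3 + 1)) (P := block [(3, .reg 3 + 1)])
    (c := fun _ => blockCost [(3, .reg 3 + 1)])
    (I := fun i s' => RowVars n d i 1 s' ∧ LayerState D s₀ 0 0 s') (n := Nat.sqrt (n / d))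
    (s := s) ?_ ?_ ⟨hv, hs⟩
  · refine hloop.weaken ?_ fun _ hs => hs
    rw [Finset.sum_const, Finset.card_range, smul_eq_mul]
    exact Nat.add_le_add (Nat.mul_le_mul_left _ (by decide)) (by decide)
  · rintro s' ⟨hv', hs'⟩
    refine ⟨hok hs', ?_⟩
    rw [heval hv']
    have := Nat.lt_succ_sqrt (n / d)
    simp only [Nat.succ_eq_add_one] at this
    omega
  · rintro i hi s' ⟨hv', hs'⟩
    refine ⟨hok hs', ?_, ?_⟩
    · rw [heval hv']
      have : (i + 1) * (i + 1) ≤ n / d := Nat.le_sqrt.1 hi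
      omega
    · have ev : (Expr.reg 3 + 1).eval s' = ((i + 1 : ℕ) : ℤ) := by simp [hv'.r3]
      refine (hs'.runs_set hD hW (k := 3) (by norm_num) (by decide) (by simp) ?_).weaken le_rfl ?_
      · rw [ev, Nat.abs_cast]
        exact_mod_cast (by omega : i + 1 ≤ D)
      · rintro s'' ⟨e, f, hs''⟩
        rw [ev] at e
        exact ⟨⟨(f 0 (by norm_num)).trans hv'.r0, (f 1 (by norm_num)).trans hv'.r1,
          (f 2 (by norm_num)).trans hv'.r2, e, (f 4 (by norm_num)).trans hv'.r4⟩, hs''⟩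

/-- There are B rows, each of cost O(B(σ+1)) where σ is the binary size of 2N, and B² ≤ N. -/
theorem exists_runs_layer : ∃ K : ℕ, ∀ {S W D n d : ℕ} {s : State} (_ : n + 2 ≤ D)
    (_ : D ^ 610 ≤ W) (_ : 1 ≤ d) (_ : d ≤ n) (_ : s.reg 0 = n) (_ : s.reg 1 = d)
    (_ : ∀ i, |s.reg i| ≤ (D : ℤ) ^ 600),
    Runs S W layerProg s (K * ((n / d) * (Nat.size (2 * (n / d)) + 1))) (fun s' =>
      s'.reg 0 = n ∧ s'.reg 1 = d ∧ s'.reg 50 = layer d n ∧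
      |s'.reg 50| ≤ (D : ℤ) ^ 500 ∧ s'.mem = s.mem ∧ (∀ i, 51 ≤ i → s'.reg i = s.reg i) ∧
      ∀ i, |s'.reg i| ≤ (D : ℤ) ^ 600) := by
  obtain ⟨K, hK⟩ := exists_runs_row
  obtain ⟨c, hc⟩ : ∃ c, c = blockCost layerInit := ⟨_, rfl⟩
  refine ⟨K + c + 48, fun {S W D n d s} hDn hW hd hdn h0 h1 hall => ?_⟩
  have hD : 2 ≤ D := by omega
  have hN : n / d ≤ n := Nat.div_le_self _ _
  have hN1 : 1 ≤ n / d := (Nat.one_le_div_iff (by omega)).2 hdn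
  set N := n / d with hNdef
  set B := Nat.sqrt N with hB
  set σ := Nat.size (2 * N) with hσ
  have hBN : B ≤ N := Nat.sqrt_le_self _
  have hBB : B * B ≤ N := Nat.sqrt_le _
  have hrun : Runs S W layerProg s (c + ((B * 20 + 12) + (B * (6 + K * (B * (σ + 1))) + 6)))
      (fun s' => RowVars n d B (B + 1) s' ∧
        LayerState D s (∑ p ∈ Finset.Icc 1 B, rowValue n d p) (20 * D * B) s') := by
    rw [hc]
    refine (runs_layerInit hDn hW hd hdn h0 h1 hall).seq fun s₁ ⟨hv₁, hs₁⟩ =>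
      (runs_sqrtLoop hDn hW hv₁ hs₁).seq fun s₂ ⟨hv₂, hs₂⟩ => ?_
    have hok : ∀ {T : ℤ} {c : ℕ} {s' : State}, LayerState D s T c s' →
        (Expr.reg 3 + 1 - .reg 4).Ok S W s' := fun hs => by
      refine Expr.Safe.ok hD hs.degrees (by simp) ((Nat.pow_le_pow_right (by omega) ?_).trans hW)
      decide
    have heval : ∀ {i : ℕ} {s' : State}, RowVars n d B i s' →
        (Expr.reg 3 + 1 - .reg 4).eval s' = (B : ℤ) + 1 - i := fun hv => by
      simp only [Expr.eval_sub, Expr.eval_add, Expr.eval_reg, Expr.eval_ofNat, hv.r3, hv.r4]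
      push_cast
      rfl
    have hloop := Runs.whileCount (S := S) (W := W) (e := .reg 3 + 1 - .reg 4) (P := rowProg)
      (c := fun _ => K * (B * (σ + 1)))
      (I := fun i s' => RowVars n d B (i + 1) s' ∧
        LayerState D s (∑ p ∈ Finset.Icc 1 i, rowValue n d p) (20 * D * i) s') (n := B)
      (s := s₂) ?_ ?_ ⟨hv₂, by simpa using hs₂⟩
    · refine hloop.weaken ?_ fun _ hs => hs
      rw [Finset.sum_const, Finset.card_range, smul_eq_mul]
      exact le_rfl
    · rintro s' ⟨hv', hs'⟩
      refine ⟨hok hs', ?_⟩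
      rw [heval hv']
      push_cast
      omega
    · rintro i hi s' ⟨hv', hs'⟩
      refine ⟨hok hs', ?_, ?_⟩
      · rw [heval hv']
        push_cast
        omega
      · have hcnt : 20 * D * i + 20 * (i + 1) ≤ 20 * D * (i + 1) := by nlinarith
        have hcnt2 : 20 * D * (i + 1) ≤ 60 * D ^ 2 := by nlinarith
        refine (hK hDn hW hs' (hcnt.trans hcnt2) hv' (by omega) hi
          (Nat.size_le_size (Nat.mul_le_mul_left 2 (hBN.trans' hi)))).weaken ?_ ?_
        · exact Nat.mul_le_mul_left _ (Nat.mul_le_mul_right _ hi)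
        · rintro s'' ⟨hv'', hs''⟩
          refine ⟨hv'', ?_⟩
          rw [Finset.sum_Icc_succ_top (by omega)]
          exact hs''.mono hcnt
  refine hrun.weaken ?_ ?_
  · have hB1 : B ≤ B * B := by nlinarith
    have a0 : N ≤ N * (σ + 1) := Nat.le_mul_of_pos_right _ (by omega)
    have a1 : B * B * (σ + 1) ≤ N * (σ + 1) := Nat.mul_le_mul_right _ hBB
    have a2 : K * (B * B * (σ + 1)) ≤ K * (N * (σ + 1)) := Nat.mul_le_mul_left _ a1
    have a3 : B * (K * (B * (σ + 1))) = K * (B * B * (σ + 1)) := by ring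
    have a4 : c ≤ c * (N * (σ + 1)) := Nat.le_mul_of_pos_right _ (by omega)
    have a5 : B * (6 + K * (B * (σ + 1))) = 6 * B + B * (K * (B * (σ + 1))) := by ring
    rw [a5, a3, add_mul, add_mul]
    omega
  · rintro s' ⟨hv', hs'⟩
    have hval : s'.reg 50 = layer d n := by rw [hs'.total, layer_eq_sum_rowValue]
    refine ⟨hv'.r0, hv'.r1, hval, ?_, hs'.mem_eq, hs'.frame, hs'.all⟩
    rw [hs'.total]
    refine hs'.total_le.trans ?_
    have h1 : 20 * D * B ≤ D ^ 7 := by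
      calc 20 * D * B ≤ 2 ^ 5 * D * D := by gcongr <;> omega
        _ ≤ D ^ 5 * D * D := by gcongr
        _ = D ^ 7 := by ring
    have h2 : 20 * D * B * D ^ 438 ≤ D ^ 500 := by
      calc 20 * D * B * D ^ 438 ≤ D ^ 7 * D ^ 438 := by gcongr
        _ = D ^ 445 := (pow_add D 7 438).symm
        _ ≤ D ^ 500 := Nat.pow_le_pow_right (by omega) (by norm_num)
    exact_mod_cast h2

theorem natSize_two_mul_le {N : ℕ} (hN : 1 ≤ N) :
    (Nat.size (2 * N) : ℝ) + 1 ≤ 8 * Real.log (N + 1) := by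
  obtain ⟨h1, h2⟩ := natSize_le_log hN
  have h3 : Nat.size (2 * N) ≤ Nat.size N + 1 := by
    rw [Nat.size_le, pow_succ]
    have := Nat.lt_size_self N
    omega
  have h4 : (Nat.size (2 * N) : ℝ) ≤ Nat.size N + 1 := by exact_mod_cast h3
  linarith

theorem abs_initState_le {D : ℕ} {l : List ℤ} (h : ∀ x ∈ l, |x| ≤ (D : ℤ)) (i : ℕ) :
    |(initState l).reg i| ≤ (D : ℤ) := by
  simp only [initState, List.getD_eq_getElem?_getD]
  rcases hi : l[i]? with _ | x
  · simp
  · simpa using h x (List.mem_of_getElem? hi)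

theorem layer_program :
    ∃ (P : Prog) (C : ℝ) (k : ℕ), ∀ n d : ℕ, 1 ≤ d → d ≤ n → ∃ t S : ℕ,
      Outputs P [(n : ℤ), (d : ℤ)] [layer d n] t S ((n + 2) ^ k) ∧
      (t : ℝ) ≤ C * ((n / d : ℕ) * Real.log ((n / d : ℕ) + 1)) ∧ (S : ℝ) ≤ C * (n / d : ℕ) := by
  obtain ⟨K, hK⟩ := exists_runs_layer
  -- The 8 comes from `natSize_two_mul_le`; the 2 in K + 2 absorbs the final assignment.
  refine ⟨.seq layerProg (.assign 0 (.reg 50)), 8 * (K + 2), 610, fun n d hd hdn => ?_⟩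
  set s := initState [(n : ℤ), (d : ℤ)] with hs
  have hN1 : 1 ≤ n / d := (Nat.one_le_div_iff (by omega)).2 hdn
  have hn1 : (1 : ℤ) ≤ (n + 2 : ℕ) := by exact_mod_cast (by omega : 1 ≤ n + 2)
  have hall : ∀ i, |s.reg i| ≤ ((n + 2 : ℕ) : ℤ) ^ 600 := fun i =>
    (abs_initState_le (fun x hx => by
      simp only [List.mem_cons, List.not_mem_nil, or_false] at hx
      rcases hx with rfl | rfl
      · rw [Nat.abs_cast]; exact_mod_cast (by omega : n ≤ n + 2)
      · rw [Nat.abs_cast]; exact_mod_cast (by omega : d ≤ n + 2)) i).trans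
      (le_self_pow₀ hn1 (by norm_num))
  have hrun := (hK (S := 0) (W := (n + 2) ^ 610) le_rfl le_rfl hd hdn rfl rfl hall).seq
    (P' := .assign 0 (.reg 50)) (T' := 2) (Q := fun s' => s'.reg 0 = layer d n)
    fun s₁ ⟨_, _, h3, _, _, _, h7⟩ => Runs.assign ?_ h3
  · obtain ⟨t, s', ht, hx, h0⟩ := hrun
    refine ⟨t, 0, ⟨s', hx, fun i hi => ?_⟩, ?_, ?_⟩
    · have : i = 0 := by simpa using hi
      subst this
      exact h0
    · have hl := natSize_two_mul_le hN1
      have hN' : (1 : ℝ) ≤ (n / d : ℕ) := by exact_mod_cast hN1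
      have ht' : (t : ℝ) ≤ K * ((n / d : ℕ) * (Nat.size (2 * (n / d)) + 1)) + 2 := by
        exact_mod_cast ht
      have h1 : ((n / d : ℕ) : ℝ) * (Nat.size (2 * (n / d)) + 1) ≤
          (n / d : ℕ) * (8 * Real.log ((n / d : ℕ) + 1)) := by gcongr
      have h2 : (1 : ℝ) ≤ (n / d : ℕ) * (Nat.size (2 * (n / d)) + 1) := by
        have : (0 : ℝ) ≤ Nat.size (2 * (n / d)) := by positivity
        nlinarith
      have h3 := mul_le_mul_of_nonneg_left h1 (by positivity : (0 : ℝ) ≤ K)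
      nlinarith
    · rw [Nat.cast_zero]
      positivity
  · exact (h7 50).trans (by
      exact_mod_cast Nat.pow_le_pow_right (by omega : 0 < n + 2) (by norm_num : 600 ≤ 610))

end LatticeRect

namespace LatticeRect

/-! ### Möbius inversion -/

theorem sum_divisors_moebius (m : ℕ) :
    ∑ d ∈ m.divisors, ArithmeticFunction.moebius d = if m = 1 then 1 else 0 := by
  rw [← ArithmeticFunction.coe_zeta_mul_apply, ArithmeticFunction.coe_zeta_mul_moebius,
    ArithmeticFunction.one_apply]

/-- The summand of `F₁`, as a function of `(u, v, x, y)`. -/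
def primTerm (n : ℕ) (z : ℕ × ℕ × ℕ × ℕ) : ℤ :=
  mult z.2.2.1 z.2.2.2 *
    (((n : ℤ) - z.2.2.1 * z.1 - z.2.2.2 * z.2.1) * ((n : ℤ) - z.2.2.1 * z.2.1 - z.2.2.2 * z.1))

/-- The index set of `F₁` without the coprimality condition. -/
def fullIndex (n : ℕ) : Finset (ℕ × ℕ × ℕ × ℕ) :=
  (Finset.Icc 1 n ×ˢ Finset.Icc 1 n ×ˢ Finset.Icc 1 n ×ˢ Finset.Icc 1 n).filter
    (fun z => z.2.1 < z.1 ∧ z.2.2.2 ≤ z.2.2.1 ∧ z.2.2.1 * z.1 + z.2.2.2 * z.2.1 ≤ n)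

/-- The directions divisible by d are the d(a,b), and x·da + y·db ≤ n means ax + by ≤ ⌊n/d⌋. -/
theorem layer_eq_sum_fullIndex {n d : ℕ} (hd : 1 ≤ d) :
    layer d n = ∑ z ∈ (fullIndex n).filter (fun z => d ∣ z.1 ∧ d ∣ z.2.1), primTerm n z := by
  have hd0 : 0 < d := hd
  refine Finset.sum_nbij' (fun z => (d * z.1, d * z.2.1, z.2.2.1, z.2.2.2))
    (fun z => (z.1 / d, z.2.1 / d, z.2.2.1, z.2.2.2)) ?_ ?_ ?_ ?_ ?_
  · rintro ⟨a, b, x, y⟩ h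
    simp only [region, fullIndex, Finset.mem_filter, Finset.mem_product, Finset.mem_Icc,
      Nat.le_div_iff_mul_le hd0] at h ⊢
    obtain ⟨⟨⟨ha, ha'⟩, ⟨hb, hb'⟩, ⟨hx, hx'⟩, hy, hy'⟩, h1, h2, h3⟩ := h
    have e : x * (d * a) + y * (d * b) = (a * x + b * y) * d := by ring
    have p1 : 0 < d * a := by positivity
    have p2 : 0 < d * b := by positivity
    have q1 : x ≤ x * d := Nat.le_mul_of_pos_right _ hd0
    have q2 : y ≤ y * d := Nat.le_mul_of_pos_right _ hd0
    refine ⟨⟨⟨⟨p1, by linarith⟩, ⟨p2, by linarith⟩, ⟨hx, by omega⟩, hy, by omega⟩, ?_, h2, ?_⟩,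
      dvd_mul_right _ _, dvd_mul_right _ _⟩
    · exact Nat.mul_lt_mul_of_pos_left h1 hd0
    · omega
  · rintro ⟨u, v, x, y⟩ h
    simp only [region, fullIndex, Finset.mem_filter, Finset.mem_product, Finset.mem_Icc] at h ⊢
    obtain ⟨⟨⟨⟨hu, hu'⟩, ⟨hv, hv'⟩, ⟨hx, hx'⟩, hy, hy'⟩, h1, h2, h3⟩, ⟨a, rfl⟩, b, rfl⟩ := h
    rw [Nat.mul_div_cancel_left _ hd0, Nat.mul_div_cancel_left _ hd0]
    have ha : 0 < a := Nat.pos_of_mul_pos_left hu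
    have hb : 0 < b := Nat.pos_of_mul_pos_left hv
    have hle : a * x + b * y ≤ n / d := by
      rw [Nat.le_div_iff_mul_le hd0]
      linarith
    have q1 : a ≤ a * x := Nat.le_mul_of_pos_right _ hx
    have q2 : b ≤ b * y := Nat.le_mul_of_pos_right _ hy
    have q3 : x ≤ a * x := Nat.le_mul_of_pos_left _ ha
    have q4 : y ≤ b * y := Nat.le_mul_of_pos_left _ hb
    exact ⟨⟨⟨ha, by omega⟩, ⟨hb, by omega⟩, ⟨hx, by omega⟩, hy, by omega⟩,
      Nat.lt_of_mul_lt_mul_left h1, h2, hle⟩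
  · rintro ⟨a, b, x, y⟩ _
    simp [Nat.mul_div_cancel_left _ hd0]
  · rintro ⟨u, v, x, y⟩ h
    simp only [Finset.mem_filter] at h
    simp [Nat.mul_div_cancel' h.2.1, Nat.mul_div_cancel' h.2.2]
  · rintro ⟨a, b, x, y⟩ _
    simp only [primTerm]
    push_cast
    ring

theorem F₁_eq_sum_primTerm (n : ℕ) :
    F₁ n = ∑ z ∈ (fullIndex n).filter (fun z => Nat.Coprime z.1 z.2.1), primTerm n z := by
  refine Finset.sum_congr ?_ fun _ _ => rfl
  rw [fullIndex, Finset.filter_filter]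
  refine Finset.filter_congr fun z _ => ?_
  tauto

/-- The sum of μ over the divisors of gcd(u,v) detects coprimality. These divisors are at most u ≤
n, so the range d ≤ n misses none. -/
theorem F₁_eq_sum_moebius (n : ℕ) :
    F₁ n = ∑ d ∈ Finset.Icc 1 n, ArithmeticFunction.moebius d * layer d n := by
  have h : ∀ d ∈ Finset.Icc 1 n, ArithmeticFunction.moebius d * layer d n =
      ∑ z ∈ fullIndex n,
        (if d ∣ z.1 ∧ d ∣ z.2.1 then ArithmeticFunction.moebius d else 0) * primTerm n z := by
    intro d hd
    rw [layer_eq_sum_fullIndex (Finset.mem_Icc.1 hd).1, Finset.mul_sum, Finset.sum_filter]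
    refine Finset.sum_congr rfl fun z _ => ?_
    split_ifs <;> simp
  rw [Finset.sum_congr rfl h, Finset.sum_comm, F₁_eq_sum_primTerm, Finset.sum_filter]
  refine Finset.sum_congr rfl fun z hz => ?_
  rw [← Finset.sum_mul, ← Finset.sum_filter]
  have hset : (Finset.Icc 1 n).filter (fun d => d ∣ z.1 ∧ d ∣ z.2.1) =
      (Nat.gcd z.1 z.2.1).divisors := by
    simp only [fullIndex, Finset.mem_filter, Finset.mem_product, Finset.mem_Icc] at hz
    have hpos : 0 < Nat.gcd z.1 z.2.1 := Nat.gcd_pos_of_pos_left _ hz.1.1.1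
    ext d
    simp only [Finset.mem_filter, Finset.mem_Icc, Nat.mem_divisors, Nat.dvd_gcd_iff]
    constructor
    · rintro ⟨_, h⟩
      exact ⟨h, hpos.ne'⟩
    · rintro ⟨h, _⟩
      have h1 := Nat.le_of_dvd hz.1.1.1 h.1
      have h2 := Nat.pos_of_dvd_of_pos h.1 hz.1.1.1
      exact ⟨⟨h2, h1.trans hz.1.1.2⟩, h⟩
  rw [hset, sum_divisors_moebius]
  by_cases hc : Nat.Coprime z.1 z.2.1
  · rw [if_pos hc, if_pos hc, one_mul]
  · rw [if_neg hc, if_neg hc, zero_mul]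

/-! ### Counting rectangles -/

/-- The vertex set of the rectangle with lowest vertex `(s, t)` and sides `(a, b)`, `(-c, e)`. -/
def vertices (s t a b c e : ℤ) : Finset (ℤ × ℤ) :=
  {(s, t), (s + a, t + b), (s - c, t + e), (s + a - c, t + b + e)}

/-- The sign conditions locate the vertices: (s,t) is the leftmost of the lowest, (s+a,t+b) the
lowest of the rightmost, and (s-c,t+e) the highest of the leftmost ones. -/
theorem vertices_injective {s t a b c e s' t' a' b' c' e' : ℤ} (ha : 0 < a) (hb : 0 ≤ b)
    (hc : 0 ≤ c) (he : 0 < e) (ha' : 0 < a') (hb' : 0 ≤ b') (hc' : 0 ≤ c') (he' : 0 < e')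
    (h : vertices s t a b c e = vertices s' t' a' b' c' e') :
    s = s' ∧ t = t' ∧ a = a' ∧ b = b' ∧ c = c' ∧ e = e' := by
  have hl : ∀ {x y}, (x, y) ∈ vertices s t a b c e → (x, y) ∈ vertices s' t' a' b' c' e' :=
    fun hx => h ▸ hx
  have hr : ∀ {x y}, (x, y) ∈ vertices s' t' a' b' c' e' → (x, y) ∈ vertices s t a b c e :=
    fun hx => h ▸ hx
  simp only [vertices, Finset.mem_insert, Finset.mem_singleton, Prod.mk.injEq] at hl hr
  have h1 := hl (x := s) (y := t) (by simp)
  have h1' := hr (x := s') (y := t') (by simp)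
  have hst : s = s' ∧ t = t' := by omega
  obtain ⟨rfl, rfl⟩ := hst
  have h2 := hl (x := s + a) (y := t + b) (by simp)
  have h2' := hr (x := s + a') (y := t + b') (by simp)
  have hab : a = a' ∧ b = b' := by omega
  obtain ⟨rfl, rfl⟩ := hab
  have h3 := hl (x := s - c) (y := t + e) (by simp)
  have h3' := hr (x := s - c') (y := t + e') (by simp)
  omega

/-- A nonzero w orthogonal to v lies, up to sign, in the second quadrant with w₂ > 0. If w₂ < 0, the
base point moves to p + w and w becomes -w. -/
theorem exists_vertices_of_quadrant {R : Finset (ℤ × ℤ)} {p v w : ℤ × ℤ} (hv1 : 0 < v.1)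
    (hv2 : 0 ≤ v.2) (hw : w ≠ 0) (hvw : v.1 * w.1 + v.2 * w.2 = 0)
    (hR : R = {p, p + v, p + w, p + v + w}) :
    ∃ s t a b c e : ℤ, 0 < a ∧ 0 ≤ b ∧ 0 ≤ c ∧ 0 < e ∧ a * c = b * e ∧
      R = vertices s t a b c e := by
  obtain ⟨p1, p2⟩ := p
  obtain ⟨v1, v2⟩ := v
  obtain ⟨w1, w2⟩ := w
  simp only at hv1 hv2 hvw
  rcases lt_trichotomy w2 0 with h | h | h
  · refine ⟨p1 + w1, p2 + w2, v1, v2, w1, -w2, hv1, hv2, ?_, by omega, by linarith, ?_⟩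
    · by_contra hc
      nlinarith [mul_nonneg hv2 (by omega : 0 ≤ -w2), mul_pos hv1 (by omega : 0 < -w1)]
    · rw [hR]
      ext ⟨x, y⟩
      simp only [vertices, Finset.mem_insert, Finset.mem_singleton, Prod.mk_add_mk,
        Prod.mk.injEq]
      omega
  · subst h
    have : w1 = 0 := by
      rw [mul_zero, add_zero] at hvw
      rcases mul_eq_zero.1 hvw with h | h
      · omega
      · exact h
    exact absurd (by rw [this]; rfl) hw
  · refine ⟨p1, p2, v1, v2, -w1, w2, hv1, hv2, ?_, h, by linarith, ?_⟩
    · by_contra hc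
      nlinarith [mul_nonneg hv2 h.le, mul_pos hv1 (by omega : 0 < w1)]
    · rw [hR]
      ext ⟨x, y⟩
      simp only [vertices, Finset.mem_insert, Finset.mem_singleton, Prod.mk_add_mk,
        Prod.mk.injEq]
      omega

theorem rectangle_neg (p v w : ℤ × ℤ) : ({p, p + v, p + w, p + v + w} : Finset (ℤ × ℤ)) =
    {p + v, p + v + -v, p + v + w, p + v + -v + w} := by
  rw [add_neg_cancel_right]
  ext x
  simp only [Finset.mem_insert, Finset.mem_singleton]
  tauto

theorem rectangle_swap (p v w : ℤ × ℤ) : ({p, p + v, p + w, p + v + w} : Finset (ℤ × ℤ)) =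
    {p, p + w, p + v, p + w + v} := by
  rw [add_right_comm p w v]
  ext x
  simp only [Finset.mem_insert, Finset.mem_singleton]
  tauto

/-- The half-open first and third quadrants and their images under a quarter turn partition the
nonzero vectors. Of two orthogonal nonzero vectors one therefore lies in the former set. -/
theorem quadrant_of_orthogonal {v w : ℤ × ℤ} (hv : v ≠ 0) (hw : w ≠ 0)
    (hvw : v.1 * w.1 + v.2 * w.2 = 0) (h1 : ¬ (0 < v.1 ∧ 0 ≤ v.2))
    (h2 : ¬ (v.1 < 0 ∧ v.2 ≤ 0)) : (0 < w.1 ∧ 0 ≤ w.2) ∨ (w.1 < 0 ∧ w.2 ≤ 0) := by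
  obtain ⟨v1, v2⟩ := v
  obtain ⟨w1, w2⟩ := w
  simp only [ne_eq, Prod.mk_eq_zero] at *
  by_contra hc
  rcases lt_trichotomy v1 0 with a | a | a
  · have hv2 : 0 < v2 := by omega
    rcases lt_trichotomy w1 0 with b | b | b
    · nlinarith [mul_pos_of_neg_of_neg a b, mul_pos hv2 (by omega : 0 < w2)]
    · subst b
      have : v2 * w2 = 0 := by linarith
      rcases mul_eq_zero.1 this with h | h <;> omega
    · nlinarith [mul_pos (by omega : 0 < -v1) b, mul_pos hv2 (by omega : 0 < -w2)]
  · subst a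
    have : v2 * w2 = 0 := by linarith
    rcases mul_eq_zero.1 this with h | h <;> omega
  · have hv2 : v2 < 0 := by omega
    rcases lt_trichotomy w1 0 with b | b | b
    · nlinarith [mul_pos a (by omega : 0 < -w1), mul_pos (by omega : 0 < -v2) (by omega : 0 < w2)]
    · subst b
      have : v2 * w2 = 0 := by linarith
      rcases mul_eq_zero.1 this with h | h <;> omega
    · nlinarith [mul_pos a b, mul_pos (by omega : 0 < -v2) (by omega : 0 < -w2)]

theorem IsRectangle.exists_vertices {R : Finset (ℤ × ℤ)} (h : IsRectangle R) :
    ∃ s t a b c e : ℤ, 0 < a ∧ 0 ≤ b ∧ 0 ≤ c ∧ 0 < e ∧ a * c = b * e ∧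
      R = vertices s t a b c e := by
  have key : ∀ p v w : ℤ × ℤ, w ≠ 0 → v.1 * w.1 + v.2 * w.2 = 0 →
      (0 < v.1 ∧ 0 ≤ v.2) ∨ (v.1 < 0 ∧ v.2 ≤ 0) → R = {p, p + v, p + w, p + v + w} →
      ∃ s t a b c e : ℤ, 0 < a ∧ 0 ≤ b ∧ 0 ≤ c ∧ 0 < e ∧ a * c = b * e ∧
        R = vertices s t a b c e := by
    rintro p v w hw hvw (hq | hq) hR
    · exact exists_vertices_of_quadrant hq.1 hq.2 hw hvw hR
    · rw [rectangle_neg] at hR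
      refine exists_vertices_of_quadrant (v := -v) ?_ ?_ hw ?_ hR
      · simpa using hq.1
      · simpa using hq.2
      · simp only [Prod.fst_neg, Prod.snd_neg]
        linarith
  obtain ⟨p, v, w, hv, hw, hvw, hR⟩ := h
  by_cases hq : (0 < v.1 ∧ 0 ≤ v.2) ∨ (v.1 < 0 ∧ v.2 ≤ 0)
  · exact key p v w hw hvw hq hR
  · rw [not_or] at hq
    rw [rectangle_swap] at hR
    exact key p w v hv (by linarith) (quadrant_of_orthogonal hv hw hvw hq.1 hq.2) hR

/-- Write (a,b) = x(u,v) with u, v coprime. Then uc = ve, so u divides e, and the quotient is y. -/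
theorem exists_primitive {a b c e : ℤ} (ha : 0 < a) (hb : 0 ≤ b) (hc : 0 ≤ c) (he : 0 < e)
    (h : a * c = b * e) :
    ∃ u v x y : ℕ, 0 < u ∧ 0 < x ∧ 0 < y ∧ Nat.Coprime u v ∧ a = x * u ∧ b = x * v ∧
      c = y * v ∧ e = y * u := by
  lift a to ℕ using ha.le
  lift b to ℕ using hb
  lift c to ℕ using hc
  lift e to ℕ using he.le
  have ha' : 0 < a := by exact_mod_cast ha
  have he' : 0 < e := by exact_mod_cast he
  have h' : a * c = b * e := by exact_mod_cast h
  obtain ⟨x, u, v, hx, hcop, hau, hbv⟩ := Nat.exists_coprime' (m := a) (n := b)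
    (Nat.gcd_pos_of_pos_left _ ha')
  have hu : 0 < u := Nat.pos_of_ne_zero fun hu => by simp [hu] at hau; omega
  have h1 : u * c = v * e := by
    refine Nat.eq_of_mul_eq_mul_right hx ?_
    rw [hau, hbv] at h'
    linarith
  obtain ⟨y, rfl⟩ : u ∣ e := hcop.dvd_of_dvd_mul_left ⟨c, h1.symm⟩
  have h2 : c = v * y := Nat.eq_of_mul_eq_mul_left hu (by linarith)
  have hy : 0 < y := Nat.pos_of_mul_pos_left he'
  refine ⟨u, v, x, y, hu, hx, hy, hcop, ?_, ?_, ?_, ?_⟩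
  · exact_mod_cast hau.trans (mul_comm _ _)
  · exact_mod_cast hbv.trans (mul_comm _ _)
  · exact_mod_cast h2.trans (mul_comm _ _)
  · exact_mod_cast mul_comm u y

theorem primitive_unique {u v x u' v' x' : ℕ} (hx : 0 < x)
    (h : Nat.Coprime u v) (h' : Nat.Coprime u' v') (h1 : x * u = x' * u')
    (h2 : x * v = x' * v') : u = u' ∧ v = v' ∧ x = x' := by
  have hxx : x = x' := by
    have e1 : Nat.gcd (x * u) (x * v) = x := by rw [Nat.gcd_mul_left, h, mul_one]
    have e2 : Nat.gcd (x' * u') (x' * v') = x' := by rw [Nat.gcd_mul_left, h', mul_one]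
    rw [← e1, h1, h2, e2]
  subst hxx
  exact ⟨Nat.eq_of_mul_eq_mul_left hx h1, Nat.eq_of_mul_eq_mul_left hx h2, rfl⟩

/-- Primitive directions `(u, v)` and side lengths `(x, y)`. -/
def directions (n : ℕ) : Finset (ℕ × ℕ × ℕ × ℕ) :=
  (Finset.Icc 1 n ×ˢ Finset.Icc 0 n ×ˢ Finset.Icc 1 n ×ˢ Finset.Icc 1 n).filter
    (fun z => Nat.Coprime z.1 z.2.1)

/-- The number of positions of a rectangle in the grid. -/
def positions (n : ℕ) (z : ℕ × ℕ × ℕ × ℕ) : ℕ :=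
  (n - (z.2.2.1 * z.1 + z.2.2.2 * z.2.1)) * (n - (z.2.2.1 * z.2.1 + z.2.2.2 * z.1))

/-- The rectangle with given direction, side lengths and position. -/
def placed (w : (_ : ℕ × ℕ × ℕ × ℕ) × ℕ × ℕ) : Finset (ℤ × ℤ) :=
  vertices (w.2.1 + w.1.2.2.2 * w.1.2.1 : ℕ) w.2.2 (w.1.2.2.1 * w.1.1 : ℕ)
    (w.1.2.2.1 * w.1.2.1 : ℕ) (w.1.2.2.2 * w.1.2.1 : ℕ) (w.1.2.2.2 * w.1.1 : ℕ)

/-- The index set of all rectangles in the grid. -/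
def placements (n : ℕ) : Finset ((_ : ℕ × ℕ × ℕ × ℕ) × ℕ × ℕ) :=
  (directions n).sigma fun z =>
    Finset.range (n - (z.2.2.1 * z.1 + z.2.2.2 * z.2.1)) ×ˢ
      Finset.range (n - (z.2.2.1 * z.2.1 + z.2.2.2 * z.1))

theorem placed_injOn (n : ℕ) : Set.InjOn placed (placements n) := by
  rintro ⟨⟨u, v, x, y⟩, i, j⟩ h ⟨⟨u', v', x', y'⟩, i', j'⟩ h' heq
  simp only [placements, directions, Finset.coe_sigma, Set.mem_sigma_iff, Finset.mem_coe,
    Finset.mem_filter, Finset.mem_product, Finset.mem_Icc] at h h'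
  obtain ⟨⟨⟨⟨hu, -⟩, -, ⟨hx, -⟩, hy, -⟩, hcop⟩, -⟩ := h
  obtain ⟨⟨⟨⟨hu', -⟩, -, ⟨hx', -⟩, hy', -⟩, hcop'⟩, -⟩ := h'
  have pos : ∀ {a b : ℕ}, 1 ≤ a → 1 ≤ b → (0 : ℤ) < (a * b : ℕ) := fun ha hb => by
    exact_mod_cast Nat.mul_pos ha hb
  obtain ⟨h1, h2, h3, h4, h5, h6⟩ := vertices_injective (pos hx hu) (Int.natCast_nonneg _)
    (Int.natCast_nonneg _) (pos hy hu) (pos hx' hu') (Int.natCast_nonneg _)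
    (Int.natCast_nonneg _) (pos hy' hu') heq
  have g1 : i + y * v = i' + y' * v' := by exact_mod_cast h1
  have g2 : j = j' := by exact_mod_cast h2
  have g3 : x * u = x' * u' := by exact_mod_cast h3
  have g4 : x * v = x' * v' := by exact_mod_cast h4
  have g6 : y * u = y' * u' := by exact_mod_cast h6
  obtain ⟨rfl, rfl, rfl⟩ := primitive_unique hx hcop hcop' g3 g4
  have : y = y' := Nat.eq_of_mul_eq_mul_right hu g6
  subst this
  have : i = i' := by omega
  subst this g2
  rfl

/-- The position (i,j) is the lower left corner of the bounding box. The lowest vertex has the same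
ordinate j, but its abscissa is i + yv. -/
theorem rectangles_eq_image (n : ℕ) :
    {R : Finset (ℤ × ℤ) | R ⊆ grid n ∧ IsRectangle R} = placed '' (placements n) := by
  ext R
  constructor
  · rintro ⟨hsub, hrec⟩
    obtain ⟨s, t, a, b, c, e, ha, hb, hc, he, h, rfl⟩ := hrec.exists_vertices
    obtain ⟨u, v, x, y, hu, hx, hy, hcop, rfl, rfl, rfl, rfl⟩ := exists_primitive ha hb hc he h
    have hmem : ∀ {X Y : ℤ}, (X, Y) ∈ vertices s t (x * u) (x * v) (y * v) (y * u) →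
        (0 ≤ X ∧ X < n) ∧ 0 ≤ Y ∧ Y < n := fun hXY => by
      have := hsub hXY
      simpa [grid] using this
    have m1 := hmem (X := s) (Y := t) (by simp [vertices])
    have m2 := hmem (X := s + x * u) (Y := t + x * v) (by simp [vertices])
    have m3 := hmem (X := s - y * v) (Y := t + y * u) (by simp [vertices])
    have m4 := hmem (X := s + x * u - y * v) (Y := t + x * v + y * u) (by simp [vertices])
    obtain ⟨i, hi⟩ : ∃ i : ℕ, s - y * v = i := ⟨_, (Int.toNat_of_nonneg m3.1.1).symm⟩
    obtain ⟨j, hj⟩ : ∃ j : ℕ, t = j := ⟨_, (Int.toNat_of_nonneg m1.2.1).symm⟩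
    have b1 : i + (x * u + y * v) < n := by
      have : (i : ℤ) + (x * u + y * v) < n := by linarith [m2.1.2]
      exact_mod_cast this
    have b2 : j + (x * v + y * u) < n := by
      have : (j : ℤ) + (x * v + y * u) < n := by linarith [m4.2.2]
      exact_mod_cast this
    have q1 : u ≤ x * u := Nat.le_mul_of_pos_left _ hx
    have q2 : v ≤ x * v := Nat.le_mul_of_pos_left _ hx
    have q3 : x ≤ x * u := Nat.le_mul_of_pos_right _ hu
    have q4 : y ≤ y * u := Nat.le_mul_of_pos_right _ hu
    refine ⟨⟨(u, v, x, y), i, j⟩, ?_, ?_⟩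
    · simp only [placements, directions, Finset.coe_sigma, Set.mem_sigma_iff, Finset.mem_coe,
        Finset.mem_filter, Finset.mem_product, Finset.mem_Icc, Finset.mem_range]
      exact ⟨⟨⟨⟨hu, by omega⟩, ⟨by omega, by omega⟩, ⟨hx, by omega⟩, hy, by omega⟩, hcop⟩,
        by omega, by omega⟩
    · simp only [placed]
      rw [hj]
      push_cast
      rw [show (i : ℤ) + y * v = s by linarith]
  · rintro ⟨⟨⟨u, v, x, y⟩, i, j⟩, hmem, rfl⟩
    simp only [placements, directions, Finset.coe_sigma, Set.mem_sigma_iff, Finset.mem_coe,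
      Finset.mem_filter, Finset.mem_product, Finset.mem_Icc, Finset.mem_range] at hmem
    obtain ⟨⟨⟨⟨hu, -⟩, -, ⟨hx, -⟩, hy, -⟩, hcop⟩, hi, hj⟩ := hmem
    have p1 : 0 < x * u := Nat.mul_pos hx hu
    have p2 : 0 < y * u := Nat.mul_pos hy hu
    constructor
    · intro ⟨X, Y⟩ hXY
      simp only [placed, vertices, Finset.mem_insert, Finset.mem_singleton, Prod.mk.injEq] at hXY
      simp only [grid, Finset.mem_product, Finset.mem_Ico]
      omega
    · refine ⟨((i + y * v : ℕ), j), ((x * u : ℕ), (x * v : ℕ)), (-(y * v : ℕ), (y * u : ℕ)),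
        ?_, ?_, ?_, ?_⟩
      · intro h
        have := congrArg Prod.fst h
        simp only [Prod.fst_zero] at this
        omega
      · intro h
        have := congrArg Prod.snd h
        simp only [Prod.snd_zero] at this
        omega
      · push_cast
        ring
      · rfl

theorem F_eq_sum_positions (n : ℕ) : F n = ∑ z ∈ directions n, positions n z := by
  rw [F, rectangles_eq_image, Set.InjOn.ncard_image (placed_injOn n), Set.ncard_coe_finset,
    placements, Finset.card_sigma]
  refine Finset.sum_congr rfl fun z _ => ?_
  rw [Finset.card_product, Finset.card_range, Finset.card_range, positions]

end LatticeRect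

/-! ### Axis-parallel, diagonal and oblique directions -/

namespace LatticeRect

/-- All quadruples with entries in `[1, n]` and coprime first entries. -/
def coprimeBox (n : ℕ) : Finset (ℕ × ℕ × ℕ × ℕ) :=
  (Finset.Icc 1 n ×ˢ Finset.Icc 1 n ×ˢ Finset.Icc 1 n ×ˢ Finset.Icc 1 n).filter
    (fun z => Nat.Coprime z.1 z.2.1)

/-- The terms with y > m equal f 0 = 0 by truncated subtraction, so one range [1,n] can serve for
every m ≤ n. -/
theorem sum_Icc_truncated {M : Type*} [AddCommMonoid M] (f : ℕ → M) (h0 : f 0 = 0) {m n : ℕ}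
    (h : m ≤ n) : ∑ y ∈ Finset.Icc 1 n, f (m - y) = ∑ k ∈ Finset.range m, f k := by
  have h1 : ∑ y ∈ Finset.Icc 1 m, f (m - y) = ∑ y ∈ Finset.Icc 1 n, f (m - y) := by
    refine Finset.sum_subset (Finset.Icc_subset_Icc le_rfl h) fun y hy hy' => ?_
    rw [Finset.mem_Icc] at hy hy'
    rw [Nat.sub_eq_zero_of_le (by omega), h0]
  rw [← h1]
  refine Finset.sum_nbij' (fun y => m - y) (fun k => m - k) ?_ ?_ ?_ ?_ fun _ _ => rfl
  all_goals
    intro y hy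
    simp only [Finset.mem_Icc, Finset.mem_range] at hy ⊢
    omega

theorem sum_axis_parallel (n : ℕ) :
    ∑ z ∈ (directions n).filter (fun z => z.2.1 = 0), (positions n z : ℚ) =
      (n : ℚ) ^ 2 * ((n : ℚ) - 1) ^ 2 / 4 := by
  have h1 : ∑ z ∈ (directions n).filter (fun z => z.2.1 = 0), (positions n z : ℚ) =
      ∑ w ∈ Finset.Icc 1 n ×ˢ Finset.Icc 1 n, ((n - w.1 : ℕ) : ℚ) * ((n - w.2 : ℕ) : ℚ) := by
    refine Finset.sum_nbij' (fun z => (z.2.2.1, z.2.2.2)) (fun w => (1, 0, w.1, w.2))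
      ?_ ?_ ?_ ?_ ?_
    · rintro ⟨u, v, x, y⟩ h
      simp only [directions, Finset.mem_filter, Finset.mem_product] at h ⊢
      exact h.1.1.2.2
    · rintro ⟨x, y⟩ h
      simp only [directions, Finset.mem_filter, Finset.mem_product, Finset.mem_Icc] at h ⊢
      refine ⟨⟨⟨⟨le_rfl, by omega⟩, ⟨le_rfl, by omega⟩, h⟩, by simp⟩, trivial⟩
    · rintro ⟨u, v, x, y⟩ h
      simp only [directions, Finset.mem_filter] at h
      obtain ⟨⟨-, hc⟩, rfl⟩ := h
      have : u = 1 := by simpa using hc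
      subst this
      rfl
    · rintro ⟨x, y⟩ _; rfl
    · rintro ⟨u, v, x, y⟩ h
      simp only [directions, Finset.mem_filter] at h
      obtain ⟨⟨-, hc⟩, rfl⟩ := h
      have : u = 1 := by simpa using hc
      subst this
      simp [positions]
  have h2 : ∑ x ∈ Finset.Icc 1 n, ((n - x : ℕ) : ℚ) = (n : ℚ) * ((n : ℚ) - 1) / 2 := by
    rw [sum_Icc_truncated (fun k => (k : ℚ)) (by simp) le_rfl]
    have h : ∀ m : ℕ, ∑ k ∈ Finset.range m, (k : ℚ) = (m : ℚ) * ((m : ℚ) - 1) / 2 := by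
      intro m
      induction m with
      | zero => simp
      | succ m ih => rw [Finset.sum_range_succ, ih]; push_cast; ring
    exact h n
  rw [h1, Finset.sum_product]
  simp only [← Finset.mul_sum, ← Finset.sum_mul, h2]
  ring

theorem sum_diagonal (n : ℕ) :
    ∑ z ∈ (coprimeBox n).filter (fun z => z.1 = z.2.1), (positions n z : ℚ) =
      (n : ℚ) * ((n : ℚ) - 1) ^ 2 * ((n : ℚ) - 2) / 12 := by
  have h1 : ∑ z ∈ (coprimeBox n).filter (fun z => z.1 = z.2.1), (positions n z : ℚ) =
      ∑ w ∈ Finset.Icc 1 n ×ˢ Finset.Icc 1 n, ((n - w.1 - w.2 : ℕ) : ℚ) ^ 2 := by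
    refine Finset.sum_nbij' (fun z => (z.2.2.1, z.2.2.2)) (fun w => (1, 1, w.1, w.2))
      ?_ ?_ ?_ ?_ ?_
    · rintro ⟨u, v, x, y⟩ h
      simp only [coprimeBox, Finset.mem_filter, Finset.mem_product] at h ⊢
      exact h.1.1.2.2
    · rintro ⟨x, y⟩ h
      simp only [coprimeBox, Finset.mem_filter, Finset.mem_product, Finset.mem_Icc] at h ⊢
      refine ⟨⟨⟨⟨le_rfl, by omega⟩, ⟨le_rfl, by omega⟩, h⟩, by simp⟩, trivial⟩
    · rintro ⟨u, v, x, y⟩ h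
      simp only [coprimeBox, Finset.mem_filter] at h
      obtain ⟨⟨-, hc⟩, rfl⟩ := h
      have : u = 1 := by simpa using hc
      subst this
      rfl
    · rintro ⟨x, y⟩ _; rfl
    · rintro ⟨u, v, x, y⟩ h
      simp only [coprimeBox, Finset.mem_filter] at h
      obtain ⟨⟨-, hc⟩, rfl⟩ := h
      have : u = 1 := by simpa using hc
      subst this
      simp [positions, Nat.sub_sub, sq]
  have h2 : ∀ m : ℕ, ∑ k ∈ Finset.range m, (k : ℚ) ^ 2 =
      ((m : ℚ) - 1) * m * (2 * m - 1) / 6 := by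
    intro m
    induction m with
    | zero => simp
    | succ m ih => rw [Finset.sum_range_succ, ih]; push_cast; ring
  have h3 : ∀ x ∈ Finset.Icc 1 n, ∑ y ∈ Finset.Icc 1 n, ((n - x - y : ℕ) : ℚ) ^ 2 =
      (((n - x : ℕ) : ℚ) - 1) * (n - x : ℕ) * (2 * (n - x : ℕ) - 1) / 6 := by
    intro x _
    rw [sum_Icc_truncated (fun k => (k : ℚ) ^ 2) (by simp) (Nat.sub_le n x), h2]
  have h4 : ∀ m : ℕ, ∑ k ∈ Finset.range m, ((k : ℚ) - 1) * k * (2 * k - 1) / 6 =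
      (m : ℚ) * ((m : ℚ) - 1) ^ 2 * ((m : ℚ) - 2) / 12 := by
    intro m
    induction m with
    | zero => simp
    | succ m ih => rw [Finset.sum_range_succ, ih]; push_cast; ring
  rw [h1, Finset.sum_product, Finset.sum_congr rfl h3,
    sum_Icc_truncated (fun k => ((k : ℚ) - 1) * k * (2 * k - 1) / 6) (by simp) le_rfl, h4]

theorem sum_swap_directions (n : ℕ) :
    ∑ z ∈ (coprimeBox n).filter (fun z => z.1 < z.2.1), positions n z =
      ∑ z ∈ (coprimeBox n).filter (fun z => z.2.1 < z.1), positions n z := by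
  refine Finset.sum_nbij' (fun z => (z.2.1, z.1, z.2.2)) (fun z => (z.2.1, z.1, z.2.2))
    ?_ ?_ (fun _ _ => rfl) (fun _ _ => rfl) ?_
  · rintro ⟨u, v, x, y⟩ h
    simp only [coprimeBox, Finset.mem_filter, Finset.mem_product] at h ⊢
    exact ⟨⟨⟨h.1.1.2.1, h.1.1.1, h.1.1.2.2⟩, h.1.2.symm⟩, h.2⟩
  · rintro ⟨u, v, x, y⟩ h
    simp only [coprimeBox, Finset.mem_filter, Finset.mem_product] at h ⊢
    exact ⟨⟨⟨h.1.1.2.1, h.1.1.1, h.1.1.2.2⟩, h.1.2.symm⟩, h.2⟩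
  · rintro ⟨u, v, x, y⟩ _
    simp only [positions]
    rw [mul_comm]

theorem sum_swap_sides (n : ℕ) :
    ∑ z ∈ (coprimeBox n).filter (fun z => z.2.1 < z.1 ∧ z.2.2.1 < z.2.2.2), positions n z =
      ∑ z ∈ (coprimeBox n).filter (fun z => z.2.1 < z.1 ∧ z.2.2.2 < z.2.2.1), positions n z := by
  refine Finset.sum_nbij' (fun z => (z.1, z.2.1, z.2.2.2, z.2.2.1))
    (fun z => (z.1, z.2.1, z.2.2.2, z.2.2.1)) ?_ ?_ (fun _ _ => rfl) (fun _ _ => rfl) ?_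
  · rintro ⟨u, v, x, y⟩ h
    simp only [coprimeBox, Finset.mem_filter, Finset.mem_product] at h ⊢
    exact ⟨⟨⟨h.1.1.1, h.1.1.2.1, h.1.1.2.2.2, h.1.1.2.2.1⟩, h.1.2⟩, h.2⟩
  · rintro ⟨u, v, x, y⟩ h
    simp only [coprimeBox, Finset.mem_filter, Finset.mem_product] at h ⊢
    exact ⟨⟨⟨h.1.1.1, h.1.1.2.1, h.1.1.2.2.2, h.1.1.2.2.1⟩, h.1.2⟩, h.2⟩
  · rintro ⟨u, v, x, y⟩ _
    simp only [positions]
    rw [mul_comm, add_comm (x * v), add_comm (x * u)]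

/-- Exchanging x and y turns twice the full sum into a sum over x ≥ y with weights 4 and 2. Boxes
that are too wide contribute 0 by truncated subtraction; the others are not too high either, since
(u-v)(x-y) ≥ 0 gives xv + yu ≤ xu + yv. -/
theorem F₁_eq_two_mul_sum (n : ℕ) :
    F₁ n = 2 * ∑ z ∈ (coprimeBox n).filter (fun z => z.2.1 < z.1), (positions n z : ℤ) := by
  have h1 : F₁ n = ∑ z ∈ (coprimeBox n).filter (fun z => z.2.1 < z.1 ∧ z.2.2.2 ≤ z.2.2.1),
      mult z.2.2.1 z.2.2.2 * (positions n z : ℤ) := by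
    rw [F₁_eq_sum_primTerm]
    have hsub : (fullIndex n).filter (fun z => Nat.Coprime z.1 z.2.1) ⊆
        (coprimeBox n).filter (fun z => z.2.1 < z.1 ∧ z.2.2.2 ≤ z.2.2.1) := by
      intro z h
      simp only [fullIndex, coprimeBox, Finset.mem_filter] at h ⊢
      tauto
    rw [← Finset.sum_subset hsub]
    · refine Finset.sum_congr rfl ?_
      rintro ⟨u, v, x, y⟩ h
      simp only [fullIndex, Finset.mem_filter] at h
      obtain ⟨⟨-, h1, h2, h3⟩, -⟩ := h
      have h4 : x * v + y * u ≤ x * u + y * v := by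
        obtain ⟨k, rfl⟩ := Nat.exists_eq_add_of_le h1.le
        obtain ⟨l, rfl⟩ := Nat.exists_eq_add_of_le h2
        nlinarith [Nat.zero_le (k * l)]
      have h5 : x * v + y * u ≤ n := h4.trans h3
      simp only [primTerm, positions]
      push_cast [h3, h5]
      ring
    · rintro ⟨u, v, x, y⟩ h h'
      simp only [fullIndex, coprimeBox, Finset.mem_filter] at h h'
      have : ¬ x * u + y * v ≤ n := fun hle => h' ⟨⟨h.1.1, h.2.1, h.2.2, hle⟩, h.1.2⟩
      simp only [positions]
      rw [Nat.sub_eq_zero_of_le (by omega)]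
      simp
  have h2 : (∑ z ∈ (coprimeBox n).filter (fun z => z.2.1 < z.1 ∧ z.2.2.1 < z.2.2.2),
      (positions n z : ℤ)) = ∑ z ∈ (coprimeBox n).filter
        (fun z => z.2.1 < z.1 ∧ z.2.2.2 < z.2.2.1), (positions n z : ℤ) := by
    rw [← Nat.cast_sum, ← Nat.cast_sum, sum_swap_sides]
  have h3 : 2 * ∑ z ∈ (coprimeBox n).filter (fun z => z.2.1 < z.1), (positions n z : ℤ) =
      ∑ z ∈ (coprimeBox n).filter (fun z => z.2.1 < z.1 ∧ z.2.2.2 ≤ z.2.2.1),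
        mult z.2.2.1 z.2.2.2 * (positions n z : ℤ) +
      (2 * ∑ z ∈ (coprimeBox n).filter (fun z => z.2.1 < z.1 ∧ z.2.2.1 < z.2.2.2),
          (positions n z : ℤ) -
        2 * ∑ z ∈ (coprimeBox n).filter (fun z => z.2.1 < z.1 ∧ z.2.2.2 < z.2.2.1),
          (positions n z : ℤ)) := by
    simp only [Finset.sum_filter, Finset.mul_sum, ← Finset.sum_add_distrib,
      ← Finset.sum_sub_distrib]
    refine Finset.sum_congr rfl fun z _ => ?_
    by_cases h : z.2.1 < z.1
    · simp only [h, true_and, if_true, mult]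
      rcases lt_trichotomy z.2.2.1 z.2.2.2 with hlt | heq | hgt
      · rw [if_neg (by omega), if_pos hlt, if_neg (by omega)]
        ring
      · rw [if_pos (by omega), if_pos heq, if_neg (by omega), if_neg (by omega)]
        ring
      · rw [if_pos (by omega), if_neg (by omega), if_neg (by omega), if_pos hgt]
        ring
    · simp [h]
  rw [h1, h3, h2]
  ring

theorem F_eq_F₀_add_F₁ (n : ℕ) : (F n : ℚ) = F₀ n + F₁ n := by
  have h1 : (F n : ℚ) = ∑ z ∈ (directions n).filter (fun z => z.2.1 = 0), (positions n z : ℚ) +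
      ∑ z ∈ coprimeBox n, (positions n z : ℚ) := by
    rw [F_eq_sum_positions, Nat.cast_sum,
      ← Finset.sum_filter_add_sum_filter_not (directions n) (fun z => z.2.1 = 0)]
    congr 1
    refine Finset.sum_congr ?_ fun _ _ => rfl
    ext ⟨u, v, x, y⟩
    simp only [directions, coprimeBox, Finset.mem_filter, Finset.mem_product, Finset.mem_Icc,
      Nat.zero_le, true_and]
    constructor
    · rintro ⟨⟨⟨h1, h2, h3⟩, h4⟩, h5⟩
      exact ⟨⟨h1, ⟨by omega, h2⟩, h3⟩, h4⟩
    · rintro ⟨⟨h1, h2, h3⟩, h4⟩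
      exact ⟨⟨⟨h1, h2.2, h3⟩, h4⟩, by omega⟩
  have h2 : ∑ z ∈ coprimeBox n, (positions n z : ℚ) =
      ∑ z ∈ (coprimeBox n).filter (fun z => z.1 = z.2.1), (positions n z : ℚ) +
      (∑ z ∈ (coprimeBox n).filter (fun z => z.1 < z.2.1), (positions n z : ℚ) +
      ∑ z ∈ (coprimeBox n).filter (fun z => z.2.1 < z.1), (positions n z : ℚ)) := by
    simp only [Finset.sum_filter, ← Finset.sum_add_distrib]
    refine Finset.sum_congr rfl fun z _ => ?_
    rcases lt_trichotomy z.1 z.2.1 with hlt | heq | hgt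
    · rw [if_neg (by omega), if_pos hlt, if_neg (by omega)]; ring
    · rw [if_pos heq, if_neg (by omega), if_neg (by omega)]; ring
    · rw [if_neg (by omega), if_neg (by omega), if_pos hgt]; ring
  have h3 : ∑ z ∈ (coprimeBox n).filter (fun z => z.1 < z.2.1), (positions n z : ℚ) =
      ∑ z ∈ (coprimeBox n).filter (fun z => z.2.1 < z.1), (positions n z : ℚ) := by
    rw [← Nat.cast_sum, ← Nat.cast_sum, sum_swap_directions]
  rw [h1, h2, h3, sum_axis_parallel, sum_diagonal, F₀, F₁_eq_two_mul_sum]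
  push_cast
  ring

end LatticeRect

namespace LatticeRect

open ArithmeticFunction (moebius)

/-! ### The program for one value -/

/-- Contents of cell `k` of the Möbius sieve when all `j < d` have been processed. -/
def sieveCell (d k : ℕ) : ℤ :=
  (if k = 1 then 1 else 0) - ∑ j ∈ Finset.range d, if j ∣ k ∧ j < k then moebius j else 0

theorem sieveCell_one (k : ℕ) : sieveCell 1 k = if k = 1 then 1 else 0 := by
  simp [sieveCell]

theorem sieveCell_succ (d k : ℕ) :
    sieveCell (d + 1) k = sieveCell d k - if d ∣ k ∧ d < k then moebius d else 0 := by
  rw [sieveCell, sieveCell, Finset.sum_range_succ]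
  ring

theorem sieveCell_succ_of_not {d k : ℕ} (h : ¬ (d ∣ k ∧ d < k)) :
    sieveCell (d + 1) k = sieveCell d k := by
  rw [sieveCell_succ, if_neg h, sub_zero]

/-- When d is reached all its proper divisors have been subtracted, and the divisor sum of μ being
[d = 1] leaves μ(d). -/
theorem sieveCell_self {d : ℕ} (hd : 1 ≤ d) : sieveCell d d = moebius d := by
  have h := sum_divisors_moebius d
  rw [← Nat.cons_self_properDivisors (by omega), Finset.sum_cons] at h
  have h2 : ∑ j ∈ Finset.range d, (if j ∣ d ∧ j < d then moebius j else 0) =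
      ∑ j ∈ d.properDivisors, moebius j := by
    rw [← Finset.sum_filter]
    refine Finset.sum_congr ?_ fun _ _ => rfl
    ext j
    simp only [Finset.mem_filter, Finset.mem_range, Nat.mem_properDivisors]
    tauto
  rw [sieveCell, h2, ← h]
  ring

theorem abs_sieveCell_le (d k : ℕ) : |sieveCell d k| ≤ d + 1 := by
  have h1 : |(if k = 1 then 1 else 0 : ℤ)| ≤ 1 := by split_ifs <;> simp
  have h2 : |∑ j ∈ Finset.range d, if j ∣ k ∧ j < k then moebius j else 0| ≤ (d : ℤ) := by
    refine (Finset.abs_sum_le_sum_abs _ _).trans ?_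
    calc _ ≤ ∑ j ∈ Finset.range d, (1 : ℤ) := Finset.sum_le_sum fun j _ => by
          split_ifs
          · exact ArithmeticFunction.abs_moebius_le_one
          · simp
      _ = d := by simp
  have h3 := abs_sub (if k = 1 then 1 else 0 : ℤ)
    (∑ j ∈ Finset.range d, if j ∣ k ∧ j < k then moebius j else 0)
  rw [sieveCell]
  linarith

/-- One step of the sieve: the multiples of `d` beyond `d` are decreased by the value of cell `d`,
which is kept in register 61; register 62 runs over the multiples. -/
def sieveProg : Prog :=
  .seq (.assign 62 (.reg 1 + .reg 1)) (.whilePos (.reg 0 + 1 - .reg 62)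
    (.seq (.store (.reg 62) (.sub (.load (.reg 62)) (.reg 61))) (.assign 62 (.reg 62 + .reg 1))))

/-- One value of `d`: the layer, its contribution to the total in register 60, the sieve. -/
def roundProg : Prog :=
  .seq layerProg (.seq (.assign 61 (.load (.reg 1)))
    (.seq (.assign 60 (.reg 60 + .reg 61 * .reg 50))
      (.seq sieveProg (.assign 1 (.reg 1 + 1)))))

/-- The closed-form part, from register 0. -/
def closedForm : Expr :=
  (3 * (.reg 0 * .reg 0 * ((.reg 0 - 1) * (.reg 0 - 1))) +
    .reg 0 * ((.reg 0 - 1) * (.reg 0 - 1)) * (.reg 0 - 2)) / 12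

/-- The program for `F`. -/
def countProg : Prog :=
  .seq (.store 1 1) (.seq (.assign 1 1) (.seq (.whilePos (.reg 0 + 1 - .reg 1) roundProg)
    (.assign 0 (.reg 60 + closedForm))))

/-- The main registers of the sieve. -/
structure SieveVars (D n d : ℕ) (T : ℤ) (s : State) : Prop where
  r0 : s.reg 0 = n
  r1 : s.reg 1 = d
  total : s.reg 60 = T
  all : ∀ i, |s.reg i| ≤ (D : ℤ) ^ 600

theorem Runs.assignSafe {S W D i : ℕ} {e : Expr} {s : State} (hD : 2 ≤ D) (hW : D ^ 610 ≤ W)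
    (hall : ∀ i, |s.reg i| ≤ (D : ℤ) ^ 600) (hs : e.Safe s)
    (hdeg : e.degree (fun _ => 600) ≤ 610) (hv : |e.eval s| ≤ (D : ℤ) ^ 600) :
    Runs S W (.assign i e) s (e.cost + 1) (fun s' =>
      s' = ⟨Function.update s.reg i (e.eval s), s.mem⟩ ∧ ∀ i, |s'.reg i| ≤ (D : ℤ) ^ 600) := by
  refine Runs.assign (hs.ok hD hall ((Nat.pow_le_pow_right (by omega) hdeg).trans hW)) ⟨rfl, ?_⟩
  intro j
  by_cases hj : j = i
  · subst hj
    simpa using hv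
  · simpa [Function.update_of_ne hj] using hall j

theorem natCast_le_pow {D m j : ℕ} (hD : 2 ≤ D) (hj : 2 ≤ j) (h : m ≤ 2 * D) :
    |(m : ℤ)| ≤ (D : ℤ) ^ j := by
  rw [Nat.abs_cast]
  have h1 : D ^ 2 ≤ D ^ j := Nat.pow_le_pow_right (by omega) hj
  have h2 : 2 * D ≤ D ^ 2 := by rw [sq]; exact Nat.mul_le_mul_right _ hD
  exact_mod_cast (h.trans h2).trans h1

theorem runs_sieve {S W D n d : ℕ} {T : ℤ} {s : State} (hDn : n + 2 ≤ D) (hS : n + 1 ≤ S)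
    (hW : D ^ 610 ≤ W) (hd : 1 ≤ d) (hdn : d ≤ n) (hs : SieveVars D n d T s)
    (h61 : s.reg 61 = moebius d) (hmem : ∀ k ≤ n, s.mem k = sieveCell d k) :
    Runs S W sieveProg s (16 * (n / d) + 10) (fun s' => SieveVars D n d T s' ∧
      ∀ k ≤ n, s'.mem k = sieveCell (d + 1) k) := by
  have hD : 2 ≤ D := by omega
  have hDW : D ≤ W := (Nat.le_self_pow (by norm_num) D).trans hW
  have hN1 : 1 ≤ n / d := (Nat.one_le_div_iff (by omega)).2 hdn
  have hcur : ∀ i, i < n / d - 1 → (i + 2) * d ≤ n := fun i hi =>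
    (Nat.mul_le_mul_right d (by omega : i + 2 ≤ n / d)).trans (Nat.div_mul_le_self n d)
  have hcur' : n < (n / d - 1 + 2) * d := by
    have h1 := Nat.lt_div_mul_add (a := n) (b := d) (by omega)
    have h2 : n / d - 1 + 2 = n / d + 1 := by omega
    rw [h2, add_mul, one_mul]
    exact h1
  -- The cursor starts at 2d, hence i + 2; cells below it are up to date for d + 1, the others still
  -- for d.
  let I : ℕ → State → Prop := fun i s' => SieveVars D n d T s' ∧ s'.reg 61 = moebius d ∧
    s'.reg 62 = ((i + 2) * d : ℕ) ∧
    ∀ k ≤ n, s'.mem k = if k < (i + 2) * d then sieveCell (d + 1) k else sieveCell d k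
  have hok : ∀ {s' : State}, (∀ i, |s'.reg i| ≤ (D : ℤ) ^ 600) →
      (Expr.reg 0 + 1 - .reg 62).Ok S W s' := fun hs => by
    refine Expr.Safe.ok hD hs (by simp) ((Nat.pow_le_pow_right (by omega) ?_).trans hW)
    decide
  have hloop := fun (s₁ : State) => Runs.whileCount (S := S) (W := W) (e := .reg 0 + 1 - .reg 62)
    (P := .seq (.store (.reg 62) (.sub (.load (.reg 62)) (.reg 61)))
      (.assign 62 (.reg 62 + .reg 1))) (c := fun _ => 10) (I := I) (n := n / d - 1) (s := s₁)
    ?_ ?_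
  · have h1 := Runs.assignSafe (S := S) (i := 62) (e := .reg 1 + .reg 1) hD hW hs.all (by simp)
      (by decide) (by
        simp only [Expr.eval_add, Expr.eval_reg, hs.r1]
        exact_mod_cast natCast_le_pow hD (by norm_num) (by omega : d + d ≤ 2 * D))
    refine (h1.seq (P' := .whilePos _ _) (T' := (n / d - 1) * 16 + 6)
      (Q := I (n / d - 1)) ?_).weaken ?_ ?_
    · rintro s₁ ⟨heq, hall⟩
      refine (hloop s₁ ⟨⟨?_, ?_, ?_, hall⟩, ?_, ?_, ?_⟩).weaken (by
          rw [Finset.sum_const, Finset.card_range, smul_eq_mul]; exact le_rfl) fun _ h => h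
      · rw [heq]; exact hs.r0
      · rw [heq]; exact hs.r1
      · rw [heq]; exact hs.total
      · rw [heq]; exact h61
      · simp [heq, hs.r1, two_mul]
      · intro k hk
        rw [heq, hmem k hk]
        split_ifs with hlt
        · refine (sieveCell_succ_of_not ?_).symm
          rintro ⟨⟨c, rfl⟩, h⟩
          have h1 : 1 < c := by
            by_contra hc
            have := Nat.mul_le_mul_left d (not_lt.1 hc)
            omega
          have := Nat.mul_le_mul_left d h1
          rw [zero_add, mul_comm 2 d] at hlt
          omega
        · rfl
    · change 4 + ((n / d - 1) * 16 + 6) ≤ _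
      omega
    · rintro s' ⟨hv, _, _, hm⟩
      refine ⟨hv, fun k hk => ?_⟩
      rw [hm k hk, if_pos (by omega)]
  · rintro s' ⟨hv, _, h62, _⟩
    refine ⟨hok hv.all, ?_⟩
    simp only [Expr.eval_sub, Expr.eval_add, Expr.eval_reg, Expr.eval_ofNat, hv.r0, h62]
    omega
  · rintro i hi s' ⟨hv, h61', h62, hm⟩
    have hc := hcur i hi
    refine ⟨hok hv.all, ?_, ?_⟩
    · simp only [Expr.eval_sub, Expr.eval_add, Expr.eval_reg, Expr.eval_ofNat, hv.r0, h62]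
      omega
    · have htoNat : (s'.reg 62).toNat = (i + 2) * d := by rw [h62, Int.toNat_natCast]
      have hcell : s'.mem ((i + 2) * d) = sieveCell d ((i + 2) * d) := by
        rw [hm _ hc, if_neg (lt_irrefl _)]
      have hnew : sieveCell d ((i + 2) * d) - moebius d = sieveCell (d + 1) ((i + 2) * d) := by
        rw [sieveCell_succ, if_pos ⟨Dvd.intro_left _ rfl, by nlinarith⟩]
      have hw : ∀ {x : ℤ}, |x| ≤ D → |x| ≤ W := fun h => h.trans (by exact_mod_cast hDW)
      have hreg62 : |s'.reg 62| ≤ W := hw (by rw [h62, Nat.abs_cast]; exact_mod_cast (by omega))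
      have h1 : Runs S W (.store (.reg 62) (.sub (.load (.reg 62)) (.reg 61))) s' 6
          (fun s₂ => s₂ = ⟨s'.reg, Function.update s'.mem ((i + 2) * d)
            (sieveCell (d + 1) ((i + 2) * d))⟩) := by
        refine Runs.store (a := .reg 62) (e := .sub (.load (.reg 62)) (.reg 61)) hreg62
          ⟨⟨hreg62, ?_, ?_, ?_⟩, ?_, ?_⟩ ?_ ?_ ?_
        · rw [Expr.eval_reg, h62]; positivity
        · rw [Expr.eval_reg, h62]; exact_mod_cast (by omega)
        · rw [Expr.eval_reg, htoNat, hcell]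
          refine hw ((abs_sieveCell_le _ _).trans ?_)
          exact_mod_cast (by omega)
        · change |s'.reg 61| ≤ W
          rw [h61']
          refine hw (ArithmeticFunction.abs_moebius_le_one.trans ?_)
          exact_mod_cast (by omega)
        · change |s'.mem (s'.reg 62).toNat - s'.reg 61| ≤ W
          rw [htoNat, hcell, h61', hnew]
          refine hw ((abs_sieveCell_le _ _).trans ?_)
          exact_mod_cast (by omega)
        · rw [Expr.eval_reg, h62]; positivity
        · rw [Expr.eval_reg, h62]; exact_mod_cast (by omega)
        · change State.mk s'.reg (Function.update s'.mem (s'.reg 62).toNat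
            (s'.mem (s'.reg 62).toNat - s'.reg 61)) = _
          rw [htoNat, hcell, h61', hnew]
      refine (h1.seq (T' := 4) ?_)
      rintro _ rfl
      have heval : (Expr.reg 62 + .reg 1).eval s' = ((i + 1 + 2) * d : ℕ) := by
        simp only [Expr.eval_add, Expr.eval_reg, h62, hv.r1]
        push_cast
        ring
      have h2 := Runs.assignSafe (S := S) (i := 62) (e := .reg 62 + .reg 1)
        (s := ⟨s'.reg, Function.update s'.mem ((i + 2) * d)
            (sieveCell (d + 1) ((i + 2) * d))⟩) hD hW hv.all (by simp)
        (by decide) (by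
          change |(Expr.reg 62 + .reg 1).eval s'| ≤ _
          rw [heval]
          exact natCast_le_pow hD (by norm_num) (by rw [add_right_comm, add_mul]; omega))
      refine h2.weaken le_rfl ?_
      rintro _ ⟨rfl, hall⟩
      refine ⟨⟨hv.r0, hv.r1, hv.total, hall⟩, h61', ?_, ?_⟩
      · exact heval
      · intro k hk
        change Function.update s'.mem ((i + 2) * d) _ k = _
        by_cases hk2 : k = (i + 2) * d
        · subst hk2
          rw [Function.update_self, if_pos (Nat.mul_lt_mul_of_pos_right (by omega) (by omega))]
        · rw [Function.update_of_ne hk2, hm k hk]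
          by_cases hlt : k < (i + 2) * d
          · rw [if_pos hlt, if_pos (by rw [add_right_comm, add_mul]; omega)]
          -- No multiple of d lies strictly between (i+2)d and (i+3)d, so these cells need no
          -- update.
          · rw [if_neg hlt]
            split_ifs with h3
            · refine (sieveCell_succ_of_not ?_).symm
              rintro ⟨⟨c, rfl⟩, -⟩
              rw [mul_comm d c] at h3 hlt hk2
              have h4 := lt_of_mul_lt_mul_right h3 (Nat.zero_le d)
              have h5 := lt_of_mul_lt_mul_right (lt_of_le_of_ne (not_lt.1 hlt) (Ne.symm hk2))
                (Nat.zero_le d)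
              omega
            · rfl

/-- A layer computation leaves the memory and the registers from 51 on untouched, so the sieve and
the total in register 60 survive it. -/
theorem exists_runs_round : ∃ K : ℕ, ∀ {S W D n d : ℕ} {T : ℤ} {s : State} (_ : n + 2 ≤ D)
    (_ : n + 1 ≤ S) (_ : D ^ 610 ≤ W) (_ : 1 ≤ d) (_ : d ≤ n) (_ : SieveVars D n d T s)
    (_ : |T| ≤ (d - 1 : ℕ) * (D : ℤ) ^ 500) (_ : ∀ k ≤ n, s.mem k = sieveCell d k),
    Runs S W roundProg s (K * ((n / d) * (Nat.size (2 * (n / d)) + 1))) (fun s' =>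
      SieveVars D n (d + 1) (T + moebius d * layer d n) s' ∧
      |T + moebius d * layer d n| ≤ d * (D : ℤ) ^ 500 ∧
      ∀ k ≤ n, s'.mem k = sieveCell (d + 1) k) := by
  obtain ⟨K, hK⟩ := exists_runs_layer
  refine ⟨K + 40, fun {S W D n d T s} hDn hS hW hd hdn hs hT hmem => ?_⟩
  have hD : 2 ≤ D := by omega
  have hD' : (1 : ℤ) ≤ D := by exact_mod_cast (by omega : 1 ≤ D)
  have hN1 : 1 ≤ n / d := (Nat.one_le_div_iff (by omega)).2 hdn
  have hW' : ∀ {x : ℤ}, |x| ≤ (D : ℤ) ^ 600 → |x| ≤ W := fun h => by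
    refine h.trans ((pow_le_pow_right₀ hD' (by norm_num : 600 ≤ 610)).trans ?_)
    exact_mod_cast hW
  have hrun : Runs S W roundProg s (K * ((n / d) * (Nat.size (2 * (n / d)) + 1)) +
      (3 + (6 + ((16 * (n / d) + 10) + 4)))) (fun s' =>
      SieveVars D n (d + 1) (T + moebius d * layer d n) s' ∧
      |T + moebius d * layer d n| ≤ d * (D : ℤ) ^ 500 ∧
      ∀ k ≤ n, s'.mem k = sieveCell (d + 1) k) := by
    refine (hK hDn hW hd hdn hs.r0 hs.r1 hs.all).seq fun s₁ ⟨a0, a1, a50, alay, amem, afr, aall⟩ => ?_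
    have hmob : |moebius d| ≤ 1 := ArithmeticFunction.abs_moebius_le_one
    have hT' : |T + moebius d * layer d n| ≤ d * (D : ℤ) ^ 500 := by
      have h1 : |moebius d * layer d n| ≤ (D : ℤ) ^ 500 := by
        rw [abs_mul]
        rw [a50] at alay
        calc |moebius d| * |layer d n| ≤ 1 * |layer d n| := by gcongr
          _ ≤ (D : ℤ) ^ 500 := by rwa [one_mul]
      have h2 : ((d - 1 : ℕ) : ℤ) = d - 1 := by omega
      rw [h2] at hT
      have := abs_add_le T (moebius d * layer d n)
      linarith
    have hT'' : |T + moebius d * layer d n| ≤ (D : ℤ) ^ 600 := by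
      refine hT'.trans ?_
      calc (d : ℤ) * (D : ℤ) ^ 500 ≤ D * (D : ℤ) ^ 500 := by
            gcongr
            exact_mod_cast (by omega)
        _ = (D : ℤ) ^ 501 := (pow_succ' _ _).symm
        _ ≤ (D : ℤ) ^ 600 := pow_le_pow_right₀ hD' (by norm_num)
    have hcell : s₁.mem (s₁.reg 1).toNat = moebius d := by
      rw [a1, Int.toNat_natCast, amem, hmem d hdn, sieveCell_self hd]
    have hmobD : |moebius d| ≤ (D : ℤ) ^ 600 := hmob.trans (one_le_pow₀ hD')
    refine Runs.seq (R := fun s₂ => s₂ = ⟨Function.update s₁.reg 61 (moebius d), s₁.mem⟩)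
      (Runs.assign (e := .load (.reg 1)) ⟨hW' (aall 1), ?_, ?_, ?_⟩ ?_) ?_
    · rw [Expr.eval_reg, a1]; positivity
    · rw [Expr.eval_reg, a1]; exact_mod_cast (by omega)
    · rw [Expr.eval_reg, hcell]; exact hW' hmobD
    · change State.mk (Function.update s₁.reg 61 (s₁.mem (s₁.reg 1).toNat)) s₁.mem = _
      rw [hcell]
    rintro _ rfl
    have all₂ : ∀ i, |Function.update s₁.reg 61 (moebius d) i| ≤ (D : ℤ) ^ 600 := by
      intro i
      by_cases hi : i = 61
      · subst hi
        simpa using hmobD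
      · simpa [Function.update_of_ne hi] using aall i
    have heval : (Expr.reg 60 + .reg 61 * .reg 50).eval
        ⟨Function.update s₁.reg 61 (moebius d), s₁.mem⟩ = T + moebius d * layer d n := by
      simp [a50, afr 60 (by norm_num), hs.total]
    refine Runs.seq (R := fun s₃ => SieveVars D n d (T + moebius d * layer d n) s₃ ∧
      s₃.reg 61 = moebius d ∧ s₃.mem = s₁.mem) (Runs.assign ?_ ⟨⟨?_, ?_, ?_, ?_⟩, ?_, rfl⟩) ?_
    · refine ⟨hW' (all₂ 60), ⟨hW' (all₂ 61), hW' (all₂ 50), ?_⟩, ?_⟩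
      · change |moebius d * s₁.reg 50| ≤ _
        refine hW' ?_
        rw [abs_mul]
        calc _ ≤ 1 * |s₁.reg 50| := by gcongr
          _ ≤ _ := by rw [one_mul]; exact aall 50
      · exact (congrArg abs heval).le.trans (hW' hT'')
    · simpa using a0
    · simpa using a1
    · rw [heval]; simp
    · intro i
      rw [heval]
      by_cases hi : i = 60
      · subst hi
        simpa using hT''
      · simpa [Function.update_of_ne hi] using all₂ i
    · simp
    rintro s₃ ⟨hv₃, h61, hmem₃⟩
    refine (runs_sieve hDn hS hW hd hdn hv₃ h61 fun k hk => by
      rw [hmem₃, amem, hmem k hk]).seq ?_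
    rintro s₄ ⟨hv₄, hmem₄⟩
    have h4 := Runs.assignSafe (S := S) (i := 1) (e := .reg 1 + 1) hD hW hv₄.all (by simp)
      (by decide) (by
        simp only [Expr.eval_add, Expr.eval_reg, Expr.eval_ofNat, hv₄.r1]
        exact_mod_cast natCast_le_pow hD (by norm_num) (by omega : d + 1 ≤ 2 * D))
    refine h4.weaken le_rfl ?_
    rintro _ ⟨rfl, hall⟩
    refine ⟨⟨hv₄.r0, ?_, hv₄.total, hall⟩, hT', hmem₄⟩
    simp [hv₄.r1]
  refine hrun.weaken ?_ fun _ h => h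
  have h1 : n / d ≤ (n / d) * (Nat.size (2 * (n / d)) + 1) := Nat.le_mul_of_pos_right _ (by omega)
  rw [add_mul]
  omega

/-- `F₀` is defined over ℚ, but F - F₁ is an integer; hence the floor division by 12 is exact. -/
theorem closedForm_value (n : ℕ) :
    (3 * ((n : ℤ) * n * ((n - 1) * (n - 1))) + n * ((n - 1) * (n - 1)) * (n - 2)) / 12 =
      F n - F₁ n := by
  have h : (3 * ((n : ℤ) * n * ((n - 1) * (n - 1))) + n * ((n - 1) * (n - 1)) * (n - 2)) =
      12 * (F n - F₁ n) := by
    have h1 := F_eq_F₀_add_F₁ n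
    rw [F₀] at h1
    have h2 : (3 * ((n : ℚ) * n * ((n - 1) * (n - 1))) + n * ((n - 1) * (n - 1)) * (n - 2)) =
        12 * (F n - F₁ n) := by
      rw [h1]
      ring
    exact_mod_cast h2
  rw [h, Int.mul_ediv_cancel_left _ (by norm_num)]

theorem exists_runs_count : ∃ K : ℕ, ∀ n : ℕ, Runs (n + 2) ((n + 2) ^ 610) countProg
    (initState [(n : ℤ)])
    (∑ i ∈ Finset.range n, K * ((n / (i + 1)) * (Nat.size (2 * (n / (i + 1))) + 1)) + K)
    (fun s' => s'.reg 0 = F n) := by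
  obtain ⟨K, hK⟩ := exists_runs_round
  obtain ⟨c, hc⟩ : ∃ c, c = closedForm.cost := ⟨_, rfl⟩
  refine ⟨K + c + 20, fun n => ?_⟩
  obtain ⟨D, hDn⟩ : ∃ D, D = n + 2 := ⟨_, rfl⟩
  rw [← hDn]
  have hD : 2 ≤ D := by omega
  have hD' : (1 : ℤ) ≤ D := by exact_mod_cast (by omega : 1 ≤ D)
  have hD1 : D ≤ D ^ 610 := Nat.le_self_pow (by norm_num) D
  have hone : |(1 : ℤ)| ≤ (D ^ 610 : ℕ) := by
    rw [abs_one]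
    exact_mod_cast (by omega : 1 ≤ D ^ 610)
  let T : ℕ → ℤ := fun i => ∑ d ∈ Finset.Icc 1 i, moebius d * layer d n
  have hok : ∀ {s' : State}, (∀ i, |s'.reg i| ≤ (D : ℤ) ^ 600) →
      (Expr.reg 0 + 1 - .reg 1).Ok D (D ^ 610) s' := fun hs => by
    refine Expr.Safe.ok hD hs (by simp) (Nat.pow_le_pow_right (by omega) ?_)
    decide
  have hall : ∀ i, |(initState [(n : ℤ)]).reg i| ≤ (D : ℤ) ^ 600 := fun i =>
    (abs_initState_le (fun x hx => by
      simp only [List.mem_cons, List.not_mem_nil, or_false] at hx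
      subst hx
      rw [Nat.abs_cast]
      exact_mod_cast (by omega : n ≤ D)) i).trans (le_self_pow₀ hD' (by norm_num))
  have hrun : Runs D (D ^ 610) countProg (initState [(n : ℤ)])
      (3 + (2 + ((∑ i ∈ Finset.range n,
        (6 + K * ((n / (i + 1)) * (Nat.size (2 * (n / (i + 1))) + 1))) + 6) + (c + 3))))
      (fun s' => s'.reg 0 = F n) := by
    refine Runs.seq (R := fun s₁ => s₁ = ⟨(initState [(n : ℤ)]).reg,
      Function.update (fun _ => 0) 1 1⟩) (Runs.store (a := 1) (e := 1) hone hone ?_ ?_ rfl) ?_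
    · simp
    -- Cell 1 is written even for n = 0, which is why n + 2 cells are provided.
    · simp only [Expr.eval_ofNat]
      exact_mod_cast (by omega : 1 < D)
    rintro _ rfl
    refine (Runs.assignSafe (i := 1) (e := 1)
      (s := ⟨(initState [(n : ℤ)]).reg, Function.update (fun _ => 0) 1 1⟩) hD le_rfl hall (by simp) (by decide) ?_).seq ?_
    · simp only [Expr.eval_ofNat]
      exact natCast_le_pow hD (by norm_num) (by omega)
    rintro _ ⟨rfl, hall₂⟩
    refine (Runs.whileCount (e := .reg 0 + 1 - .reg 1) (P := roundProg)
      (c := fun i => K * ((n / (i + 1)) * (Nat.size (2 * (n / (i + 1))) + 1)))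
      (I := fun i s' => SieveVars D n (i + 1) (T i) s' ∧ |T i| ≤ i * (D : ℤ) ^ 500 ∧
        ∀ k ≤ n, s'.mem k = sieveCell (i + 1) k) (n := n) ?_ ?_
      ⟨⟨rfl, rfl, rfl, hall₂⟩, by simp [T], fun k _ => ?_⟩).seq (T' := c + 3) ?_
    · rintro s' ⟨hv, -, -⟩
      refine ⟨hok hv.all, ?_⟩
      simp only [Expr.eval_sub, Expr.eval_add, Expr.eval_reg, Expr.eval_ofNat, hv.r0, hv.r1]
      omega
    · rintro i hi s' ⟨hv, hT, hm⟩
      refine ⟨hok hv.all, ?_, ?_⟩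
      · simp only [Expr.eval_sub, Expr.eval_add, Expr.eval_reg, Expr.eval_ofNat, hv.r0, hv.r1]
        omega
      · have hsucc : T (i + 1) = T i + moebius (i + 1) * layer (i + 1) n :=
          Finset.sum_Icc_succ_top (by omega) _
        rw [hsucc]
        exact hK (by omega) (by omega) le_rfl (by omega) hi hv (by simpa using hT) hm
    · rw [sieveCell_one]
      by_cases hk : k = 1
      · subst hk; simp
      · simp [hk]
    · rintro s' ⟨hv, hT, -⟩
      rw [hc]
      -- Register 0 gets exponent 1 here: with exponent 600 the products in the closed form would
      -- exceed the word bound.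
      have hβ : ∀ i, |s'.reg i| ≤ (D : ℤ) ^ (if i = 0 then 1 else 600) := fun i => by
        split_ifs with hi
        · rw [hi, hv.r0, Nat.abs_cast, pow_one]
          exact_mod_cast (by omega)
        · exact hv.all i
      refine (Runs.assign (i := 0) (e := .reg 60 + closedForm) (Expr.Safe.ok hD hβ ?_
        (Nat.pow_le_pow_right (by omega) ?_)) ?_).weaken ?_ fun _ h => h
      · simp [closedForm]
      · decide
      · simp only [closedForm, Expr.eval_sub, Expr.eval_add, Expr.eval_mul, Expr.eval_div,
          Expr.eval_reg, Expr.eval_ofNat, hv.r0, hv.total, Function.update_self]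
        have := closedForm_value n
        push_cast
        rw [this]
        simp only [T]
        rw [← F₁_eq_sum_moebius]
        ring
      · change 1 + closedForm.cost + 1 + 1 ≤ _
        omega
  refine hrun.weaken ?_ fun _ h => h
  have hsum : ∑ i ∈ Finset.range n,
      (6 + K * ((n / (i + 1)) * (Nat.size (2 * (n / (i + 1))) + 1))) ≤
      ∑ i ∈ Finset.range n, (K + c + 20) * ((n / (i + 1)) * (Nat.size (2 * (n / (i + 1))) + 1)) := by
    refine Finset.sum_le_sum fun i hi => ?_
    have h1 : 1 ≤ n / (i + 1) := (Nat.one_le_div_iff (by omega)).2 (Finset.mem_range.1 hi)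
    have h2 : n / (i + 1) ≤ (n / (i + 1)) * (Nat.size (2 * (n / (i + 1))) + 1) :=
      Nat.le_mul_of_pos_right _ (by omega)
    simp only [add_mul _ _ ((n / (i + 1)) * (Nat.size (2 * (n / (i + 1))) + 1))]
    omega
  omega

/-! ### The harmonic sum over the layers -/

theorem sum_div_mul_size_le {n : ℕ} (hn : 2 ≤ n) :
    (∑ i ∈ Finset.range n, (n / (i + 1)) * (Nat.size (2 * (n / (i + 1))) + 1) : ℕ) ≤
      48 * (n * Real.log n ^ 2) := by
  have hn' : (2 : ℝ) ≤ n := by exact_mod_cast hn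
  have hlog2 : (1 : ℝ) / 2 ≤ Real.log 2 := by linarith [Real.log_two_gt_d9]
  have hlog : (1 : ℝ) / 2 ≤ Real.log n := hlog2.trans (Real.log_le_log (by norm_num) hn')
  -- This is n + 1 ≤ n², valid from n = 2 on.
  have hlog' : Real.log (n + 1) ≤ 2 * Real.log n := by
    rw [← Nat.cast_ofNat, ← Real.log_pow]
    exact Real.log_le_log (by positivity) (by nlinarith)
  have hterm : ∀ i ∈ Finset.range n,
      (((n / (i + 1)) * (Nat.size (2 * (n / (i + 1))) + 1) : ℕ) : ℝ) ≤
        16 * n * Real.log n * ((i : ℝ) + 1)⁻¹ := by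
    intro i hi
    have h1 : 1 ≤ n / (i + 1) := (Nat.one_le_div_iff (by omega)).2 (Finset.mem_range.1 hi)
    have h2 := natSize_two_mul_le h1
    have h3 : ((n / (i + 1) : ℕ) : ℝ) ≤ n := by exact_mod_cast Nat.div_le_self _ _
    have h4 : Real.log ((n / (i + 1) : ℕ) + 1) ≤ Real.log (n + 1) :=
      Real.log_le_log (by positivity) (by linarith)
    have h5 : ((n / (i + 1) : ℕ) : ℝ) ≤ n * ((i : ℝ) + 1)⁻¹ := by
      rw [← div_eq_mul_inv]
      exact_mod_cast Nat.cast_div_le (α := ℝ) (m := n) (n := i + 1)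
    push_cast
    calc _ ≤ (n * ((i : ℝ) + 1)⁻¹) * (16 * Real.log n) :=
          mul_le_mul h5 (by linarith) (by positivity) (by positivity)
      _ = _ := by ring
  have hharm : ∑ i ∈ Finset.range n, ((i : ℝ) + 1)⁻¹ ≤ 1 + Real.log n := by
    have := harmonic_le_one_add_log n
    simpa [harmonic] using this
  rw [Nat.cast_sum]
  calc _ ≤ ∑ i ∈ Finset.range n, 16 * n * Real.log n * ((i : ℝ) + 1)⁻¹ :=
        Finset.sum_le_sum hterm
    _ ≤ 16 * n * Real.log n * (1 + Real.log n) := by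
        rw [← Finset.mul_sum]
        exact mul_le_mul_of_nonneg_left hharm (by positivity)
    -- 1 ≤ 2 log n for n ≥ 2, so the harmonic sum is at most 3 log n.
    _ ≤ 16 * n * Real.log n * (3 * Real.log n) :=
        mul_le_mul_of_nonneg_left (by linarith) (by positivity)
    _ = _ := by ring

theorem count_program :
    ∃ (P : Prog) (C : ℝ) (k : ℕ), ∀ n : ℕ, ∃ t S : ℕ,
      Outputs P [(n : ℤ)] [(F n : ℤ)] t S ((n + 2) ^ k) ∧
      (2 ≤ n → (t : ℝ) ≤ C * (n * Real.log n ^ 2) ∧ (S : ℝ) ≤ C * n) := by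
  obtain ⟨K, hK⟩ := exists_runs_count
  -- 48K for the layers, 2K for the additive K because 1 ≤ 2n log² n, and 2 because n + 2 ≤ 2n cells
  -- are used.
  refine ⟨countProg, 50 * K + 2, 610, fun n => ?_⟩
  obtain ⟨t, s', ht, hx, h0⟩ := hK n
  refine ⟨t, n + 2, ⟨s', hx, fun i hi => ?_⟩, fun hn => ⟨?_, ?_⟩⟩
  · have : i = 0 := by simpa using hi
    subst this
    exact h0
  · have h1 := sum_div_mul_size_le hn
    rw [← Finset.mul_sum] at ht
    have ht' : (t : ℝ) ≤ K * (∑ i ∈ Finset.range n,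
        (n / (i + 1)) * (Nat.size (2 * (n / (i + 1))) + 1) : ℕ) + K := by exact_mod_cast ht
    have hn' : (2 : ℝ) ≤ n := by exact_mod_cast hn
    have hlog : (1 : ℝ) / 2 ≤ Real.log n := by
      have := Real.log_le_log (by norm_num) hn'
      linarith [Real.log_two_gt_d9]
    have h2 : (1 : ℝ) ≤ 2 * (n * Real.log n ^ 2) := by nlinarith
    have h3 := mul_le_mul_of_nonneg_left h1 (by positivity : (0 : ℝ) ≤ K)
    have h4 := mul_le_mul_of_nonneg_left h2 (by positivity : (0 : ℝ) ≤ K)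
    nlinarith
  · have hn' : (2 : ℝ) ≤ n := by exact_mod_cast hn
    have hK0 : (0 : ℝ) ≤ K := by positivity
    push_cast
    nlinarith

end LatticeRect

theorem mainTheorem2 :
    -- one value: `O(n log² n)` operations and `O(n)` memory, on words of `O(log n)` bits
    (∃ (P : LatticeRect.Prog) (C : ℝ) (k : ℕ), ∀ n : ℕ, ∃ t S : ℕ,
      LatticeRect.Outputs P [(n : ℤ)] [(LatticeRect.F n : ℤ)] t S ((n + 2) ^ k) ∧
      (2 ≤ n → (t : ℝ) ≤ C * (n * Real.log n ^ 2) ∧ (S : ℝ) ≤ C * n)) ∧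
    -- the decomposition into Möbius divisor layers
    (∀ n : ℕ, (LatticeRect.F n : ℚ) = LatticeRect.F₀ n + LatticeRect.F₁ n) ∧
    (∀ n : ℕ, LatticeRect.F₁ n =
      ∑ d ∈ Finset.Icc 1 n, ArithmeticFunction.moebius d * LatticeRect.layer d n) ∧
    -- the disjoint square-root cover
    (∀ N : ℕ,
      LatticeRect.region N =
        LatticeRect.smallSides N (Nat.sqrt N) ∪ LatticeRect.smallDirections N (Nat.sqrt N) ∧
      Disjoint (LatticeRect.smallSides N (Nat.sqrt N))
        (LatticeRect.smallDirections N (Nat.sqrt N))) ∧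
    -- the formula for one layer
    (∀ n d : ℕ, 1 ≤ d → d ≤ n →
      LatticeRect.layer d n =
        ∑ p ∈ Finset.Icc 1 (Nat.sqrt (n / d)), ∑ q ∈ Finset.Ico 1 p,
          (8 * LatticeRect.Phi n d p q - 6 * LatticeRect.Delta n d p q
            - 4 * LatticeRect.PhiCap n d p q + 2 * LatticeRect.DeltaCap n d p q)
        + ∑ t ∈ Finset.Icc 1 (Nat.sqrt (n / d)), LatticeRect.diagSide n d t) ∧
    -- the six-state floor-sum kernel in `O(log m)` operations
    (∃ (P : LatticeRect.Prog) (C : ℝ) (k : ℕ), ∀ N m a b : ℕ, 1 ≤ m → ∃ t S : ℕ,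
      LatticeRect.Outputs P [(N : ℤ), (m : ℤ), (a : ℤ), (b : ℤ)]
        [(LatticeRect.floorMoment 0 1 N m a b : ℤ), (LatticeRect.floorMoment 1 1 N m a b : ℤ),
          (LatticeRect.floorMoment 2 1 N m a b : ℤ), (LatticeRect.floorMoment 0 2 N m a b : ℤ),
          (LatticeRect.floorMoment 1 2 N m a b : ℤ), (LatticeRect.floorMoment 0 3 N m a b : ℤ)]
        t S ((N + m + a + b + 2) ^ k) ∧
      (t : ℝ) ≤ C * Real.log (m + 1) ∧ (S : ℝ) ≤ C * Real.log (m + 1)) ∧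
    -- one layer in `O(N_d log N_d)` operations and `O(N_d)` memory, where `N_d = ⌊n/d⌋`
    (∃ (P : LatticeRect.Prog) (C : ℝ) (k : ℕ), ∀ n d : ℕ, 1 ≤ d → d ≤ n → ∃ t S : ℕ,
      LatticeRect.Outputs P [(n : ℤ), (d : ℤ)] [LatticeRect.layer d n] t S ((n + 2) ^ k) ∧
      (t : ℝ) ≤ C * ((n / d : ℕ) * Real.log ((n / d : ℕ) + 1)) ∧
      (S : ℝ) ≤ C * (n / d : ℕ)) := by
  exact ⟨LatticeRect.count_program, LatticeRect.F_eq_F₀_add_F₁, LatticeRect.F₁_eq_sum_moebius,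
    fun N => ⟨LatticeRect.region_eq_union N, LatticeRect.disjoint_smallSides_smallDirections N _⟩,
    fun n d _ _ => LatticeRect.layer_formula n d, LatticeRect.floorMoment_program,
    LatticeRect.layer_program⟩
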